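/- Let $L>0$ and let $\Lambda=\mathbb T^3=(\mathbb R/L\mathbb Z)^3$. Let $V:\mathbb R^3\times\mathbb R^3\to[0,\infty)$ be smooth and compactly supported with $V(x,y)=V(y,x)$, and let $\beta<\frac18$. For $N\ge 1$ let $V_N$ be the periodic extension to $\Lambda\times\Lambda$ (the sum over all lattice translates) of $N^{6\beta}V(N^\beta x,N^\beta y)$, and let $$H_N=\sum_{j=1}^N(-\Delta_{x_j})+\frac1{N^2}\sum_{1\le i<j<l\le N}V_N(x_i-x_j,x_i-x_l)$$ be the corresponding self-adjoint operator on $L^2(\Lambda^N)$. Let $L^2_s(\Lambda^N)$ be the subspace of permutation-symmetric functions, and put $S_j=\langle\nabla_{x_j}\rangle=(1-\Delta_{x_j})^{1/2}$ and $S^{(1,k)}=\prod_{j=1}^kS_j$ (with $S^{(1,0)}=1$). Quadratic expressions such as $\langle\psi,(N^{-1}H_N+1)^k\psi\rangle$, $\langle\psi,H_N^k\psi\rangle$ and $\|S^{(1,k)}\psi\|^2$ are understood as elements of $[0,\infty]$, being $+\infty$ off the form domain (respectively, off the domain of the operator). (i) For all $c_1\in[0,1)$ and $k\ge1$ there is $N_0(c_1,k)$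 such that for all $N>N_0(c_1,k)$ and all $\psi_N\in L^2_s(\Lambda^N)$ $$\big\langle\psi_N,(N^{-1}H_N+1)^k\psi_N\big\rangle\ \ge\ c_1^k\Big(\big\|S^{(1,k)}\psi_N\big\|_{L^2}^2+\frac1N\big\|S_1S^{(1,k-1)}\psi_N\big\|_{L^2}^2\Big).$$ Here, for every $k\ge 1$, $N_0(c_1,k)\to\infty$ as $c_1\to1^-$. (ii) For every $C>0$ there is $C'>0$ such that for every $k\ge1$ there is $N_1$ with the following property. Let $N>N_1$, let $\psi_N:\mathbb R\to L^2_s(\Lambda^N)$ be a (strong) solution of $i\partial_t\psi_N=H_N\psi_N$ with $\|\psi_N(0)\|_{L^2}=1$ and $$\langle\psi_N(0),H_N^j\psi_N(0)\rangle\le C^jN^j\qquad\text{for all }j\ge1,$$ and let $\gamma_N^{(k)}(t)=\mathrm{Tr}_{x_{k+1},\dots,x_N}|\psi_N(t)\rangle\langle\psi_N(t)|$ be its $k$-particle marginal density. Then for every $t\in\mathbb R$ the operator $S^{(1,k)}\gamma_N^{(k)}(t)S^{(1,k)}$ extends to a nonnegative bounded operator on $L^2(\Lambda^k)$ with $$S^{(1,k)}\gamma_N^{(k)}(t)S^{(1,k)}\le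 (C')^k\quad\text{and}\quad \mathrm{Tr}\,S^{(1,k)}\gamma_N^{(k)}(t)S^{(1,k)}\le (C')^k .$$ -/

import Mathlib

open MeasureTheory Filter Topology Set
open scoped ENNReal ContDiff ComplexConjugate InnerProductSpace

noncomputable section

namespace QuinticBose

/-! ### Unbounded operators on a complex Hilbert space -/

section Operators

variable {E : Type*} [NormedAddCommGroup E] [InnerProductSpace ℂ E]

/-- The composition `g ∘ f` of two unbounded operators, with its maximal domain
`{ψ ∈ D(f) | f ψ ∈ D(g)}`. -/
def opComp (g f : E →ₗ.[ℂ] E) : E →ₗ.[ℂ] E :=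
  g.comp (f.domRestrict ((g.domain.comap f.toFun).map f.domain.subtype)) (by
    rintro ⟨x, hx⟩
    obtain ⟨⟨y, hy, hyx⟩, hf⟩ := hx
    subst hyx
    exact hy)

/-- The power `A ^ m` of an unbounded operator, with its natural domain. -/
def opPow (A : E →ₗ.[ℂ] E) : ℕ → (E →ₗ.[ℂ] E)
  | 0 => (LinearMap.id : E →ₗ[ℂ] E).toPMap ⊤
  | m + 1 => opComp A (opPow A m)

open Classical in
/-- `‖A ψ‖²` as an extended number for every vector `ψ`: it is `∞` off the domain of `A`. -/
def opNormSq (A : E →ₗ.[ℂ] E) (ψ : E) : ℝ≥0∞ :=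
  if h : ψ ∈ A.domain then ‖A ⟨ψ, h⟩‖ₑ ^ 2 else ⊤

open Classical in
/-- The expectation `⟨ψ, A ^ k ψ⟩ ∈ [0, ∞]` of a power of a nonnegative self-adjoint operator `A`
whose closed quadratic form is `q`, for every vector `ψ`.
It is `‖A ^ m ψ‖²` if `k = 2 m` and `⟨A ^ m ψ, A (A ^ m ψ)⟩ = q (A ^ m ψ)` if `k = 2 m + 1`;
it is `∞` if `ψ` is not in the form domain of `A ^ k`. -/
def powExpectation (A : E →ₗ.[ℂ] E) (q : E → ℝ≥0∞) (k : ℕ) (ψ : E) : ℝ≥0∞ :=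
  if h : ψ ∈ (opPow A (k / 2)).domain then
    (if Even k then ‖opPow A (k / 2) ⟨ψ, h⟩‖ₑ ^ 2 else q (opPow A (k / 2) ⟨ψ, h⟩))
  else ⊤

/-- `ψ` is a (strong) solution of the Schrödinger equation `i ∂ₜ ψ = H ψ` on `ℝ`. -/
def IsSchrodingerSolution (H : E →ₗ.[ℂ] E) (ψ : ℝ → E) : Prop :=
  ∀ t : ℝ, ∃ h : ψ t ∈ H.domain, HasDerivAt ψ (-(Complex.I • H ⟨ψ t, h⟩)) t

/-- The maximal domain `{ψ | ∑ i, |m i|² |⟨b i, ψ⟩|² < ∞}` of the operator which is diagonal in the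
orthonormal basis `b` with real eigenvalues `m`. -/
def diagonalDomain {ι : Type*} (b : HilbertBasis ι ℂ E) (m : ι → ℝ) : Submodule ℂ E where
  carrier := {ψ | Memℓp (fun i => (m i : ℂ) * b.repr ψ i) 2}
  add_mem' := by
    intro x y hx hy
    have h : (fun i => (m i : ℂ) * b.repr (x + y) i)
        = (fun i => (m i : ℂ) * b.repr x i) + (fun i => (m i : ℂ) * b.repr y i) := by
      funext i
      simp [mul_add]
    show Memℓp _ 2
    rw [h]
    exact Memℓp.add hx hy
  zero_mem' := by
    have h : (fun i => (m i : ℂ) * b.repr (0 : E) i) = 0 := by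
      funext i
      simp
    show Memℓp _ 2
    rw [h]
    exact zero_memℓp
  smul_mem' := by
    intro c x hx
    have h : (fun i => (m i : ℂ) * b.repr (c • x) i)
        = c • (fun i => (m i : ℂ) * b.repr x i) := by
      funext i
      simp [mul_left_comm]
    show Memℓp _ 2
    rw [h]
    exact Memℓp.const_smul hx c

/-- The coefficients `m i ⟨b i, ψ⟩`, as an element of `ℓ²`. -/
def diagonalCoeff {ι : Type*} (b : HilbertBasis ι ℂ E) (m : ι → ℝ) :
    diagonalDomain b m →ₗ[ℂ] lp (fun _ : ι => ℂ) 2 where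
  toFun ψ := ⟨fun i => (m i : ℂ) * b.repr (ψ : E) i, ψ.2⟩
  map_add' x y := by
    apply lp.ext
    funext i
    show (m i : ℂ) * b.repr ((x : E) + (y : E)) i
      = (m i : ℂ) * b.repr (x : E) i + (m i : ℂ) * b.repr (y : E) i
    simp [mul_add]
  map_smul' c x := by
    apply lp.ext
    funext i
    show (m i : ℂ) * b.repr (c • (x : E)) i = c • ((m i : ℂ) * b.repr (x : E) i)
    simp [mul_left_comm]

/-- The operator `ψ ↦ ∑ i, m i ⟨b i, ψ⟩ b i`, on its maximal domain. -/
def diagonalOp {ι : Type*} (b : HilbertBasis ι ℂ E) (m : ι → ℝ) : E →ₗ.[ℂ] E where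
  domain := diagonalDomain b m
  toFun := b.repr.symm.toLinearEquiv.toLinearMap ∘ₗ diagonalCoeff b m

end Operators

/-! ### `L²` on tori: Fourier multipliers and multiplication operators -/

/- The measure on `ℝ / ℤ` is the Haar probability measure, as in Mathlib's Fourier analysis on
`UnitAddTorus` (and it is also the pushforward of Lebesgue measure on `[0, 1)`). -/
attribute [local instance] instMeasureSpaceUnitAddCircle

/-- `L²` of the torus with coordinates indexed by `d`. -/
abbrev L2 (d : Type) [Fintype d] : Type :=
  Lp ℂ 2 (volume : Measure (UnitAddTorus d))

section Torus

variable {d : Type} [Fintype d]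

/-- The Fourier multiplier operator with real symbol `m`, on its maximal domain
`{ψ | ∑ ξ, |m ξ|² |ψ̂ ξ|² < ∞}`, where `ψ̂ ξ` are the Fourier coefficients of `ψ`. -/
def fourierMultiplier (m : (d → ℤ) → ℝ) : L2 d →ₗ.[ℂ] L2 d :=
  diagonalOp UnitAddTorus.mFourierBasis m

/-- Multiplication by the real function `U`, on its maximal domain `{ψ | U ψ ∈ L²}`. -/
def multiplication (U : UnitAddTorus d → ℝ) : L2 d →ₗ.[ℂ] L2 d where
  domain :=
    { carrier := {ψ | MemLp (fun x => (U x : ℂ) * ψ x) 2 volume}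
      add_mem' := by
        intro a b ha hb
        refine (memLp_congr_ae ?_).mp (MemLp.add ha hb)
        filter_upwards [Lp.coeFn_add a b] with x hx
        simp only [hx, Pi.add_apply, mul_add]
      zero_mem' := by
        refine (memLp_congr_ae ?_).mp (MemLp.zero (ε := ℂ))
        filter_upwards [Lp.coeFn_zero ℂ 2 (volume : Measure (UnitAddTorus d))] with x hx
        simp only [hx, Pi.zero_apply, mul_zero]
      smul_mem' := by
        intro c a ha
        refine (memLp_congr_ae ?_).mp (MemLp.const_smul ha c)
        filter_upwards [Lp.coeFn_smul c a] with x hx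
        simp only [hx, Pi.smul_apply, smul_eq_mul, mul_left_comm] }
  toFun :=
    { toFun := fun ψ => MemLp.toLp _ ψ.2
      map_add' := by
        intro a b
        rw [← MemLp.toLp_add]
        refine MemLp.toLp_congr _ _ ?_
        filter_upwards [Lp.coeFn_add (a : L2 d) (b : L2 d)] with x hx
        simp only [Submodule.coe_add, hx, Pi.add_apply, mul_add]
      map_smul' := by
        intro c a
        rw [RingHom.id_apply, ← MemLp.toLp_const_smul]
        refine MemLp.toLp_congr _ _ ?_
        filter_upwards [Lp.coeFn_smul c (a : L2 d)] with x hx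
        simp only [Submodule.coe_smul, hx, Pi.smul_apply, smul_eq_mul, mul_left_comm] }

/-- The trace `∑ ξ, ⟨e_ξ, G e_ξ⟩ ∈ [0, ∞]` of a positive bounded operator `G` on `L²` of the torus,
computed in the orthonormal basis of plane waves. -/
def posTrace (G : L2 d →L[ℂ] L2 d) : ℝ≥0∞ :=
  ∑' ξ : d → ℤ, ENNReal.ofReal
    (RCLike.re ⟪UnitAddTorus.mFourierBasis ξ, G (UnitAddTorus.mFourierBasis ξ)⟫_ℂ)

end Torus

/-! ### The `N`-body system

The physical torus is `Λ = (ℝ / L ℤ)³`. A point of `Λ` is written `L θ` with `θ ∈ (ℝ / ℤ)³`, and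
functions on `Λ ^ N` are functions of `θ`. Hence `ξ ∈ ℤ³` is the frequency `2 π ξ / L`, and the
volume of `Λ` is normalized to one. -/

/-- `L²(Λ ^ N)`. -/
abbrev L2N (N : ℕ) : Type := L2 (Fin N × Fin 3)

/-- The symbol `|2 π ξ_j / L|²` of `-Δ_{x_j}`. -/
def laplaceSymbol (L : ℝ) {N : ℕ} (j : Fin N) (ξ : Fin N × Fin 3 → ℤ) : ℝ :=
  ∑ a : Fin 3, (2 * Real.pi / L * (ξ (j, a) : ℝ)) ^ 2

/-- The symbol `⟨2 π ξ_j / L⟩` of `S_j = ⟨∇_{x_j}⟩ = (1 - Δ_{x_j}) ^ (1 / 2)`. -/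
def japaneseSymbol (L : ℝ) {N : ℕ} (j : Fin N) (ξ : Fin N × Fin 3 → ℤ) : ℝ :=
  Real.sqrt (1 + laplaceSymbol L j ξ)

/-- `S^{(1,k)} = ∏_{j ≤ k} ⟨∇_{x_j}⟩` on `L²(Λ ^ N)`. -/
def S (L : ℝ) (N k : ℕ) : L2N N →ₗ.[ℂ] L2N N :=
  fourierMultiplier fun ξ =>
    ∏ j ∈ Finset.univ.filter (fun j : Fin N => j.val < k), japaneseSymbol L j ξ

/-- `S_1 S^{(1,k)}` on `L²(Λ ^ N)`. -/
def S₁S (L : ℝ) (N k : ℕ) : L2N N →ₗ.[ℂ] L2N N :=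
  fourierMultiplier fun ξ =>
    (∏ j ∈ Finset.univ.filter (fun j : Fin N => j.val < 1), japaneseSymbol L j ξ) *
      ∏ j ∈ Finset.univ.filter (fun j : Fin N => j.val < k), japaneseSymbol L j ξ

/-- The representative in `[0, 1)³` of a point of `(ℝ / ℤ)³`. -/
def torusRep (θ : UnitAddTorus (Fin 3)) : Fin 3 → ℝ :=
  fun a => (AddCircle.equivIco (1 : ℝ) 0 (θ a) : ℝ)

/-- `V_N(x, y) = N^{6 β} V(N^β x, N^β y)`, extended periodically to `Λ × Λ` by summing over
the lattice `(L ℤ)³ × (L ℤ)³`. -/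
def VN (V : (Fin 3 → ℝ) × (Fin 3 → ℝ) → ℝ) (β L : ℝ) (N : ℕ) (θ η : UnitAddTorus (Fin 3)) : ℝ :=
  ∑' p : (Fin 3 → ℤ) × (Fin 3 → ℤ),
    (N : ℝ) ^ (6 * β) *
      V (fun a => (N : ℝ) ^ β * (L * (torusRep θ a + (p.1 a : ℝ))),
         fun a => (N : ℝ) ^ β * (L * (torusRep η a + (p.2 a : ℝ))))

/-- The position of the `j`-th particle. -/
def particle {N : ℕ} (x : UnitAddTorus (Fin N × Fin 3)) (j : Fin N) : UnitAddTorus (Fin 3) :=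
  fun a => x (j, a)

/-- The interaction `N⁻² ∑_{i < j < l} V_N(x_i - x_j, x_i - x_l)`. -/
def interaction (V : (Fin 3 → ℝ) × (Fin 3 → ℝ) → ℝ) (β L : ℝ) (N : ℕ)
    (x : UnitAddTorus (Fin N × Fin 3)) : ℝ :=
  1 / (N : ℝ) ^ 2 * ∑ i : Fin N, ∑ j ∈ Finset.Ioi i, ∑ l ∈ Finset.Ioi j,
    VN V β L N (particle x i - particle x j) (particle x i - particle x l)

/-- The `N`-body Hamiltonian `H_N = ∑ⱼ (-Δ_{x_j}) + N⁻² ∑_{i<j<l} V_N(x_i - x_j, x_i - x_l)`. -/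
def hamiltonian (V : (Fin 3 → ℝ) × (Fin 3 → ℝ) → ℝ) (β L : ℝ) (N : ℕ) : L2N N →ₗ.[ℂ] L2N N :=
  fourierMultiplier (fun ξ => ∑ j : Fin N, laplaceSymbol L j ξ) +
    multiplication (interaction V β L N)

/-- The closed quadratic form of `H_N`:
`⟨ψ, H_N ψ⟩ = ∑ⱼ ‖∇_{x_j} ψ‖² + N⁻² ∑_{i<j<l} ∫ V_N(x_i - x_j, x_i - x_l) |ψ|²`. -/
def energyForm (V : (Fin 3 → ℝ) × (Fin 3 → ℝ) → ℝ) (β L : ℝ) (N : ℕ) (ψ : L2N N) : ℝ≥0∞ :=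
  (∑ j : Fin N, opNormSq (fourierMultiplier fun ξ => Real.sqrt (laplaceSymbol L j ξ)) ψ) +
    ∫⁻ x, ENNReal.ofReal (interaction V β L N x) * ‖ψ x‖ₑ ^ 2

/-- The operator `N⁻¹ H_N + 1`. -/
def shiftedHamiltonian (V : (Fin 3 → ℝ) × (Fin 3 → ℝ) → ℝ) (β L : ℝ) (N : ℕ) :
    L2N N →ₗ.[ℂ] L2N N :=
  (N : ℂ)⁻¹ • hamiltonian V β L N + (LinearMap.id : L2N N →ₗ[ℂ] L2N N).toPMap ⊤

/-- The closed quadratic form of `N⁻¹ H_N + 1`. -/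
def shiftedEnergyForm (V : (Fin 3 → ℝ) × (Fin 3 → ℝ) → ℝ) (β L : ℝ) (N : ℕ) (ψ : L2N N) : ℝ≥0∞ :=
  (N : ℝ≥0∞)⁻¹ * energyForm V β L N ψ + ‖ψ‖ₑ ^ 2

/-- `ψ ∈ L²_s(Λ ^ N)`: invariance under all permutations of the particles. -/
def IsBosonic {N : ℕ} (ψ : L2N N) : Prop :=
  ∀ σ : Equiv.Perm (Fin N), (fun x => ψ (fun p => x (σ p.1, p.2))) =ᵐ[volume] ψ

/-- The configuration `(x_1, …, x_k, x_{k+1}, …, x_N)` formed of the first `k` and the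
last `N - k` positions. -/
def joinConfig {N k : ℕ} (x : UnitAddTorus (Fin k × Fin 3))
    (y : UnitAddTorus ({j : Fin N // k ≤ j.val} × Fin 3)) : UnitAddTorus (Fin N × Fin 3) :=
  fun p => if h : p.1.val < k then x (⟨p.1.val, h⟩, p.2) else y (⟨p.1, not_lt.mp h⟩, p.2)

/-- The kernel of the `k`-particle marginal density `γ^{(k)} = Tr_{k+1,…,N} |ψ⟩⟨ψ|`,
`γ^{(k)}(x, x') = ∫ ψ(x, y) conj ψ(x', y) dy`. -/
def marginal {N : ℕ} (ψ : L2N N) (k : ℕ) (x x' : UnitAddTorus (Fin k × Fin 3)) : ℂ :=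
  ∫ y : UnitAddTorus ({j : Fin N // k ≤ j.val} × Fin 3),
    ψ (joinConfig x y) * conj (ψ (joinConfig x' y))

/-- The sesquilinear form `⟨f, γ g⟩` of the operator with kernel `γ`. -/
def kernelForm {d : Type} [Fintype d] (γ : UnitAddTorus d → UnitAddTorus d → ℂ) (f g : L2 d) : ℂ :=
  ∫ x, ∫ x', conj (f x) * γ x x' * g x'

/-- `S^{(1,k)} γ S^{(1,k)} ≤ M`, for the operator `γ` on `L²(Λ ^ k)` with the given kernel:
`S^{(1,k)} γ S^{(1,k)}` extends to a bounded operator `G` on `L²(Λ ^ k)` which is nonnegative,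
satisfies the operator inequality `G ≤ M`, and moreover is of trace class with trace
at most `M`. -/
def SobolevBound (L : ℝ) (k : ℕ)
    (γ : UnitAddTorus (Fin k × Fin 3) → UnitAddTorus (Fin k × Fin 3) → ℂ) (M : ℝ) : Prop :=
  ∃ G : L2N k →L[ℂ] L2N k,
    (∀ f g : (S L k k).domain, ⟪(f : L2N k), G g⟫_ℂ = kernelForm γ (S L k k f) (S L k k g)) ∧
    0 ≤ G ∧ G ≤ (M : ℂ) • ContinuousLinearMap.id ℂ (L2N k) ∧
    posTrace G ≤ ENNReal.ofReal M

end QuinticBose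

end

noncomputable section

namespace QuinticBose

attribute [local instance] instMeasureSpaceUnitAddCircle

set_option linter.unusedSectionVars false

/-! Write A = N⁻¹ H_N + 1 = T + W, with T the Fourier multiplier N⁻¹ ∑ ⟨ξ_j⟩² and W ≥ 0 the
multiplication by N⁻³ ∑_{i<j<l} V_N. The Fourier coefficients of V_N live at scale R = max(1, N^β)
in six dimensions. Hence multiplication by a single V_N has norm O(R⁶) on L², and each derivative
S_j falling on one of its three particles costs one more factor R
(`InteractionBounds.wsum_mulOp_le`). All errors are governed by ρ = R⁷/N, which tends to zero
because 7β < 1.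

Fix a set J of k particles and let S_J be the product of their derivatives. Triples disjoint from J
commute with S_J. On φ = S_J ψ one expands ‖(T + W_D) φ‖² ≥ ‖T φ‖² + 2 Re⟨T φ, W_D φ⟩. Here Re⟨S_j²
φ, V_t φ⟩ is nonnegative when j ∉ t, since then S_j commutes with V_t, and is at least -C R⁷ ‖S_j
φ‖² when j ∈ t. Each j lies in O(N²) triples, so the loss is O(ρ) ‖T φ‖². Triples meeting J number
O(k N²) and are estimated in norm, at relative cost O(kρ) for fixed k. This gives ‖S_J A ψ‖ ≥ c ‖S_J
T ψ‖ (`InteractionBounds.wsum_shiftedOp_ge`), without any symmetry.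

Averaging over J turns the weight into the elementary symmetric function e_k of the numbers ⟨ξ_j⟩².
Since e_1² e_k dominates (k+1)(k+2) e_{k+2} plus a diagonal term (`esymm_mul_sq_ge`), each factor of
A gains two derivatives in the average norm. Induction in steps of two from k = 0 or 1 gives the
energy estimate. Bosonic symmetry enters only at the end: it identifies the average with ‖S^{(1,k)}
ψ‖² up to a factor tending to 1, and the diagonal term with N⁻¹ ‖S_1 S^{(1,k-1)} ψ‖².

For the dynamics, a strong solution is a priori only in the domain of A, so A^k ψ(t) may be
undefined. The bounded operators A_n = A (1 + A/n)⁻¹ commute with A, hence ‖A_n^k ψ(t)‖ is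
conserved, and the energy moments bound it at t = 0 uniformly in n. As A_n^k = A^k (1 + A/n)^{-k},
the energy estimate controls 2k derivatives of (1 + A/n)^{-k} ψ(t), and n → ∞ is a lower
semicontinuity argument (`InteractionBounds.avgNorm_solution_le`). Finally the marginal is ∑
|u_ζ⟩⟨u_ζ| for the partial Fourier coefficients u_ζ of ψ(t) in the last N - k particles, so the
trace of S γ S is ‖S^{(1,k)} ψ(t)‖² (`sobolevBound_marginal`). -/

instance isAddHaarMeasure_unitAddCircle :
    Measure.IsAddHaarMeasure (volume : Measure UnitAddCircle) :=
  inferInstanceAs (Measure.IsAddHaarMeasure AddCircle.haarAddCircle)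

instance isProbabilityMeasure_unitAddCircle :
    IsProbabilityMeasure (volume : Measure UnitAddCircle) :=
  inferInstanceAs (IsProbabilityMeasure AddCircle.haarAddCircle)

/-! ### Periodization and Poisson summation -/

section Periodization

variable {d : Type} [Fintype d]

/-- The projection of `ℝᵈ` onto the torus. -/
def toTorus (z : d → ℝ) : UnitAddTorus d := fun i => (z i : UnitAddCircle)

/-- The lattice point with integer coordinates `p`. -/
def latticePoint (p : d → ℤ) : d → ℝ := fun i => (p i : ℝ)

theorem toTorus_add_latticePoint (z : d → ℝ) (p : d → ℤ) :
    toTorus (z + latticePoint p) = toTorus z := by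
  funext i
  simp only [toTorus, latticePoint, Pi.add_apply]
  rw [AddCircle.coe_add]
  have : ((p i : ℝ) : UnitAddCircle) = 0 := by
    rw [AddCircle.coe_eq_zero_iff]
    exact ⟨p i, by simp⟩
  rw [this, add_zero]

theorem isOpenQuotientMap_toTorus : IsOpenQuotientMap (toTorus : (d → ℝ) → UnitAddTorus d) :=
  IsOpenQuotientMap.piMap fun _ => QuotientAddGroup.isOpenQuotientMap_mk

/-- The translates of a compactly supported function that do not vanish somewhere in a given
box are finite in number. -/
theorem exists_finset_translate_eq_zero {f : (d → ℝ) → ℂ} (hf : HasCompactSupport f) (B : ℝ) :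
    ∃ s : Finset (d → ℤ), ∀ p ∉ s, ∀ z : d → ℝ, ‖z‖ ≤ B → f (z + latticePoint p) = 0 := by
  obtain ⟨R, hR⟩ := hf.isBounded.exists_norm_le
  obtain ⟨M, hM⟩ := exists_nat_ge (R + B)
  classical
  refine ⟨Fintype.piFinset fun _ => Finset.Icc (-(M : ℤ)) M, fun p hp z hz => ?_⟩
  by_contra hne
  apply hp
  have h1 : ‖z + latticePoint p‖ ≤ R := hR _ (subset_tsupport _ hne)
  have h2 : ‖latticePoint p‖ ≤ M := by
    calc ‖latticePoint p‖ = ‖(z + latticePoint p) - z‖ := by simp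
      _ ≤ ‖z + latticePoint p‖ + ‖z‖ := norm_sub_le _ _
      _ ≤ M := by linarith
  rw [Fintype.mem_piFinset]
  intro i
  have h3 : |(p i : ℝ)| ≤ M := (norm_le_pi_norm (latticePoint p) i).trans h2
  rw [abs_le] at h3
  rw [Finset.mem_Icc]
  exact ⟨by exact_mod_cast h3.1, by exact_mod_cast h3.2⟩

theorem continuous_tsum_translate {f : (d → ℝ) → ℂ} (hf : HasCompactSupport f)
    (hc : Continuous f) : Continuous fun z => ∑' p, f (z + latticePoint p) := by
  rw [continuous_iff_continuousAt]
  intro z₀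
  obtain ⟨s, hs⟩ := exists_finset_translate_eq_zero hf (‖z₀‖ + 1)
  have h : (fun z => ∑' p, f (z + latticePoint p)) =ᶠ[𝓝 z₀]
      fun z => ∑ p ∈ s, f (z + latticePoint p) := by
    filter_upwards [Metric.ball_mem_nhds z₀ one_pos] with z hz
    refine tsum_eq_sum fun p hp => hs p hp z ?_
    have : ‖z - z₀‖ < 1 := by simpa [dist_eq_norm] using hz
    linarith [norm_le_norm_add_norm_sub' z z₀]
  refine ContinuousAt.congr ?_ h.symm
  exact Continuous.continuousAt (by fun_prop)

theorem tsum_translate_add_latticePoint (f : (d → ℝ) → ℂ) (z : d → ℝ) (q : d → ℤ) :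
    ∑' p, f (z + latticePoint q + latticePoint p) = ∑' p, f (z + latticePoint p) := by
  rw [← (Equiv.addLeft q).tsum_eq fun p => f (z + latticePoint p)]
  refine tsum_congr fun p => ?_
  congr 1
  funext i
  simp [latticePoint, add_assoc]

theorem exists_latticePoint_of_toTorus_eq {z w : d → ℝ} (h : toTorus z = toTorus w) :
    ∃ p : d → ℤ, z = w + latticePoint p := by
  have h1 : ∀ i, ∃ p : ℤ, z i = w i + p := by
    intro i
    have h2 : ((z i - w i : ℝ) : UnitAddCircle) = 0 := by
      rw [AddCircle.coe_sub, sub_eq_zero]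
      exact congrFun h i
    rw [AddCircle.coe_eq_zero_iff] at h2
    obtain ⟨n, hn⟩ := h2
    refine ⟨n, ?_⟩
    have : (n : ℝ) = z i - w i := by simpa using hn
    linarith
  choose p hp using h1
  exact ⟨p, funext hp⟩

/-- The sum over translates is locally finite, hence continuous, and lattice periodic, so it
descends through the quotient map onto the torus. -/
theorem exists_periodization {f : (d → ℝ) → ℂ} (hf : HasCompactSupport f) (hc : Continuous f) :
    ∃ F : C(UnitAddTorus d, ℂ), ∀ z, F (toTorus z) = ∑' p, f (z + latticePoint p) := by
  have hq := (isOpenQuotientMap_toTorus (d := d)).isQuotientMap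
  let g : C(d → ℝ, ℂ) := ⟨_, continuous_tsum_translate hf hc⟩
  have hg : Function.FactorsThrough g (toTorus (d := d)) := by
    intro z w hzw
    obtain ⟨p, rfl⟩ := exists_latticePoint_of_toTorus_eq hzw
    exact tsum_translate_add_latticePoint f w p
  let π : C(d → ℝ, UnitAddTorus d) := ⟨toTorus, hq.continuous⟩
  have hq' : IsQuotientMap π := hq
  refine ⟨hq'.lift g hg, fun z => ?_⟩
  have := congrArg (fun h : C(d → ℝ, ℂ) => h z) (hq'.lift_comp g hg)
  exact this

/-- The unit cube with lower corner `p`. -/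
def unitCube (p : d → ℤ) : Set (d → ℝ) := {x | ∀ i, x i ∈ Ioc (p i : ℝ) (p i + 1)}

theorem measurableSet_unitCube (p : d → ℤ) : MeasurableSet (unitCube p) :=
  MeasurableSet.univ_pi' fun _ => measurableSet_Ioc

theorem iUnion_unitCube : ⋃ p : d → ℤ, unitCube p = univ := by
  refine eq_univ_of_forall fun x => mem_iUnion.2 ⟨fun i => ⌈x i⌉ - 1, fun i => ?_⟩
  have h1 := Int.ceil_lt_add_one (x i)
  have h2 := Int.le_ceil (x i)
  push_cast
  exact ⟨by linarith, by linarith⟩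

theorem pairwise_disjoint_unitCube : Pairwise (Function.onFun Disjoint (unitCube (d := d))) := by
  intro p q hpq
  refine Set.disjoint_left.2 fun x hp hq => hpq (funext fun i => ?_)
  have h1 := hp i
  have h2 := hq i
  have h3 : (p i : ℝ) < q i + 1 := h1.1.trans_le h2.2
  have h4 : (q i : ℝ) < p i + 1 := h2.1.trans_le h1.2
  have h5 : p i < q i + 1 := by exact_mod_cast h3
  have h6 : q i < p i + 1 := by exact_mod_cast h4
  omega

theorem setIntegral_unitCube_translate (h : (d → ℝ) → ℂ) (p : d → ℤ) :
    ∫ x in unitCube p, h x = ∫ x in unitCube (0 : d → ℤ), h (x + latticePoint p) := by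
  have h1 := (measurePreserving_add_right (volume : Measure (d → ℝ))
    (latticePoint p)).setIntegral_preimage_emb (measurableEmbedding_addRight _) h (unitCube p)
  rw [← h1]
  congr 2
  ext x
  simp only [unitCube, latticePoint, mem_preimage, mem_ofPred_eq, mem_Ioc, Pi.add_apply,
    Pi.zero_apply, Int.cast_zero]
  refine forall_congr' fun i => ?_
  constructor <;> rintro ⟨h1, h2⟩ <;> constructor <;> linarith

/-- The integral of a compactly supported function is the integral of its periodization over the
unit cube. -/
theorem integral_eq_setIntegral_tsum {h : (d → ℝ) → ℂ} (hs : HasCompactSupport h)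
    (hc : Continuous h) :
    ∫ x, h x = ∫ x in unitCube (0 : d → ℤ), ∑' p, h (x + latticePoint p) := by
  have hint : Integrable h := hc.integrable_of_hasCompactSupport hs
  have h1 := integral_iUnion measurableSet_unitCube pairwise_disjoint_unitCube
    (f := h) (μ := volume) hint.integrableOn
  rw [iUnion_unitCube, setIntegral_univ] at h1
  obtain ⟨s, hsz⟩ := exists_finset_translate_eq_zero hs 1
  have hnorm : ∀ x ∈ unitCube (0 : d → ℤ), ‖x‖ ≤ 1 := by
    intro x hx
    refine (pi_norm_le_iff_of_nonneg zero_le_one).2 fun i => ?_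
    have := hx i
    simp only [Pi.zero_apply, Int.cast_zero, zero_add, mem_Ioc] at this
    rw [Real.norm_eq_abs, abs_le]
    exact ⟨by linarith, this.2⟩
  have h0 : ∀ p ∉ s, ∫ x in unitCube p, h x = 0 := by
    intro p hp
    rw [setIntegral_unitCube_translate]
    exact setIntegral_eq_zero_of_forall_eq_zero fun x hx => hsz p hp x (hnorm x hx)
  rw [h1, tsum_eq_sum h0]
  have h2 : ∫ x in unitCube (0 : d → ℤ), ∑' p, h (x + latticePoint p)
      = ∫ x in unitCube (0 : d → ℤ), ∑ p ∈ s, h (x + latticePoint p) :=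
    setIntegral_congr_fun (measurableSet_unitCube 0) fun x hx =>
      tsum_eq_sum fun p hp => hsz p hp x (hnorm x hx)
  rw [h2, integral_finsetSum]
  · exact Finset.sum_congr rfl fun p _ => setIntegral_unitCube_translate h p
  · intro p _
    exact (hint.comp_add_right (latticePoint p)).integrableOn

/-- The plane wave of frequency `n` on `ℝᵈ`. -/
def planeWave (n : d → ℤ) (z : d → ℝ) : ℂ := UnitAddTorus.mFourier n (toTorus z)

theorem continuous_planeWave (n : d → ℤ) : Continuous (planeWave n) :=
  (UnitAddTorus.mFourier n).continuous.comp isOpenQuotientMap_toTorus.continuous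

theorem planeWave_eq (n : d → ℤ) (z : d → ℝ) :
    planeWave n z = Complex.exp (2 * Real.pi * (∑ i, (n i : ℝ) * z i : ℝ) * Complex.I) := by
  simp only [planeWave, toTorus, UnitAddTorus.mFourier, ContinuousMap.coe_mk, fourier_coe_apply,
    ← Complex.exp_sum]
  congr 1
  push_cast
  rw [Finset.mul_sum, Finset.sum_mul]
  refine Finset.sum_congr rfl fun i _ => ?_
  ring

/-- **Poisson summation** for continuous compactly supported functions on `ℝᵈ`. -/
theorem hasSum_poisson {f : (d → ℝ) → ℂ} (hf : HasCompactSupport f) (hc : Continuous f)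
    (hsum : Summable fun n : d → ℤ => ∫ z, planeWave (-n) z * f z) (z : d → ℝ) :
    HasSum (fun n : d → ℤ => (∫ w, planeWave (-n) w * f w) * UnitAddTorus.mFourier n (toTorus z))
      (∑' p, f (z + latticePoint p)) := by
  obtain ⟨F, hF⟩ := exists_periodization hf hc
  have hcoef : ∀ n, UnitAddTorus.mFourierCoeff F n = ∫ w, planeWave (-n) w * f w := by
    intro n
    rw [UnitAddTorus.mFourierCoeff_eq_integral _ _ 0, integral_eq_setIntegral_tsum
      (h := fun w => planeWave (-n) w * f w) hf.mul_left
      ((continuous_planeWave (-n)).mul hc)]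
    have hset : {x : d → ℝ | ∀ i, x i ∈ Ioc ((0 : d → ℝ) i) ((0 : d → ℝ) i + 1)}
        = unitCube (0 : d → ℤ) := by
      ext x
      simp [unitCube]
    rw [hset]
    refine setIntegral_congr_fun (measurableSet_unitCube 0) fun x _ => ?_
    show planeWave (-n) x • F (toTorus x) = _
    rw [hF, smul_eq_mul, ← tsum_mul_left]
    -- Plane waves of integer frequency are lattice periodic, so they pass inside the sum over
    -- translates.
    refine tsum_congr fun p => ?_
    rw [planeWave, planeWave, toTorus_add_latticePoint]
  have := UnitAddTorus.hasSum_mFourier_series_apply_of_summable (f := F)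
    (by simpa only [funext hcoef] using hsum) (toTorus z)
  rw [hF] at this
  simpa only [hcoef, smul_eq_mul] using this

end Periodization

/-! ### The Fourier coefficients of the scaled interaction -/

section Decay

variable {d : Type} [Fintype d]

/-- A smooth compactly supported function is Schwartz, and so is its Fourier transform. The Schwartz
theory needs an inner product, so the argument runs on Euclidean space, whose norm dominates the sup
norm used here. -/
theorem exists_fourier_decay {g : (d → ℝ) → ℂ} (hs : HasCompactSupport g) (hg : ContDiff ℝ ∞ g)
    (m : ℕ) : ∃ C : ℝ, 0 ≤ C ∧ ∀ ζ : d → ℝ,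
      (1 + ‖ζ‖) ^ m *
        ‖∫ w, Complex.exp (-(2 * Real.pi * (∑ i, ζ i * w i : ℝ) * Complex.I)) * g w‖ ≤ C := by
  let e := EuclideanSpace.equiv d ℝ
  let gE : EuclideanSpace ℝ d → ℂ := fun v => g (e v)
  have hgE : ContDiff ℝ ∞ gE := hg.comp e.contDiff
  have hsE : HasCompactSupport gE := hs.comp_homeomorph e.toHomeomorph
  let G : SchwartzMap (EuclideanSpace ℝ d) ℂ := hsE.toSchwartzMap hgE
  let FG : SchwartzMap (EuclideanSpace ℝ d) ℂ := FourierTransform.fourier G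
  have hdec := SchwartzMap.one_add_le_sup_seminorm_apply (𝕜 := ℝ) (m := (m, 0)) (k := m) (n := 0)
    le_rfl le_rfl FG
  obtain ⟨C, hdec⟩ : ∃ C, ∀ x, (1 + ‖x‖) ^ m * ‖iteratedFDeriv ℝ 0 (⇑FG) x‖ ≤ C := ⟨_, hdec⟩
  refine ⟨C, le_trans (by positivity) (hdec 0), fun ζ => ?_⟩
  · refine le_trans ?_ (hdec (WithLp.toLp 2 ζ))
    rw [norm_iteratedFDeriv_zero]
    have h1 : ‖ζ‖ ≤ ‖(WithLp.toLp 2 ζ : EuclideanSpace ℝ d)‖ := by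
      refine (pi_norm_le_iff_of_nonneg (norm_nonneg _)).2 fun i => ?_
      exact PiLp.norm_apply_le (WithLp.toLp 2 ζ : EuclideanSpace ℝ d) i
    have h2 : FG (WithLp.toLp 2 ζ)
        = ∫ w, Complex.exp (-(2 * Real.pi * (∑ i, ζ i * w i : ℝ) * Complex.I)) * g w := by
      show (FourierTransform.fourier G : SchwartzMap _ ℂ) _ = _
      rw [SchwartzMap.fourier_coe, Real.fourier_eq']
      rw [← (PiLp.volume_preserving_toLp d).integral_comp
        (MeasurableEquiv.toLp 2 (d → ℝ)).measurableEmbedding]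
      refine integral_congr_ae (Eventually.of_forall fun w => ?_)
      show Complex.exp _ • g w = _
      rw [smul_eq_mul]
      congr 2
      simp only [PiLp.inner_apply, RCLike.inner_apply, conj_trivial]
      push_cast
      ring
    rw [h2]
    gcongr

/-- Change of variables w = κz. In dimension six the Jacobian cancels the prefactor N^{6β} of the
interaction. -/
theorem integral_planeWave_comp_smul (g : (d → ℝ) → ℂ) {κ : ℝ} (hκ : 0 < κ) (n : d → ℤ) :
    ∫ z, planeWave (-n) z * g (κ • z) = ((κ ^ Fintype.card d)⁻¹ : ℝ) *
      ∫ w, Complex.exp (-(2 * Real.pi * (∑ i, (n i / κ : ℝ) * w i : ℝ) * Complex.I)) * g w := by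
  have h := Measure.integral_comp_smul (volume : Measure (d → ℝ))
    (fun w => Complex.exp (-(2 * Real.pi * (∑ i, (n i / κ : ℝ) * w i : ℝ) * Complex.I)) * g w) κ
  rw [Module.finrank_fintype_fun_eq_card, abs_of_pos (by positivity)] at h
  rw [← Complex.real_smul, ← h]
  refine integral_congr_ae (Eventually.of_forall fun z => ?_)
  simp only [planeWave_eq]
  congr 2
  rw [← neg_mul]
  congr 1
  rw [← mul_neg]
  congr 1
  rw [← Complex.ofReal_neg, ← Finset.sum_neg_distrib]
  congr 1
  refine Finset.sum_congr rfl fun i _ => ?_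
  simp only [Pi.neg_apply, Int.cast_neg, Pi.smul_apply, smul_eq_mul]
  field_simp

/-- Telescoping comparison of 1/x² with 1/(x(x-1)). -/
theorem sum_range_inv_add_sq_le {μ : ℝ} (hμ : 1 ≤ μ) (M : ℕ) :
    ∑ k ∈ Finset.range M, 1 / (μ + (k + 1)) ^ 2 ≤ 1 / μ - 1 / (μ + M) := by
  induction M with
  | zero => simp
  | succ M ih =>
    rw [Finset.sum_range_succ]
    have h1 : 0 < μ + M := by positivity
    have h2 : 1 / (μ + ((M : ℝ) + 1)) ^ 2 ≤ 1 / (μ + M) - 1 / (μ + (M + 1)) := by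
      rw [div_sub_div _ _ (by positivity) (by positivity), div_le_div_iff₀ (by positivity)
        (by positivity)]
      nlinarith
    push_cast
    linarith

theorem sum_Icc_decay_le {μ : ℝ} (hμ : 1 ≤ μ) (M : ℕ) :
    ∑ k ∈ Finset.Icc (-(M : ℤ)) M, ((1 + |(k : ℝ)| / μ) ^ 2)⁻¹ ≤ 3 * μ := by
  have hμ0 : 0 < μ := by linarith
  have key : ∀ M : ℕ, ∑ k ∈ Finset.Icc (-(M : ℤ)) M, ((1 + |(k : ℝ)| / μ) ^ 2)⁻¹
      = 1 + 2 * ∑ k ∈ Finset.range M, μ ^ 2 * (1 / (μ + (k + 1)) ^ 2) := by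
    intro M
    induction M with
    | zero => simp
    | succ M ih =>
      have hI : Finset.Icc (-((M + 1 : ℕ) : ℤ)) ((M + 1 : ℕ) : ℤ)
          = insert (-((M + 1 : ℕ) : ℤ)) (insert ((M + 1 : ℕ) : ℤ) (Finset.Icc (-(M : ℤ)) M)) := by
        ext k
        simp only [Finset.mem_insert, Finset.mem_Icc]
        push_cast
        omega
      rw [hI, Finset.sum_insert, Finset.sum_insert, ih, Finset.sum_range_succ]
      · have h3 : |((M : ℝ) + 1)| = M + 1 := abs_of_pos (by positivity)
        push_cast
        rw [abs_neg, h3]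
        field_simp
        ring
      · simp
      · simp only [Finset.mem_insert, Finset.mem_Icc]
        push_cast
        omega
  rw [key, ← Finset.mul_sum]
  have h1 := sum_range_inv_add_sq_le hμ M
  have h2 : 0 ≤ 1 / (μ + M) := by positivity
  have h3 : μ ^ 2 * ∑ k ∈ Finset.range M, 1 / (μ + ((k : ℝ) + 1)) ^ 2 ≤ μ ^ 2 * (1 / μ) := by
    gcongr
    linarith
  have h4 : μ ^ 2 * (1 / μ) = μ := by field_simp
  linarith

/-- The sup norm dominates every coordinate, so decay of order 2d splits into d one-dimensional
factors of order 2. Passing from κ to some μ ≥ max(1, κ) keeps the bound valid when κ is small,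
where the single term n = 0 already contributes 1. -/
theorem sum_lattice_decay_le {μ κ : ℝ} (hμ : 1 ≤ μ) (hκ : 0 < κ) (hκμ : κ ≤ μ)
    (s : Finset (d → ℤ)) :
    ∑ n ∈ s, ((1 + ‖(fun i => (n i / κ : ℝ))‖) ^ (2 * Fintype.card d))⁻¹
      ≤ (3 * μ) ^ Fintype.card d := by
  classical
  obtain ⟨M, hM⟩ : ∃ M : ℕ, ∀ n ∈ s, ∀ i, |n i| ≤ M := by
    refine ⟨s.sup fun n => Finset.univ.sup fun i => (n i).natAbs, fun n hn i => ?_⟩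
    have h1 : (n i).natAbs ≤ s.sup fun n => Finset.univ.sup fun i => (n i).natAbs :=
      (Finset.le_sup (f := fun i => (n i).natAbs) (Finset.mem_univ i)).trans
        (Finset.le_sup (f := fun n : d → ℤ => Finset.univ.sup fun i => (n i).natAbs) hn)
    rw [Int.abs_eq_natAbs]
    exact_mod_cast h1
  have hsub : s ⊆ Fintype.piFinset fun _ => Finset.Icc (-(M : ℤ)) M := by
    intro n hn
    rw [Fintype.mem_piFinset]
    intro i
    have := abs_le.1 (hM n hn i)
    exact Finset.mem_Icc.2 this
  have hμ0 : 0 < μ := by linarith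
  have hpt : ∀ n : d → ℤ, ((1 + ‖(fun i => (n i / κ : ℝ))‖) ^ (2 * Fintype.card d))⁻¹
      ≤ ∏ i, ((1 + |(n i : ℝ)| / μ) ^ 2)⁻¹ := by
    intro n
    rw [Finset.prod_inv_distrib]
    refine inv_anti₀ (Finset.prod_pos fun i _ => by positivity) ?_
    rw [pow_mul, ← Finset.card_univ, ← Finset.prod_const]
    refine Finset.prod_le_prod (fun i _ => by positivity) fun i _ => ?_
    have h1 := norm_le_pi_norm (fun i => (n i / κ : ℝ)) i
    rw [Real.norm_eq_abs, abs_div, abs_of_pos hκ] at h1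
    have h2 : |(n i : ℝ)| / μ ≤ |(n i : ℝ)| / κ := by gcongr
    gcongr
    linarith
  calc _ ≤ ∑ n ∈ s, ∏ i, ((1 + |(n i : ℝ)| / μ) ^ 2)⁻¹ := Finset.sum_le_sum fun n _ => hpt n
    _ ≤ ∑ n ∈ Fintype.piFinset fun _ => Finset.Icc (-(M : ℤ)) M,
          ∏ i, ((1 + |(n i : ℝ)| / μ) ^ 2)⁻¹ :=
        Finset.sum_le_sum_of_subset_of_nonneg hsub fun _ _ _ =>
          Finset.prod_nonneg fun i _ => by positivity
    _ = ∏ _i : d, ∑ k ∈ Finset.Icc (-(M : ℤ)) M, ((1 + |(k : ℝ)| / μ) ^ 2)⁻¹ := by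
        rw [Finset.prod_univ_sum]
    _ ≤ ∏ _i : d, (3 * μ) := by
        refine Finset.prod_le_prod (fun i _ => Finset.sum_nonneg fun k _ => by positivity)
          fun i _ => sum_Icc_decay_le hμ M
    _ = _ := by simp

end Decay

/-- The pairs of frequencies in `ℤ³ × ℤ³`. -/
abbrev Mode : Type := Fin 3 ⊕ Fin 3 → ℤ

/-- The size `(2 π / L) ∑ |n i|` of a pair of frequencies. -/
def modeSize (L : ℝ) (n : Mode) : ℝ := 2 * Real.pi / L * ∑ i, |(n i : ℝ)|

theorem modeSize_nonneg {L : ℝ} (hL : 0 < L) (n : Mode) : 0 ≤ modeSize L n := by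
  unfold modeSize
  positivity

/-! ### Bounds, explicit in N, on the Fourier series of V_N. -/

section Scaling

variable {L : ℝ} {V : (Fin 3 → ℝ) × (Fin 3 → ℝ) → ℝ} {β : ℝ}

/-- The two halves of a point of `ℝ⁶`, as a continuous linear equivalence. -/
def splitEquiv : (Fin 3 ⊕ Fin 3 → ℝ) ≃L[ℝ] (Fin 3 → ℝ) × (Fin 3 → ℝ) :=
  ContinuousLinearEquiv.sumPiEquivProdPi ℝ (Fin 3) (Fin 3) fun _ => ℝ

theorem splitEquiv_apply (w : Fin 3 ⊕ Fin 3 → ℝ) :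
    splitEquiv w = (fun a => w (Sum.inl a), fun a => w (Sum.inr a)) := rfl

/-- The Fourier coefficients of the scaled and periodized interaction. -/
def interactionCoeff (V : (Fin 3 → ℝ) × (Fin 3 → ℝ) → ℝ) (β L : ℝ) (N : ℕ) (n : Mode) : ℂ :=
  ∫ z, planeWave (-n) z * (((N : ℝ) ^ (6 * β) * V (splitEquiv (((N : ℝ) ^ β * L) • z)) : ℝ) : ℂ)

/-- The scale `max 1 (N ^ β)`. -/
def scale (β : ℝ) (N : ℕ) : ℝ := max 1 ((N : ℝ) ^ β)

theorem one_le_scale (β : ℝ) (N : ℕ) : 1 ≤ scale β N := le_max_left _ _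

/-- The normalization N^{6β} preserves the integral up to the factor L⁻⁶, so the coefficients are
values of one fixed rapidly decreasing function at n / (N^β L), with a constant independent of N. -/
theorem exists_norm_interactionCoeff_le (hL : 0 < L) (hV : ContDiff ℝ ∞ V)
    (hs : HasCompactSupport V) (β : ℝ) (m : ℕ) :
    ∃ C : ℝ, 0 ≤ C ∧ ∀ N : ℕ, 1 ≤ N → ∀ n : Mode,
      ‖interactionCoeff V β L N n‖
        ≤ C * ((1 + ‖(fun i => (n i / ((N : ℝ) ^ β * L) : ℝ))‖) ^ m)⁻¹ := by
  let g : (Fin 3 ⊕ Fin 3 → ℝ) → ℂ := fun w => (V (splitEquiv w) : ℂ)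
  have hg : ContDiff ℝ ∞ g :=
    Complex.ofRealCLM.contDiff.comp (hV.comp splitEquiv.contDiff)
  have hgs : HasCompactSupport g :=
    (hs.comp_homeomorph splitEquiv.toHomeomorph).comp_left (g := Complex.ofReal) (by simp)
  obtain ⟨C, hC0, hC⟩ := exists_fourier_decay hgs hg m
  refine ⟨(L ^ 6)⁻¹ * C, by positivity, fun N hN n => ?_⟩
  have hN0 : (0 : ℝ) < N := by exact_mod_cast hN
  have hb : 0 < (N : ℝ) ^ β := Real.rpow_pos_of_pos hN0 β
  have hκ : 0 < (N : ℝ) ^ β * L := by positivity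
  have h6 : (N : ℝ) ^ (6 * β) = ((N : ℝ) ^ β) ^ 6 := by
    rw [mul_comm, Real.rpow_mul hN0.le]
    exact_mod_cast Real.rpow_natCast _ 6
  have h1 : interactionCoeff V β L N n = ((N : ℝ) ^ (6 * β) : ℝ) *
      ∫ z, planeWave (-n) z * g (((N : ℝ) ^ β * L) • z) := by
    rw [interactionCoeff, ← integral_const_mul]
    refine integral_congr_ae (Eventually.of_forall fun z => ?_)
    simp only [g, Complex.ofReal_mul]
    ring
  have h2 := hC fun i => (n i / ((N : ℝ) ^ β * L) : ℝ)
  rw [h1, integral_planeWave_comp_smul g hκ, ← mul_assoc, ← Complex.ofReal_mul, norm_mul,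
    Complex.norm_real, Real.norm_of_nonneg (by positivity), h6]
  have h3 : ((N : ℝ) ^ β) ^ 6 * (((N : ℝ) ^ β * L) ^ Fintype.card (Fin 3 ⊕ Fin 3))⁻¹
      = (L ^ 6)⁻¹ := by
    simp only [Fintype.card_sum, Fintype.card_fin]
    field_simp
    ring
  rw [h3, mul_assoc]
  refine mul_le_mul_of_nonneg_left ?_ (by positivity)
  rw [← div_eq_mul_inv, le_div_iff₀ (by positivity), mul_comm]
  exact h2

/-- About R⁶ lattice points carry coefficients of order one, and on them the weight is of order R^r.
-/
theorem exists_sum_interactionCoeff_le (hL : 0 < L) (hV : ContDiff ℝ ∞ V)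
    (hs : HasCompactSupport V) (β : ℝ) (r : ℕ) :
    ∃ C : ℝ, 0 ≤ C ∧ ∀ N : ℕ, 1 ≤ N → ∀ s : Finset Mode,
      ∑ n ∈ s, ‖interactionCoeff V β L N n‖ * (1 + modeSize L n) ^ r
        ≤ C * scale β N ^ (6 + r) := by
  -- Of the decay order r + 12, r powers absorb the weight and 12 = 2 · 6 make the sum over ℤ⁶
  -- converge.
  obtain ⟨C, hC0, hC⟩ := exists_norm_interactionCoeff_le hL hV hs β (r + 12)
  refine ⟨C * (12 * Real.pi + 1) ^ r * (3 * max 1 L) ^ 6, by positivity, fun N hN s => ?_⟩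
  have hN0 : (0 : ℝ) < N := by exact_mod_cast hN
  set b : ℝ := (N : ℝ) ^ β with hbdef
  have hb : 0 < b := Real.rpow_pos_of_pos hN0 β
  have hR1 := one_le_scale β N
  set R := scale β N with hRdef
  have hbR : b ≤ R := le_max_right _ _
  have hκ : 0 < b * L := by positivity
  have hterm : ∀ n : Mode, ‖interactionCoeff V β L N n‖ * (1 + modeSize L n) ^ r
      ≤ C * (12 * Real.pi + 1) ^ r * R ^ r *
        ((1 + ‖(fun i => (n i / (b * L) : ℝ))‖) ^ (2 * Fintype.card (Fin 3 ⊕ Fin 3)))⁻¹ := by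
    intro n
    set t : ℝ := ‖(fun i => (n i / (b * L) : ℝ))‖ with ht
    have ht0 : 0 ≤ t := norm_nonneg _
    have h1 : 1 + modeSize L n ≤ (12 * Real.pi + 1) * R * (1 + t) := by
      have h2 : ∑ i, |(n i : ℝ)| ≤ 6 * (b * L * t) := by
        have : ∀ i ∈ (Finset.univ : Finset (Fin 3 ⊕ Fin 3)), |(n i : ℝ)| ≤ b * L * t := by
          intro i _
          have h3 := norm_le_pi_norm (fun i => (n i / (b * L) : ℝ)) i
          rw [Real.norm_eq_abs, abs_div, abs_of_pos hκ, div_le_iff₀ hκ] at h3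
          linarith
        refine (Finset.sum_le_card_nsmul _ _ _ this).trans ?_
        simp
      have h4 : modeSize L n ≤ 12 * Real.pi * (b * t) := by
        calc modeSize L n ≤ 2 * Real.pi / L * (6 * (b * L * t)) := by
              unfold modeSize
              gcongr
          _ = 12 * Real.pi * (b * t) := by field_simp; ring
      have h5 : b * t ≤ R * (1 + t) := by
        calc b * t ≤ R * t := by gcongr
          _ ≤ R * (1 + t) := by gcongr; linarith
      have h6 : 1 ≤ R * (1 + t) := by nlinarith
      have h7 : 12 * Real.pi * (b * t) ≤ 12 * Real.pi * (R * (1 + t)) := by gcongr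
      linarith
    have h8 : (1 + modeSize L n) ^ r ≤ ((12 * Real.pi + 1) * R * (1 + t)) ^ r := by
      have := modeSize_nonneg hL n
      gcongr
    calc ‖interactionCoeff V β L N n‖ * (1 + modeSize L n) ^ r
        ≤ (C * ((1 + t) ^ (r + 12))⁻¹) * ((12 * Real.pi + 1) * R * (1 + t)) ^ r := by
          have := modeSize_nonneg hL n
          refine mul_le_mul (hC N hN n) h8 (by positivity) (by positivity)
      _ = _ := by
          simp only [Fintype.card_sum, Fintype.card_fin]
          rw [mul_pow, mul_pow, pow_add]
          field_simp
  have hmax : (1 : ℝ) ≤ max 1 L := le_max_left _ _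
  refine (Finset.sum_le_sum fun n _ => hterm n).trans ?_
  rw [← Finset.mul_sum]
  have hlat := sum_lattice_decay_le (d := Fin 3 ⊕ Fin 3) (μ := R * max 1 L) (κ := b * L)
    (by nlinarith) hκ (by gcongr; exact le_max_right _ _) s
  refine (mul_le_mul_of_nonneg_left hlat (by positivity)).trans (le_of_eq ?_)
  simp only [Fintype.card_sum, Fintype.card_fin]
  rw [pow_add]
  ring

theorem summable_interactionCoeff (hL : 0 < L) (hV : ContDiff ℝ ∞ V)
    (hs : HasCompactSupport V) (β : ℝ) {N : ℕ} (hN : 1 ≤ N) (r : ℕ) :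
    Summable fun n => ‖interactionCoeff V β L N n‖ * (1 + modeSize L n) ^ r := by
  obtain ⟨C, hC0, hC⟩ := exists_sum_interactionCoeff_le hL hV hs β r
  refine summable_of_sum_le (fun n => ?_) (hC N hN)
  have := modeSize_nonneg hL n
  positivity

theorem toTorus_torusRep (θ : UnitAddTorus (Fin 3)) : toTorus (torusRep θ) = θ := by
  funext a
  exact (AddCircle.equivIco (1 : ℝ) 0).symm_apply_apply (θ a)

/-- Poisson summation on ℝ⁶ for the scaled potential, evaluated at the representatives of θ and η in
the unit cube. -/
theorem hasSum_VN (hL : 0 < L) (hV : ContDiff ℝ ∞ V)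
    (hs : HasCompactSupport V) (β : ℝ) {N : ℕ} (hN : 1 ≤ N) (θ η : UnitAddTorus (Fin 3)) :
    HasSum (fun n : Mode =>
        interactionCoeff V β L N n * UnitAddTorus.mFourier n (Sum.elim θ η))
      (VN V β L N θ η : ℂ) := by
  have hN0 : (0 : ℝ) < N := by exact_mod_cast hN
  have hκ : (N : ℝ) ^ β * L ≠ 0 := by positivity
  let f : (Fin 3 ⊕ Fin 3 → ℝ) → ℂ := fun z =>
    (((N : ℝ) ^ (6 * β) * V (splitEquiv (((N : ℝ) ^ β * L) • z)) : ℝ) : ℂ)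
  have hfc : Continuous f := by
    have := hV.continuous
    fun_prop
  have hfs : HasCompactSupport f := by
    have h1 : HasCompactSupport fun z : Fin 3 ⊕ Fin 3 → ℝ =>
        V (splitEquiv (((N : ℝ) ^ β * L) • z)) :=
      (hs.comp_homeomorph splitEquiv.toHomeomorph).comp_homeomorph (Homeomorph.smulOfNeZero _ hκ)
    exact (h1.mul_left (f := fun _ => (N : ℝ) ^ (6 * β))).comp_left (g := Complex.ofReal) (by simp)
  have hsum : Summable fun n : Mode => ∫ z, planeWave (-n) z * f z := by
    have := summable_interactionCoeff hL hV hs β hN 0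
    simp only [pow_zero, mul_one] at this
    exact Summable.of_norm this
  have h := hasSum_poisson hfs hfc hsum (Sum.elim (torusRep θ) (torusRep η))
  have ht : toTorus (Sum.elim (torusRep θ) (torusRep η)) = Sum.elim θ η := by
    funext i
    rcases i with a | a
    · exact congrFun (toTorus_torusRep θ) a
    · exact congrFun (toTorus_torusRep η) a
  rw [ht] at h
  convert! h using 1
  rw [VN, Complex.ofReal_tsum]
  rw [← (Equiv.sumArrowEquivProdArrow (Fin 3) (Fin 3) ℤ).tsum_eq]
  refine tsum_congr fun p => ?_
  simp only [f, splitEquiv_apply]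
  congr 4
  · funext a
    simp [latticePoint, Equiv.sumArrowEquivProdArrow, mul_assoc]
  · funext a
    simp [latticePoint, Equiv.sumArrowEquivProdArrow, mul_assoc]

end Scaling

/-! ### Fourier multipliers and multiplication operators on `L²` of a torus -/

/-- Cauchy–Schwarz for the splitting b X = b^{1/2} · b^{1/2} X, via Hölder for the counting measure.
-/
theorem sq_tsum_mul_le {α : Type*} (b X : α → ℝ≥0∞) :
    (∑' i, b i * X i) ^ 2 ≤ (∑' i, b i) * ∑' i, b i * X i ^ 2 := by
  let _ : MeasurableSpace α := ⊤
  have h := ENNReal.lintegral_mul_le_Lp_mul_Lq (Measure.count : Measure α)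
    Real.HolderConjugate.two_two (f := fun i => b i ^ (1 / 2 : ℝ))
    (g := fun i => b i ^ (1 / 2 : ℝ) * X i) measurable_from_top.aemeasurable
    measurable_from_top.aemeasurable
  simp only [lintegral_count, Pi.mul_apply] at h
  have h1 : ∀ i, b i ^ (1 / 2 : ℝ) * (b i ^ (1 / 2 : ℝ) * X i) = b i * X i := by
    intro i
    rw [← mul_assoc, ← ENNReal.rpow_add_of_nonneg _ _ (by norm_num) (by norm_num)]
    norm_num
  have h2 : ∀ i, (b i ^ (1 / 2 : ℝ)) ^ (2 : ℝ) = b i := by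
    intro i
    rw [← ENNReal.rpow_mul]
    norm_num
  have h3 : ∀ i, (b i ^ (1 / 2 : ℝ) * X i) ^ (2 : ℝ) = b i * X i ^ 2 := by
    intro i
    rw [ENNReal.mul_rpow_of_nonneg _ _ (by norm_num), h2, ENNReal.rpow_two]
  simp only [h1, h2, h3] at h
  calc _ ≤ ((∑' i, b i) ^ (1 / 2 : ℝ) * (∑' i, b i * X i ^ 2) ^ (1 / 2 : ℝ)) ^ 2 := by gcongr
    _ = _ := by
        rw [mul_pow, ← ENNReal.rpow_natCast, ← ENNReal.rpow_natCast, ← ENNReal.rpow_mul,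
          ← ENNReal.rpow_mul]
        norm_num

theorem tsum_enorm_sq_ne_top_iff {ι : Type*} (f : ι → ℂ) :
    ∑' i, ‖f i‖ₑ ^ 2 ≠ ⊤ ↔ Memℓp f 2 := by
  rw [memℓp_gen_iff (by norm_num)]
  have h : ∀ i, ‖f i‖ₑ ^ 2 = ((‖f i‖₊ ^ 2 : NNReal) : ℝ≥0∞) := fun i => by
    rw [ENNReal.coe_pow]
    rfl
  simp only [h]
  rw [ENNReal.tsum_coe_ne_top_iff_summable, ← NNReal.summable_coe]
  simp

theorem enorm_sq_lp {ι : Type*} (x : lp (fun _ : ι => ℂ) 2) :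
    ‖x‖ₑ ^ 2 = ∑' i, ‖x i‖ₑ ^ 2 := by
  have h := lp.norm_rpow_eq_tsum (p := 2) (by norm_num) x
  have hs := (memℓp_gen_iff (p := 2) (by norm_num)).1 (lp.memℓp x)
  simp only [ENNReal.toReal_ofNat, Real.rpow_two] at h hs
  have h1 : ∀ i, ‖x i‖ₑ ^ 2 = ENNReal.ofReal (‖x i‖ ^ 2) := fun i => by
    rw [ENNReal.ofReal_pow (norm_nonneg _), ofReal_norm]
  simp only [h1]
  rw [← ENNReal.ofReal_tsum_of_nonneg (fun i => by positivity) hs, ← h,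
    ENNReal.ofReal_pow (norm_nonneg _), ofReal_norm]

section Multiplier

variable {d : Type} [Fintype d]

/-- The Fourier coefficients of a function on the torus. -/
def fc (ψ : L2 d) (ξ : d → ℤ) : ℂ := UnitAddTorus.mFourierBasis.repr ψ ξ

theorem fc_ext {φ ψ : L2 d} (h : ∀ ξ, fc φ ξ = fc ψ ξ) : φ = ψ :=
  UnitAddTorus.mFourierBasis.repr.injective (lp.ext (funext h))

@[simp] theorem fc_add (φ ψ : L2 d) (ξ : d → ℤ) : fc (φ + ψ) ξ = fc φ ξ + fc ψ ξ := by
  simp [fc]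

@[simp] theorem fc_smul (c : ℂ) (ψ : L2 d) (ξ : d → ℤ) : fc (c • ψ) ξ = c * fc ψ ξ := by
  simp [fc]

@[simp] theorem fc_zero (ξ : d → ℤ) : fc (0 : L2 d) ξ = 0 := by
  simp [fc]

@[simp] theorem fc_sum {ι : Type*} (s : Finset ι) (ψ : ι → L2 d) (ξ : d → ℤ) :
    fc (∑ i ∈ s, ψ i) ξ = ∑ i ∈ s, fc (ψ i) ξ := by
  classical
  induction s using Finset.induction_on with
  | empty => simp
  | insert i s hi ih => rw [Finset.sum_insert hi, Finset.sum_insert hi, fc_add, ih]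

theorem continuous_fc (ξ : d → ℤ) : Continuous fun ψ : L2 d => fc ψ ξ := by
  simp only [fc, HilbertBasis.repr_apply_apply]
  fun_prop

theorem fc_eq_integral (ψ : L2 d) (ξ : d → ℤ) :
    fc ψ ξ = ∫ x, UnitAddTorus.mFourier (-ξ) x * ψ x :=
  UnitAddTorus.mFourierBasis_repr ψ ξ

theorem enorm_sq_eq (ψ : L2 d) : ‖ψ‖ₑ ^ 2 = ∑' ξ, ‖fc ψ ξ‖ₑ ^ 2 := by
  rw [← UnitAddTorus.mFourierBasis.repr.enorm_map ψ, enorm_sq_lp]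
  rfl

theorem hasSum_inner_fc (φ ψ : L2 d) :
    HasSum (fun ξ => conj (fc φ ξ) * fc ψ ξ) ⟪φ, ψ⟫_ℂ := by
  have h := lp.hasSum_inner (𝕜 := ℂ) (UnitAddTorus.mFourierBasis.repr φ)
    (UnitAddTorus.mFourierBasis.repr ψ)
  rw [LinearIsometryEquiv.inner_map_map] at h
  simpa [fc, mul_comm] using h

/-- The weighted sum `∑ ξ, F ξ |ψ̂ ξ|²`. -/
def wsum (F : (d → ℤ) → ℝ≥0∞) (ψ : L2 d) : ℝ≥0∞ := ∑' ξ, F ξ * ‖fc ψ ξ‖ₑ ^ 2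

theorem wsum_one (ψ : L2 d) : wsum (fun _ => 1) ψ = ‖ψ‖ₑ ^ 2 := by
  simp [wsum, enorm_sq_eq]

theorem wsum_mono {F G : (d → ℤ) → ℝ≥0∞} (h : ∀ ξ, F ξ ≤ G ξ) (ψ : L2 d) :
    wsum F ψ ≤ wsum G ψ :=
  ENNReal.tsum_le_tsum fun ξ => by gcongr; exact h ξ

theorem wsum_const_mul (c : ℝ≥0∞) (F : (d → ℤ) → ℝ≥0∞) (ψ : L2 d) :
    wsum (fun ξ => c * F ξ) ψ = c * wsum F ψ := by
  simp only [wsum, mul_assoc, ENNReal.tsum_mul_left]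

theorem wsum_add (F G : (d → ℤ) → ℝ≥0∞) (ψ : L2 d) :
    wsum (fun ξ => F ξ + G ξ) ψ = wsum F ψ + wsum G ψ := by
  simp only [wsum, add_mul, ENNReal.tsum_add]

theorem wsum_finset_sum {ι : Type*} (s : Finset ι) (F : ι → (d → ℤ) → ℝ≥0∞) (ψ : L2 d) :
    wsum (fun ξ => ∑ i ∈ s, F i ξ) ψ = ∑ i ∈ s, wsum (F i) ψ := by
  simp only [wsum, Finset.sum_mul]
  exact Summable.tsum_finsetSum fun i _ => ENNReal.summable

/-- Lower semicontinuity of weighted norms: each finite partial sum is continuous on L². It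
transfers uniform bounds from regularized vectors to their limit. -/
theorem wsum_le_of_tendsto {F : (d → ℤ) → ℝ≥0∞} (hF : ∀ ξ, F ξ ≠ ⊤) {φ : ℕ → L2 d} {ψ : L2 d}
    (h : Tendsto φ atTop (𝓝 ψ)) {M : ℝ≥0∞} (hM : ∀ᶠ n in atTop, wsum F (φ n) ≤ M) :
    wsum F ψ ≤ M := by
  rw [wsum, ENNReal.tsum_eq_iSup_sum]
  refine iSup_le fun s => ?_
  have h1 : Tendsto (fun n => ∑ ξ ∈ s, F ξ * ‖fc (φ n) ξ‖ₑ ^ 2) atTop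
      (𝓝 (∑ ξ ∈ s, F ξ * ‖fc ψ ξ‖ₑ ^ 2)) := by
    refine tendsto_finsetSum _ fun ξ _ => ?_
    refine ENNReal.Tendsto.const_mul ?_ (Or.inr (hF ξ))
    exact ((ENNReal.continuous_pow 2).comp (continuous_enorm.comp (continuous_fc ξ))).tendsto ψ
      |>.comp h
  refine le_of_tendsto h1 (hM.mono fun n hn => ?_)
  exact (ENNReal.sum_le_tsum s).trans hn

/-- The squared symbol, as an extended nonnegative weight. -/
def sqw (w : (d → ℤ) → ℝ) (ξ : d → ℤ) : ℝ≥0∞ := ENNReal.ofReal (w ξ ^ 2)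

theorem enorm_ofReal_mul_sq (r : ℝ) (z : ℂ) :
    ‖(r : ℂ) * z‖ₑ ^ 2 = ENNReal.ofReal (r ^ 2) * ‖z‖ₑ ^ 2 := by
  rw [enorm_mul, mul_pow]
  congr 1
  rw [← ofReal_norm, Complex.norm_real, ← ENNReal.ofReal_pow (norm_nonneg _), Real.norm_eq_abs,
    sq_abs]

theorem mem_domain_fourierMultiplier {w : (d → ℤ) → ℝ} {ψ : L2 d} :
    ψ ∈ (fourierMultiplier w).domain ↔ wsum (sqw w) ψ ≠ ⊤ := by
  show Memℓp (fun ξ => (w ξ : ℂ) * fc ψ ξ) 2 ↔ _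
  rw [← tsum_enorm_sq_ne_top_iff]
  simp only [enorm_ofReal_mul_sq]
  rfl

theorem fc_fourierMultiplier {w : (d → ℤ) → ℝ} (ψ : (fourierMultiplier w).domain) (ξ : d → ℤ) :
    fc (fourierMultiplier w ψ) ξ = w ξ * fc (ψ : L2 d) ξ := by
  show UnitAddTorus.mFourierBasis.repr (UnitAddTorus.mFourierBasis.repr.symm
    (diagonalCoeff UnitAddTorus.mFourierBasis w ψ)) ξ = _
  rw [LinearIsometryEquiv.apply_symm_apply]
  rfl

theorem opNormSq_fourierMultiplier (w : (d → ℤ) → ℝ) (ψ : L2 d) :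
    opNormSq (fourierMultiplier w) ψ = wsum (sqw w) ψ := by
  unfold opNormSq
  split_ifs with h
  · rw [enorm_sq_eq]
    refine tsum_congr fun ξ => ?_
    rw [fc_fourierMultiplier, enorm_ofReal_mul_sq]
    rfl
  · rw [mem_domain_fourierMultiplier, not_not] at h
    exact h.symm

open Classical in
/-- The Fourier multiplier as a total function, zero off its domain. -/
def fm (w : (d → ℤ) → ℝ) (ψ : L2 d) : L2 d :=
  if h : ψ ∈ (fourierMultiplier w).domain then fourierMultiplier w ⟨ψ, h⟩ else 0

theorem fc_fm {w : (d → ℤ) → ℝ} {ψ : L2 d} (h : wsum (sqw w) ψ ≠ ⊤) (ξ : d → ℤ) :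
    fc (fm w ψ) ξ = w ξ * fc ψ ξ := by
  rw [fm, dif_pos (mem_domain_fourierMultiplier.2 h), fc_fourierMultiplier]

theorem wsum_fm {w : (d → ℤ) → ℝ} {ψ : L2 d} (h : wsum (sqw w) ψ ≠ ⊤) (F : (d → ℤ) → ℝ≥0∞) :
    wsum F (fm w ψ) = wsum (fun ξ => F ξ * sqw w ξ) ψ := by
  refine tsum_congr fun ξ => ?_
  rw [fc_fm h, enorm_ofReal_mul_sq, mul_assoc]
  rfl

theorem enorm_fm_sq {w : (d → ℤ) → ℝ} {ψ : L2 d} (h : wsum (sqw w) ψ ≠ ⊤) :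
    ‖fm w ψ‖ₑ ^ 2 = wsum (sqw w) ψ := by
  rw [← wsum_one, wsum_fm h]
  simp

/-! ### Multiplication by a continuous function -/

theorem memLp_mul {U : UnitAddTorus d → ℝ} (hU : Continuous U) (ψ : L2 d) :
    MemLp (fun x => (U x : ℂ) * ψ x) 2 volume := by
  obtain ⟨C, hC⟩ := isCompact_univ.exists_bound_of_continuousOn hU.continuousOn
  refine MemLp.of_le_mul (c := C) (Lp.memLp ψ) ?_ (Eventually.of_forall fun x => ?_)
  · exact ((Complex.continuous_ofReal.comp hU).aestronglyMeasurable).mul (Lp.aestronglyMeasurable ψ)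
  · rw [norm_mul, Complex.norm_real]
    gcongr
    exact hC x (mem_univ x)

/-- Multiplication by a continuous real function as a bounded operator on `L²`. -/
def mulOp (U : C(UnitAddTorus d, ℝ)) : L2 d →L[ℂ] L2 d :=
  LinearMap.mkContinuous
    { toFun := fun ψ => (memLp_mul U.continuous ψ).toLp
      map_add' := by
        intro a b
        rw [← MemLp.toLp_add]
        refine MemLp.toLp_congr _ _ ?_
        filter_upwards [Lp.coeFn_add a b] with x hx
        simp only [hx, Pi.add_apply, mul_add]
      map_smul' := by
        intro c a
        rw [RingHom.id_apply, ← MemLp.toLp_const_smul]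
        refine MemLp.toLp_congr _ _ ?_
        filter_upwards [Lp.coeFn_smul c a] with x hx
        simp only [hx, Pi.smul_apply, smul_eq_mul, mul_left_comm] } ‖U‖ (by
    intro ψ
    refine Lp.norm_le_mul_norm_of_ae_le_mul ?_
    filter_upwards [(memLp_mul U.continuous ψ).coeFn_toLp] with x hx
    show ‖(memLp_mul U.continuous ψ).toLp _ x‖ ≤ _
    rw [hx, norm_mul, Complex.norm_real]
    gcongr
    exact U.norm_coe_le_norm x)

theorem coeFn_mulOp (U : C(UnitAddTorus d, ℝ)) (ψ : L2 d) :
    mulOp U ψ =ᵐ[volume] fun x => (U x : ℂ) * ψ x :=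
  (memLp_mul U.continuous ψ).coeFn_toLp

theorem mem_domain_multiplication (U : C(UnitAddTorus d, ℝ)) (ψ : L2 d) :
    ψ ∈ (multiplication U).domain := memLp_mul U.continuous ψ

theorem mulOp_sum {ι : Type*} (s : Finset ι) (U : ι → C(UnitAddTorus d, ℝ)) (ψ : L2 d) :
    mulOp (∑ i ∈ s, U i) ψ = ∑ i ∈ s, mulOp (U i) ψ := by
  classical
  induction s using Finset.induction_on with
  | empty =>
    simp only [Finset.sum_empty]
    refine Lp.ext ?_
    filter_upwards [coeFn_mulOp 0 ψ, Lp.coeFn_zero ℂ 2 (volume : Measure (UnitAddTorus d))]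
      with x h1 h2
    rw [h1, h2]
    simp
  | insert i s hi ih =>
    rw [Finset.sum_insert hi, Finset.sum_insert hi, ← ih]
    refine Lp.ext ?_
    filter_upwards [coeFn_mulOp (U i + ∑ i ∈ s, U i) ψ, coeFn_mulOp (U i) ψ,
      coeFn_mulOp (∑ i ∈ s, U i) ψ, Lp.coeFn_add (mulOp (U i) ψ) (mulOp (∑ i ∈ s, U i) ψ)]
      with x h1 h2 h3 h4
    rw [h1, h4, Pi.add_apply, h2, h3]
    simp [add_mul]

theorem mulOp_smul (c : ℝ) (U : C(UnitAddTorus d, ℝ)) (ψ : L2 d) :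
    mulOp (c • U) ψ = (c : ℂ) • mulOp U ψ := by
  refine Lp.ext ?_
  filter_upwards [coeFn_mulOp (c • U) ψ, coeFn_mulOp U ψ, Lp.coeFn_smul (c : ℂ) (mulOp U ψ)]
    with x h1 h2 h3
  rw [h1, h3, Pi.smul_apply, h2]
  simp [mul_assoc]

theorem inner_mulOp_left (U : C(UnitAddTorus d, ℝ)) (φ ψ : L2 d) :
    ⟪mulOp U φ, ψ⟫_ℂ = ⟪φ, mulOp U ψ⟫_ℂ := by
  rw [L2.inner_def, L2.inner_def]
  refine integral_congr_ae ?_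
  filter_upwards [coeFn_mulOp U φ, coeFn_mulOp U ψ] with x h1 h2
  rw [h1, h2]
  simp only [RCLike.inner_apply, map_mul, Complex.conj_ofReal]
  ring

theorem re_inner_mulOp_nonneg {U : C(UnitAddTorus d, ℝ)} (hU : ∀ x, 0 ≤ U x) (ψ : L2 d) :
    0 ≤ (⟪ψ, mulOp U ψ⟫_ℂ).re := by
  have hint := L2.integrable_inner (𝕜 := ℂ) ψ (mulOp U ψ)
  rw [L2.inner_def, ← RCLike.re_eq_complex_re, ← integral_re hint]
  refine integral_nonneg_of_ae ?_
  filter_upwards [coeFn_mulOp U ψ] with x h1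
  rw [h1]
  simp only [RCLike.inner_apply, Pi.zero_apply, RCLike.re_eq_complex_re]
  rw [mul_assoc, Complex.mul_conj, ← Complex.ofReal_mul, Complex.ofReal_re]
  exact mul_nonneg (hU x) (Complex.normSq_nonneg _)

/-- Multiplication acts on Fourier coefficients as convolution; absolute summability of a permits
integrating term by term. -/
theorem fc_mulOp {α : Type*} [Countable α] {U : C(UnitAddTorus d, ℝ)} {a : α → ℂ}
    {sh : α → d → ℤ} (ha : Summable fun i => ‖a i‖)
    (hU : ∀ x, HasSum (fun i => a i * UnitAddTorus.mFourier (sh i) x) (U x : ℂ))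
    (ψ : L2 d) (ξ : d → ℤ) :
    HasSum (fun i => a i * fc ψ (ξ - sh i)) (fc (mulOp U ψ) ξ) := by
  have hψ : Integrable ψ (volume : Measure (UnitAddTorus d)) :=
    (Lp.memLp ψ).integrable (by norm_num)
  have hn : ∀ (n : d → ℤ) x, ‖UnitAddTorus.mFourier n x‖ ≤ 1 := fun n x =>
    ((UnitAddTorus.mFourier n).norm_coe_le_norm x).trans_eq UnitAddTorus.mFourier_norm
  have hint : ∀ n : d → ℤ, Integrable (fun x => UnitAddTorus.mFourier n x * ψ x) := fun n =>
    hψ.bdd_mul (UnitAddTorus.mFourier n).continuous.aestronglyMeasurable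
      (Eventually.of_forall (hn n))
  have h1 : ∀ i, ∫ x, a i * (UnitAddTorus.mFourier (-(ξ - sh i)) x * ψ x)
      = a i * fc ψ (ξ - sh i) := by
    intro i
    rw [integral_const_mul, fc_eq_integral]
  have h2 : fc (mulOp U ψ) ξ
      = ∫ x, ∑' i, a i * (UnitAddTorus.mFourier (-(ξ - sh i)) x * ψ x) := by
    rw [fc_eq_integral]
    refine integral_congr_ae ?_
    filter_upwards [coeFn_mulOp U ψ] with x hx
    rw [hx, ← (hU x).tsum_eq, ← tsum_mul_right, ← tsum_mul_left]
    refine tsum_congr fun i => ?_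
    rw [neg_sub, sub_eq_add_neg, UnitAddTorus.mFourier_add]
    ring
  rw [h2]
  simp only [← h1]
  refine hasSum_integral_of_summable_integral_norm (fun i => (hint _).const_mul _) ?_
  refine Summable.of_nonneg_of_le (fun i => integral_nonneg fun x => norm_nonneg _) (fun i => ?_)
    (ha.mul_right (∫ x, ‖ψ x‖))
  rw [← integral_const_mul]
  refine integral_mono (((hint _).const_mul _).norm) (hψ.norm.const_mul _) fun x => ?_
  simp only [norm_mul]
  have := hn (-(ξ - sh i)) x
  have h3 : ‖UnitAddTorus.mFourier (-(ξ - sh i)) x‖ * ‖ψ x‖ ≤ 1 * ‖ψ x‖ := by gcongr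
  rw [one_mul] at h3
  gcongr

/-- Boundedness of a multiplication operator between weighted spaces. -/
theorem wsum_mulOp_le {α : Type*} [Countable α] {U : C(UnitAddTorus d, ℝ)} {a : α → ℂ}
    {sh : α → d → ℤ} (ha : Summable fun i => ‖a i‖)
    (hU : ∀ x, HasSum (fun i => a i * UnitAddTorus.mFourier (sh i) x) (U x : ℂ))
    {w : (d → ℤ) → ℝ} (hw : ∀ ξ, 0 ≤ w ξ) {c : α → ℝ} (hc : ∀ i, 0 ≤ c i)
    (hwc : ∀ ξ i, w (ξ + sh i) ≤ w ξ * c i) {K : ℝ}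
    (hs : Summable fun i => ‖a i‖ * c i) (hK : ∑' i, ‖a i‖ * c i ≤ K) (ψ : L2 d) :
    wsum (sqw w) (mulOp U ψ) ≤ ENNReal.ofReal (K ^ 2) * wsum (sqw w) ψ := by
  have hK0 : 0 ≤ K := (tsum_nonneg fun i => mul_nonneg (norm_nonneg _) (hc i)).trans hK
  set W : (d → ℤ) → ℝ≥0∞ := fun ξ => ENNReal.ofReal (w ξ) with hW
  have hWsq : ∀ ξ, sqw w ξ = W ξ ^ 2 := fun ξ => ENNReal.ofReal_pow (hw ξ) 2
  set b : α → ℝ≥0∞ := fun i => ENNReal.ofReal (‖a i‖ * c i) with hb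
  have hbK : ∑' i, b i ≤ ENNReal.ofReal K := by
    rw [← ENNReal.ofReal_tsum_of_nonneg (fun i => mul_nonneg (norm_nonneg _) (hc i)) hs]
    exact ENNReal.ofReal_le_ofReal hK
  -- The weight is moved through the convolution, at the cost of the factor c i for the i-th shift.
  have h1 : ∀ ξ, W ξ * ‖fc (mulOp U ψ) ξ‖ₑ
      ≤ ∑' i, b i * (W (ξ - sh i) * ‖fc ψ (ξ - sh i)‖ₑ) := by
    intro ξ
    rw [← (fc_mulOp ha hU ψ ξ).tsum_eq]
    calc W ξ * ‖∑' i, a i * fc ψ (ξ - sh i)‖ₑ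
        ≤ W ξ * ∑' i, ‖a i * fc ψ (ξ - sh i)‖ₑ := by
          gcongr
          exact enorm_tsum_le_tsum_enorm
      _ = ∑' i, W ξ * ‖a i * fc ψ (ξ - sh i)‖ₑ := ENNReal.tsum_mul_left.symm
      _ ≤ _ := by
          refine ENNReal.tsum_le_tsum fun i => ?_
          have h2 : W ξ ≤ W (ξ - sh i) * ENNReal.ofReal (c i) := by
            rw [hW]
            simp only
            rw [← ENNReal.ofReal_mul (hw _)]
            refine ENNReal.ofReal_le_ofReal ?_
            simpa using hwc (ξ - sh i) i
          rw [enorm_mul, hb]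
          simp only
          rw [ENNReal.ofReal_mul (norm_nonneg _), ofReal_norm]
          calc _ ≤ (W (ξ - sh i) * ENNReal.ofReal (c i)) * (‖a i‖ₑ * ‖fc ψ (ξ - sh i)‖ₑ) := by
                gcongr
            _ = _ := by ring
  -- Young's inequality ℓ¹ * ℓ² ⊆ ℓ²: Cauchy–Schwarz with weights b, after which the sum over ξ is
  -- invariant under each shift.
  have h3 : ∀ ξ, sqw w ξ * ‖fc (mulOp U ψ) ξ‖ₑ ^ 2
      ≤ ENNReal.ofReal K * ∑' i, b i * (sqw w (ξ - sh i) * ‖fc ψ (ξ - sh i)‖ₑ ^ 2) := by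
    intro ξ
    rw [hWsq, ← mul_pow]
    calc _ ≤ (∑' i, b i * (W (ξ - sh i) * ‖fc ψ (ξ - sh i)‖ₑ)) ^ 2 := by gcongr; exact h1 ξ
      _ ≤ (∑' i, b i) * ∑' i, b i * (W (ξ - sh i) * ‖fc ψ (ξ - sh i)‖ₑ) ^ 2 := sq_tsum_mul_le _ _
      _ ≤ _ := by
          simp only [mul_pow, hWsq]
          gcongr
  calc wsum (sqw w) (mulOp U ψ)
      ≤ ∑' ξ, ENNReal.ofReal K * ∑' i, b i * (sqw w (ξ - sh i) * ‖fc ψ (ξ - sh i)‖ₑ ^ 2) :=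
        ENNReal.tsum_le_tsum h3
    _ = ENNReal.ofReal K * ∑' i, b i * wsum (sqw w) ψ := by
        rw [ENNReal.tsum_mul_left, ENNReal.tsum_comm]
        congr 1
        refine tsum_congr fun i => ?_
        rw [ENNReal.tsum_mul_left]
        congr 1
        exact (Equiv.subRight (sh i)).tsum_eq fun ξ => sqw w ξ * ‖fc ψ ξ‖ₑ ^ 2
    _ ≤ _ := by
        rw [ENNReal.tsum_mul_right, ENNReal.ofReal_pow hK0, sq, mul_assoc]
        gcongr

end Multiplier

/-! ### Symbols of the `N`-body problem -/

section Symbols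

variable {L : ℝ} {N : ℕ}

theorem laplaceSymbol_nonneg (L : ℝ) (j : Fin N) (ξ : Fin N × Fin 3 → ℤ) :
    0 ≤ laplaceSymbol L j ξ := Finset.sum_nonneg fun _ _ => sq_nonneg _

theorem japaneseSymbol_sq (L : ℝ) (j : Fin N) (ξ : Fin N × Fin 3 → ℤ) :
    japaneseSymbol L j ξ ^ 2 = 1 + laplaceSymbol L j ξ :=
  Real.sq_sqrt (by linarith [laplaceSymbol_nonneg L j ξ])

theorem one_le_japaneseSymbol (L : ℝ) (j : Fin N) (ξ : Fin N × Fin 3 → ℤ) :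
    1 ≤ japaneseSymbol L j ξ := by
  rw [japaneseSymbol, Real.one_le_sqrt]
  linarith [laplaceSymbol_nonneg L j ξ]

theorem japaneseSymbol_pos (L : ℝ) (j : Fin N) (ξ : Fin N × Fin 3 → ℤ) :
    0 < japaneseSymbol L j ξ := one_pos.trans_le (one_le_japaneseSymbol L j ξ)

/-- The frequency shift caused by the mode `n` of the interaction of the particles `t`. -/
def shift (t : Fin N × Fin N × Fin N) (n : Mode) : Fin N × Fin 3 → ℤ := fun p =>
  (if p.1 = t.1 then n (Sum.inl p.2) + n (Sum.inr p.2) else 0)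
    + (if p.1 = t.2.1 then -n (Sum.inl p.2) else 0) + (if p.1 = t.2.2 then -n (Sum.inr p.2) else 0)

theorem mFourier_particle (i : Fin N) (m : Fin 3 → ℤ) (x : UnitAddTorus (Fin N × Fin 3)) :
    UnitAddTorus.mFourier (fun p : Fin N × Fin 3 => if p.1 = i then m p.2 else 0) x
      = UnitAddTorus.mFourier m (particle x i) := by
  simp only [UnitAddTorus.mFourier, ContinuousMap.coe_mk, particle]
  rw [Fintype.prod_prod_type, Finset.prod_eq_single i]
  · simp
  · intro j _ hj
    simp [hj]
  · simp

theorem mFourier_sub (m : Fin 3 → ℤ) (a b : UnitAddTorus (Fin 3)) :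
    UnitAddTorus.mFourier m (a - b)
      = UnitAddTorus.mFourier m a * UnitAddTorus.mFourier (-m) b := by
  simp only [UnitAddTorus.mFourier, ContinuousMap.coe_mk, ← Finset.prod_mul_distrib]
  refine Finset.prod_congr rfl fun i _ => ?_
  simp [fourier_apply, sub_eq_add_neg, AddCircle.toCircle_add]

theorem mFourier_shift (t : Fin N × Fin N × Fin N) (n : Mode)
    (x : UnitAddTorus (Fin N × Fin 3)) :
    UnitAddTorus.mFourier (shift t n) x = UnitAddTorus.mFourier n
      (Sum.elim (particle x t.1 - particle x t.2.1) (particle x t.1 - particle x t.2.2)) := by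
  have h1 : UnitAddTorus.mFourier n
      (Sum.elim (particle x t.1 - particle x t.2.1) (particle x t.1 - particle x t.2.2))
      = UnitAddTorus.mFourier (fun a => n (Sum.inl a)) (particle x t.1 - particle x t.2.1)
        * UnitAddTorus.mFourier (fun a => n (Sum.inr a)) (particle x t.1 - particle x t.2.2) := by
    simp only [UnitAddTorus.mFourier, ContinuousMap.coe_mk, Fintype.prod_sum_type, Sum.elim_inl,
      Sum.elim_inr]
  have h2 : shift t n = (fun p : Fin N × Fin 3 => if p.1 = t.1 then
      ((fun a => n (Sum.inl a)) + fun a => n (Sum.inr a)) p.2 else 0)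
      + (fun p : Fin N × Fin 3 => if p.1 = t.2.1 then (-fun a => n (Sum.inl a)) p.2 else 0)
      + (fun p : Fin N × Fin 3 => if p.1 = t.2.2 then (-fun a => n (Sum.inr a)) p.2 else 0) := rfl
  rw [h1, h2, UnitAddTorus.mFourier_add, UnitAddTorus.mFourier_add, mFourier_particle,
    mFourier_particle, mFourier_particle, UnitAddTorus.mFourier_add, mFourier_sub, mFourier_sub]
  ring

/-- The set of the three particles of a triple. -/
def members (t : Fin N × Fin N × Fin N) : Finset (Fin N) := {t.1, t.2.1, t.2.2}

theorem japaneseSymbol_add_shift_of_notMem {t : Fin N × Fin N × Fin N} {m : Fin N}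
    (hm : m ∉ members t) (ξ : Fin N × Fin 3 → ℤ) (n : Mode) :
    japaneseSymbol L m (ξ + shift t n) = japaneseSymbol L m ξ := by
  simp only [members, Finset.mem_insert, Finset.mem_singleton, not_or] at hm
  simp [japaneseSymbol, laplaceSymbol, shift, hm.1, hm.2.1, hm.2.2]

/-- The bound does not require distinct particles: when members of t coincide, their contributions
cancel or add up to at most both frequencies. -/
theorem abs_shift_le (t : Fin N × Fin N × Fin N) (n : Mode) (m : Fin N) (a : Fin 3) :
    |(shift t n (m, a) : ℝ)| ≤ |(n (Sum.inl a) : ℝ)| + |(n (Sum.inr a) : ℝ)| := by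
  have h0 := abs_nonneg (n (Sum.inl a) : ℝ)
  have h1 := abs_nonneg (n (Sum.inr a) : ℝ)
  have h2 := abs_add_le (n (Sum.inl a) : ℝ) (n (Sum.inr a) : ℝ)
  have h3 := abs_neg (n (Sum.inl a) : ℝ)
  have h4 := abs_neg (n (Sum.inr a) : ℝ)
  have h5 := abs_add_le (-n (Sum.inl a) : ℝ) (-n (Sum.inr a) : ℝ)
  simp only [shift]
  split_ifs <;> push_cast <;> simp <;> linarith

/-- Peetre's inequality ⟨x + y⟩ ≤ ⟨x⟩ (1 + |y|), with the ℓ¹ norm of y. -/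
theorem sqrt_one_add_sum_sq_add_le (x y : Fin 3 → ℝ) :
    Real.sqrt (1 + ∑ a, (x a + y a) ^ 2) ≤ Real.sqrt (1 + ∑ a, x a ^ 2) * (1 + ∑ a, |y a|) := by
  have hy0 : 0 ≤ ∑ a, |y a| := Finset.sum_nonneg fun a _ => abs_nonneg _
  have hx0 : 0 ≤ ∑ a, x a ^ 2 := Finset.sum_nonneg fun a _ => sq_nonneg _
  rw [Real.sqrt_le_left (by positivity), mul_pow, Real.sq_sqrt (by positivity)]
  set X := ∑ a, x a ^ 2 with hX
  set Y := ∑ a, |y a| with hY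
  have h1 : ∑ a, y a ^ 2 ≤ Y ^ 2 := by
    have := Finset.sum_sq_le_sq_sum_of_nonneg (s := Finset.univ) (f := fun a => |y a|)
      (fun a _ => abs_nonneg _)
    simpa using this
  have h2 : ∑ a, x a * y a ≤ (1 + X) * Y := by
    rw [hY, Finset.mul_sum]
    refine Finset.sum_le_sum fun a _ => ?_
    have h3 : x a ^ 2 ≤ X := Finset.single_le_sum (f := fun a => x a ^ 2)
      (fun a _ => sq_nonneg _) (Finset.mem_univ a)
    have h4 : |x a| ≤ 1 + X := by nlinarith [abs_nonneg (x a), sq_abs (x a), sq_nonneg (|x a| - 1)]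
    calc x a * y a ≤ |x a| * |y a| := by rw [← abs_mul]; exact le_abs_self _
      _ ≤ _ := by gcongr
  have h5 : ∑ a, (x a + y a) ^ 2 = X + 2 * ∑ a, x a * y a + ∑ a, y a ^ 2 := by
    rw [hX, Finset.mul_sum, ← Finset.sum_add_distrib, ← Finset.sum_add_distrib]
    exact Finset.sum_congr rfl fun a _ => by ring
  rw [h5]
  nlinarith [sq_nonneg Y, mul_nonneg hx0 (sq_nonneg Y)]

theorem japaneseSymbol_add_shift_le (hL : 0 < L) (t : Fin N × Fin N × Fin N) (m : Fin N)
    (ξ : Fin N × Fin 3 → ℤ) (n : Mode) :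
    japaneseSymbol L m (ξ + shift t n) ≤ japaneseSymbol L m ξ * (1 + modeSize L n) := by
  have h := sqrt_one_add_sum_sq_add_le (fun a => 2 * Real.pi / L * (ξ (m, a) : ℝ))
    (fun a => 2 * Real.pi / L * (shift t n (m, a) : ℝ))
  have h1 : ∑ a, |2 * Real.pi / L * (shift t n (m, a) : ℝ)| ≤ modeSize L n := by
    rw [modeSize, Fintype.sum_sum_type, ← Finset.sum_add_distrib, Finset.mul_sum]
    refine Finset.sum_le_sum fun a _ => ?_
    rw [abs_mul, abs_of_pos (by positivity : 0 < 2 * Real.pi / L)]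
    gcongr
    exact abs_shift_le t n m a
  have h2 : japaneseSymbol L m (ξ + shift t n) = Real.sqrt (1 + ∑ a,
      (2 * Real.pi / L * (ξ (m, a) : ℝ) + 2 * Real.pi / L * (shift t n (m, a) : ℝ)) ^ 2) := by
    simp only [japaneseSymbol, laplaceSymbol, Pi.add_apply, Int.cast_add, mul_add]
  rw [h2]
  refine h.trans ?_
  rw [japaneseSymbol, laplaceSymbol]
  gcongr

/-- The product `∏_{j ∈ J} ⟨2 π ξ_j / L⟩`. -/
def prodSymbol (L : ℝ) (J : Finset (Fin N)) (ξ : Fin N × Fin 3 → ℤ) : ℝ :=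
  ∏ j ∈ J, japaneseSymbol L j ξ

theorem one_le_prodSymbol (L : ℝ) (J : Finset (Fin N)) (ξ : Fin N × Fin 3 → ℤ) :
    1 ≤ prodSymbol L J ξ := by
  have := Finset.prod_le_prod (s := J) (f := fun _ => (1 : ℝ)) (fun _ _ => zero_le_one)
    (fun j _ => one_le_japaneseSymbol L j ξ)
  rwa [Finset.prod_const_one] at this

theorem prodSymbol_add_shift_of_disjoint {t : Fin N × Fin N × Fin N} {J : Finset (Fin N)}
    (h : Disjoint J (members t)) (ξ : Fin N × Fin 3 → ℤ) (n : Mode) :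
    prodSymbol L J (ξ + shift t n) = prodSymbol L J ξ :=
  Finset.prod_congr rfl fun _ hj =>
    japaneseSymbol_add_shift_of_notMem (Finset.disjoint_left.1 h hj) ξ n

/-- Only the factors of particles in the triple feel the shift; this is why the loss is counted by J
∩ t and not by J. -/
theorem prodSymbol_add_shift_le (hL : 0 < L) (t : Fin N × Fin N × Fin N) (J : Finset (Fin N))
    (ξ : Fin N × Fin 3 → ℤ) (n : Mode) :
    prodSymbol L J (ξ + shift t n)
      ≤ prodSymbol L J ξ * (1 + modeSize L n) ^ (J ∩ members t).card := by
  have h : (1 + modeSize L n) ^ (J ∩ members t).card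
      = ∏ j ∈ J, if j ∈ members t then 1 + modeSize L n else 1 := by
    rw [← Finset.prod_const, ← Finset.filter_mem_eq_inter, Finset.prod_filter]
  rw [h, prodSymbol, prodSymbol, ← Finset.prod_mul_distrib]
  refine Finset.prod_le_prod (fun j _ => (japaneseSymbol_pos L j _).le) fun j _ => ?_
  split_ifs with hj
  · exact japaneseSymbol_add_shift_le hL t j ξ n
  · rw [japaneseSymbol_add_shift_of_notMem hj, mul_one]

/-- The symbol `N⁻¹ ∑ⱼ ⟨2 π ξ_j / L⟩²` of the kinetic part of `N⁻¹ H_N + 1`. -/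
def meanSymbol (L : ℝ) (N : ℕ) (ξ : Fin N × Fin 3 → ℤ) : ℝ :=
  (N : ℝ)⁻¹ * ∑ j : Fin N, japaneseSymbol L j ξ ^ 2

theorem meanSymbol_eq (L : ℝ) (hN : 1 ≤ N) (ξ : Fin N × Fin 3 → ℤ) :
    meanSymbol L N ξ = (N : ℝ)⁻¹ * ∑ j : Fin N, laplaceSymbol L j ξ + 1 := by
  have hN0 : (N : ℝ) ≠ 0 := by positivity
  simp only [meanSymbol, japaneseSymbol_sq, Finset.sum_add_distrib]
  simp
  field_simp
  ring

theorem one_le_meanSymbol (L : ℝ) (hN : 1 ≤ N) (ξ : Fin N × Fin 3 → ℤ) :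
    1 ≤ meanSymbol L N ξ := by
  rw [meanSymbol_eq L hN]
  have : 0 ≤ ∑ j : Fin N, laplaceSymbol L j ξ :=
    Finset.sum_nonneg fun j _ => laplaceSymbol_nonneg L j ξ
  have : 0 ≤ (N : ℝ)⁻¹ * ∑ j : Fin N, laplaceSymbol L j ξ := by positivity
  linarith

theorem meanSymbol_nonneg (L : ℝ) (N : ℕ) (ξ : Fin N × Fin 3 → ℤ) : 0 ≤ meanSymbol L N ξ := by
  unfold meanSymbol
  positivity

theorem meanSymbol_add_shift_le (hL : 0 < L) (t : Fin N × Fin N × Fin N)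
    (ξ : Fin N × Fin 3 → ℤ) (n : Mode) :
    meanSymbol L N (ξ + shift t n) ≤ meanSymbol L N ξ * (1 + modeSize L n) ^ 2 := by
  rw [meanSymbol, meanSymbol, mul_assoc, Finset.sum_mul]
  gcongr with j _
  rw [← mul_pow]
  have := (japaneseSymbol_pos L j (ξ + shift t n)).le
  gcongr
  exact japaneseSymbol_add_shift_le hL t j ξ n

theorem japaneseSymbol_sq_le (hN : 1 ≤ N) (j : Fin N) (ξ : Fin N × Fin 3 → ℤ) :
    japaneseSymbol L j ξ ^ 2 ≤ N * meanSymbol L N ξ := by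
  have hN0 : (N : ℝ) ≠ 0 := by positivity
  rw [meanSymbol, mul_inv_cancel_left₀ hN0]
  exact Finset.single_le_sum (f := fun j => japaneseSymbol L j ξ ^ 2) (fun _ _ => sq_nonneg _)
    (Finset.mem_univ j)

/-- A bound crude in N, used only to know that quantities are finite on Sobolev spaces. -/
theorem prodSymbol_sq_le (hN : 1 ≤ N) (J : Finset (Fin N)) (ξ : Fin N × Fin 3 → ℤ) :
    prodSymbol L J ξ ^ 2 ≤ (N * meanSymbol L N ξ) ^ J.card := by
  rw [prodSymbol, ← Finset.prod_pow, ← Finset.prod_const]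
  exact Finset.prod_le_prod (fun j _ => sq_nonneg _) fun j _ => japaneseSymbol_sq_le hN j ξ

/-- The weight `(N⁻¹ ∑ⱼ ⟨2 π ξ_j / L⟩²) ^ s` of the Sobolev space `Hˢ`. -/
def sobolevWeight (L : ℝ) (N s : ℕ) (ξ : Fin N × Fin 3 → ℤ) : ℝ≥0∞ :=
  ENNReal.ofReal (meanSymbol L N ξ ^ s)

/-- Membership in the Sobolev space `Hˢ`. -/
def MemSobolev (L : ℝ) (s : ℕ) (ψ : L2N N) : Prop := wsum (sobolevWeight L N s) ψ ≠ ⊤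

theorem MemSobolev.of_le {s : ℕ} {ψ : L2N N} (h : MemSobolev L s ψ)
    {F : (Fin N × Fin 3 → ℤ) → ℝ≥0∞} {c : ℝ}
    (hF : ∀ ξ, F ξ ≤ ENNReal.ofReal (c * meanSymbol L N ξ ^ s)) : wsum F ψ ≠ ⊤ := by
  have h1 : wsum F ψ ≤ ENNReal.ofReal |c| * wsum (sobolevWeight L N s) ψ := by
    rw [← wsum_const_mul]
    refine wsum_mono (fun ξ => (hF ξ).trans ?_) ψ
    rw [sobolevWeight, ← ENNReal.ofReal_mul (abs_nonneg c)]
    have := meanSymbol_nonneg L N ξ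
    exact ENNReal.ofReal_le_ofReal (by gcongr; exact le_abs_self c)
  exact ne_top_of_le_ne_top (ENNReal.mul_ne_top ENNReal.ofReal_ne_top h) h1

theorem MemSobolev.mono {s s' : ℕ} {ψ : L2N N} (hN : 1 ≤ N) (h : MemSobolev L s ψ)
    (hs : s' ≤ s) : MemSobolev L s' ψ := by
  refine h.of_le (c := 1) fun ξ => ENNReal.ofReal_le_ofReal ?_
  rw [one_mul]
  exact pow_le_pow_right₀ (one_le_meanSymbol L hN ξ) hs

theorem memSobolev_zero (ψ : L2N N) : MemSobolev L 0 ψ := by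
  have : sobolevWeight L N 0 = fun _ => 1 := by
    funext ξ
    simp [sobolevWeight]
  rw [MemSobolev, this, wsum_one]
  exact ENNReal.pow_ne_top enorm_ne_top

theorem MemSobolev.add {s : ℕ} {φ ψ : L2N N} (hφ : MemSobolev L s φ) (hψ : MemSobolev L s ψ) :
    MemSobolev L s (φ + ψ) := by
  have h1 : wsum (sobolevWeight L N s) (φ + ψ)
      ≤ 2 * (wsum (sobolevWeight L N s) φ + wsum (sobolevWeight L N s) ψ) := by
    rw [wsum, wsum, wsum, ← ENNReal.tsum_add, ← ENNReal.tsum_mul_left]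
    refine ENNReal.tsum_le_tsum fun ξ => ?_
    rw [fc_add, ← mul_add, mul_left_comm]
    gcongr
    calc ‖fc φ ξ + fc ψ ξ‖ₑ ^ 2 ≤ (‖fc φ ξ‖ₑ + ‖fc ψ ξ‖ₑ) ^ 2 := by
          gcongr
          exact enorm_add_le _ _
      _ ≤ 2 * (‖fc φ ξ‖ₑ ^ 2 + ‖fc ψ ξ‖ₑ ^ 2) := by
          have := ENNReal.rpow_add_le_mul_rpow_add_rpow ‖fc φ ξ‖ₑ ‖fc ψ ξ‖ₑ one_le_two
          norm_num at this
          exact this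
  exact ne_top_of_le_ne_top (ENNReal.mul_ne_top (by simp) (ENNReal.add_ne_top.2 ⟨hφ, hψ⟩)) h1

theorem MemSobolev.smul {s : ℕ} {ψ : L2N N} (h : MemSobolev L s ψ) (c : ℂ) :
    MemSobolev L s (c • ψ) := by
  have h1 : wsum (sobolevWeight L N s) (c • ψ) = ‖c‖ₑ ^ 2 * wsum (sobolevWeight L N s) ψ := by
    rw [wsum, wsum, ← ENNReal.tsum_mul_left]
    refine tsum_congr fun ξ => ?_
    rw [fc_smul, enorm_mul, mul_pow, mul_left_comm]
  rw [MemSobolev, h1]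
  exact ENNReal.mul_ne_top (ENNReal.pow_ne_top enorm_ne_top) h

theorem MemSobolev.sum {ι : Type*} {s : ℕ} (T : Finset ι) {ψ : ι → L2N N}
    (h : ∀ i ∈ T, MemSobolev L s (ψ i)) : MemSobolev L s (∑ i ∈ T, ψ i) := by
  refine Finset.sum_induction _ (MemSobolev L s) (fun _ _ => MemSobolev.add) ?_ h
  simp [MemSobolev, wsum]

end Symbols

/-! ### The key estimate -/

section KeyEstimate

variable {d : Type} [Fintype d]

theorem wsum_eq_of_fc {w : (d → ℤ) → ℝ} {χ ψ : L2 d} (h : ∀ ξ, fc χ ξ = w ξ * fc ψ ξ) :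
    wsum (sqw w) ψ = ‖χ‖ₑ ^ 2 := by
  rw [enorm_sq_eq]
  refine tsum_congr fun ξ => ?_
  rw [h, enorm_ofReal_mul_sq]
  rfl

theorem wsum_ne_top_of_fc {w : (d → ℤ) → ℝ} {χ ψ : L2 d} (h : ∀ ξ, fc χ ξ = w ξ * fc ψ ξ) :
    wsum (sqw w) ψ ≠ ⊤ := by
  rw [wsum_eq_of_fc h]
  exact ENNReal.pow_ne_top enorm_ne_top

theorem fm_eq_of_fc {w : (d → ℤ) → ℝ} {χ ψ : L2 d} (h : ∀ ξ, fc χ ξ = w ξ * fc ψ ξ) :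
    fm w ψ = χ :=
  fc_ext fun ξ => by rw [fc_fm (wsum_ne_top_of_fc h), h]

theorem norm_le_of_enorm_sq_le {x y : L2 d} {K : ℝ} (hK : 0 ≤ K)
    (h : ‖x‖ₑ ^ 2 ≤ ENNReal.ofReal (K ^ 2) * ‖y‖ₑ ^ 2) : ‖x‖ ≤ K * ‖y‖ := by
  rw [ENNReal.ofReal_pow hK, ← mul_pow] at h
  have h1 : ‖x‖ₑ ≤ ENNReal.ofReal K * ‖y‖ₑ := (ENNReal.pow_le_pow_left_iff two_ne_zero).1 h
  rw [← ofReal_norm, ← ofReal_norm, ← ENNReal.ofReal_mul hK] at h1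
  exact (ENNReal.ofReal_le_ofReal_iff (by positivity)).1 h1

theorem inner_fm_sq {w : (d → ℤ) → ℝ} {φ χ : L2 d}
    (hφ : wsum (sqw fun ξ => w ξ ^ 2) φ ≠ ⊤) (hφ' : wsum (sqw w) φ ≠ ⊤)
    (hχ : wsum (sqw w) χ ≠ ⊤) :
    ⟪fm (fun ξ => w ξ ^ 2) φ, χ⟫_ℂ = ⟪fm w φ, fm w χ⟫_ℂ := by
  refine (hasSum_inner_fc _ _).unique ?_
  convert! hasSum_inner_fc (fm w φ) (fm w χ) using 2 with ξ
  rw [fc_fm hφ, fc_fm hφ', fc_fm hχ]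
  simp only [map_mul, map_pow, Complex.conj_ofReal, Complex.ofReal_pow]
  ring

variable {L : ℝ} {N : ℕ}

/-- The triples of particles `i < j < l`. -/
def triples (N : ℕ) : Finset (Fin N × Fin N × Fin N) :=
  Finset.univ.filter fun t => t.1 < t.2.1 ∧ t.2.1 < t.2.2

/-- The properties of the three-body interactions `U t` that enter the energy estimate: they are
nonnegative, and they have a common Fourier expansion `a` with weighted `ℓ¹` norms controlled by
the scale `R`. -/
structure InteractionBounds (L : ℝ) (N : ℕ)
    (U : Fin N × Fin N × Fin N → C(UnitAddTorus (Fin N × Fin 3), ℝ)) (a : Mode → ℂ)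
    (C R : ℝ) : Prop where
  L_pos : 0 < L
  one_le_N : 1 ≤ N
  nonneg : ∀ t x, 0 ≤ U t x
  hasSum : ∀ t x, HasSum (fun n => a n * UnitAddTorus.mFourier (shift t n) x) (U t x : ℂ)
  summable : ∀ r : ℕ, Summable fun n => ‖a n‖ * (1 + modeSize L n) ^ r
  -- A triple meets a set of particles at most three times, so r ≤ 3 suffices for the quantitative
  -- bounds; larger r serve only regularity.
  bound : ∀ r : ℕ, r ≤ 3 → ∑' n, ‖a n‖ * (1 + modeSize L n) ^ r ≤ C * R ^ (6 + r)
  C_nonneg : 0 ≤ C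
  one_le_R : 1 ≤ R

/-- The operator `N⁻¹ H_N + 1` as a total function. -/
def shiftedOp (L : ℝ) {N : ℕ} (U : Fin N × Fin N × Fin N → C(UnitAddTorus (Fin N × Fin 3), ℝ))
    (ψ : L2N N) : L2N N :=
  fm (meanSymbol L N) ψ + ((N : ℂ) ^ 3)⁻¹ • ∑ t ∈ triples N, mulOp (U t) ψ

variable {U : Fin N × Fin N × Fin N → C(UnitAddTorus (Fin N × Fin 3), ℝ)} {a : Mode → ℂ}
  {C R : ℝ}

theorem InteractionBounds.summable_norm (h : InteractionBounds L N U a C R) :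
    Summable fun n => ‖a n‖ := by
  simpa using h.summable 0

theorem InteractionBounds.memSobolev_mulOp (h : InteractionBounds L N U a C R) {s : ℕ}
    {ψ : L2N N} (hψ : MemSobolev L s ψ) (t : Fin N × Fin N × Fin N) :
    MemSobolev L s (mulOp (U t) ψ) := by
  -- The general bound applies to squared weights, hence the square root of T; it grows by at most 1
  -- + modeSize under a shift.
  have hw : sobolevWeight L N s = sqw fun ξ => Real.sqrt (meanSymbol L N ξ) ^ s := by
    funext ξ
    rw [sqw, ← pow_mul, mul_comm, pow_mul, Real.sq_sqrt (meanSymbol_nonneg L N ξ)]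
    rfl
  rw [MemSobolev, hw] at hψ ⊢
  refine ne_top_of_le_ne_top (ENNReal.mul_ne_top ENNReal.ofReal_ne_top hψ)
    (wsum_mulOp_le h.summable_norm (h.hasSum t) (fun ξ => by positivity)
    (c := fun n => (1 + modeSize L n) ^ s) (fun n => ?_) (fun ξ n => ?_) (h.summable s) le_rfl ψ)
  · have := modeSize_nonneg h.L_pos n
    positivity
  · have := modeSize_nonneg h.L_pos n
    rw [← mul_pow]
    gcongr
    rw [← Real.sqrt_sq (by positivity : 0 ≤ 1 + modeSize L n), ← Real.sqrt_mul
      (meanSymbol_nonneg L N ξ)]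
    exact Real.sqrt_le_sqrt (meanSymbol_add_shift_le h.L_pos t ξ n)

theorem InteractionBounds.wsum_mulOp_le (h : InteractionBounds L N U a C R)
    (J : Finset (Fin N)) (t : Fin N × Fin N × Fin N) (ψ : L2N N) :
    wsum (sqw (prodSymbol L J)) (mulOp (U t) ψ)
      ≤ ENNReal.ofReal ((C * R ^ (6 + (J ∩ members t).card)) ^ 2) * wsum (sqw (prodSymbol L J)) ψ := by
  have hcard : (J ∩ members t).card ≤ 3 :=
    (Finset.card_le_card Finset.inter_subset_right).trans Finset.card_le_three
  refine QuinticBose.wsum_mulOp_le h.summable_norm (h.hasSum t)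
    (fun ξ => zero_le_one.trans (one_le_prodSymbol L J ξ))
    (c := fun n => (1 + modeSize L n) ^ (J ∩ members t).card) (fun n => ?_)
    (fun ξ n => prodSymbol_add_shift_le h.L_pos t J ξ n) (h.summable _) (h.bound _ hcard) ψ
  have := modeSize_nonneg h.L_pos n
  positivity

theorem InteractionBounds.norm_fm_mulOp_le (h : InteractionBounds L N U a C R)
    (J : Finset (Fin N)) (t : Fin N × Fin N × Fin N) {ψ : L2N N}
    (hψ : wsum (sqw (prodSymbol L J)) ψ ≠ ⊤) :
    wsum (sqw (prodSymbol L J)) (mulOp (U t) ψ) ≠ ⊤ ∧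
    ‖fm (prodSymbol L J) (mulOp (U t) ψ)‖
      ≤ C * R ^ (6 + (J ∩ members t).card) * ‖fm (prodSymbol L J) ψ‖ := by
  have h1 := h.wsum_mulOp_le J t ψ
  have h2 := ne_top_of_le_ne_top (ENNReal.mul_ne_top ENNReal.ofReal_ne_top hψ) h1
  refine ⟨h2, norm_le_of_enorm_sq_le ?_ ?_⟩
  · have := h.C_nonneg
    have := h.one_le_R
    positivity
  · rwa [enorm_fm_sq h2, enorm_fm_sq hψ]

/-- The interaction shifts only the frequencies of the particles in t, and the symbol of S_J does
not depend on them. -/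
theorem InteractionBounds.fm_mulOp_of_disjoint (h : InteractionBounds L N U a C R)
    {J : Finset (Fin N)} {t : Fin N × Fin N × Fin N} (hd : Disjoint J (members t)) {ψ : L2N N}
    (hψ : wsum (sqw (prodSymbol L J)) ψ ≠ ⊤) :
    fm (prodSymbol L J) (mulOp (U t) ψ) = mulOp (U t) (fm (prodSymbol L J) ψ) := by
  refine fm_eq_of_fc fun ξ => ?_
  refine (fc_mulOp h.summable_norm (h.hasSum t) _ ξ).unique ?_
  convert! (fc_mulOp h.summable_norm (h.hasSum t) ψ ξ).mul_left (prodSymbol L J ξ : ℂ) using 2 with n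
  have h1 := prodSymbol_add_shift_of_disjoint (L := L) hd (ξ - shift t n) n
  rw [sub_add_cancel] at h1
  rw [fc_fm hψ, h1]
  ring

theorem prodSymbol_singleton (j : Fin N) (ξ : Fin N × Fin 3 → ℤ) :
    prodSymbol L {j} ξ = japaneseSymbol L j ξ := Finset.prod_singleton _ _

/-- Lower bound of `Re ⟨S_j² φ, U_t φ⟩`. -/
theorem InteractionBounds.re_inner_kinetic_mulOp_ge (h : InteractionBounds L N U a C R)
    (j : Fin N) (t : Fin N × Fin N × Fin N) {φ : L2N N} (hφ : MemSobolev L 2 φ) :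
    -(if j ∈ members t then C * R ^ 7 * ‖fm (prodSymbol L {j}) φ‖ ^ 2 else 0)
      ≤ (⟪fm (fun ξ => prodSymbol L {j} ξ ^ 2) φ, mulOp (U t) φ⟫_ℂ).re := by
  have h1 : wsum (sqw (prodSymbol L {j})) φ ≠ ⊤ :=
    (hφ.mono h.one_le_N one_le_two).of_le (c := N) fun ξ => ENNReal.ofReal_le_ofReal (by
      simpa using prodSymbol_sq_le (L := L) h.one_le_N {j} ξ)
  have h2 : wsum (sqw fun ξ => prodSymbol L {j} ξ ^ 2) φ ≠ ⊤ :=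
    hφ.of_le (c := N ^ 2) fun ξ => ENNReal.ofReal_le_ofReal (by
      have h3 := prodSymbol_sq_le (L := L) h.one_le_N {j} ξ
      rw [Finset.card_singleton, pow_one] at h3
      rw [← mul_pow]
      gcongr)
  obtain ⟨h3, h4⟩ := h.norm_fm_mulOp_le {j} t h1
  -- One factor S_j moves to the right: the form is Re⟨S_j φ, S_j U_t φ⟩. If j ∈ t, Cauchy–Schwarz
  -- and the bound of U_t under one derivative give R^{6+1}.
  rw [inner_fm_sq h2 h1 h3]
  split_ifs with hj
  · have hcard : ({j} ∩ members t).card = 1 := by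
      rw [Finset.singleton_inter_of_mem hj, Finset.card_singleton]
    rw [hcard] at h4
    have h5 := (Complex.abs_re_le_norm _).trans
      (norm_inner_le_norm (𝕜 := ℂ) (fm (prodSymbol L {j}) φ) (fm (prodSymbol L {j}) (mulOp (U t) φ)))
    have h6 : ‖fm (prodSymbol L {j}) φ‖ * ‖fm (prodSymbol L {j}) (mulOp (U t) φ)‖
        ≤ ‖fm (prodSymbol L {j}) φ‖ * (C * R ^ 7 * ‖fm (prodSymbol L {j}) φ‖) := by
      gcongr
    have h7 := (abs_le.1 h5).1
    nlinarith
  -- If j ∉ t, the form becomes ⟨S_j φ, U_t S_j φ⟩, nonnegative because U_t is.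
  · rw [h.fm_mulOp_of_disjoint (Finset.disjoint_singleton_left.2 hj) h1, neg_zero]
    exact re_inner_mulOp_nonneg (h.nonneg t) _

/-- The relative size of the commutation errors for products of `k` derivatives. -/
def energyError (C ρ k : ℝ) : ℝ := 6 * C * ρ + 3 * C * k * ρ * (1 + k * ρ) ^ 2

/-- With u equal to R on J and 1 off J, R^{|J ∩ t|} is the product of u over t. If t meets J, one of
the three factors may be replaced by v, which vanishes off J; summing freely gives 3 (∑ v)(∑ u)².
One sum is thus restricted to J, and this is what gains the factor 1/N. -/
theorem sum_triples_prod_le {J : Finset (Fin N)} (hR : 1 ≤ R) :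
    ∑ t ∈ (triples N).filter (fun t => ¬Disjoint J (members t)), R ^ (J ∩ members t).card
      ≤ 3 * (J.card * R) * (N + J.card * R) ^ 2 := by
  have hR0 : 0 ≤ R := zero_le_one.trans hR
  set u : Fin N → ℝ := fun m => if m ∈ J then R else 1 with hu
  set v : Fin N → ℝ := fun m => if m ∈ J then R else 0 with hv
  have hu0 : ∀ m, 0 ≤ u m := fun m => by simp only [hu]; split_ifs <;> positivity
  have hv0 : ∀ m, 0 ≤ v m := fun m => by simp only [hv]; split_ifs <;> positivity
  have hpt : ∀ t ∈ (triples N).filter (fun t => ¬Disjoint J (members t)),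
      R ^ (J ∩ members t).card ≤ v t.1 * u t.2.1 * u t.2.2 + u t.1 * v t.2.1 * u t.2.2
        + u t.1 * u t.2.1 * v t.2.2 := by
    rintro ⟨i, j, l⟩ ht
    simp only [triples, Finset.mem_filter, Finset.mem_univ, true_and] at ht
    obtain ⟨⟨hij, hjl⟩, hd⟩ := ht
    have hij' := hij.ne
    have hjl' := hjl.ne
    have hil' := (hij.trans hjl).ne
    have hprod : R ^ (J ∩ members (i, j, l)).card = u i * u j * u l := by
      rw [Finset.inter_comm, ← Finset.filter_mem_eq_inter, ← Finset.prod_const,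
        Finset.prod_filter, members, Finset.prod_insert (by simp [hij', hil']),
        Finset.prod_insert (by simp [hjl']), Finset.prod_singleton, mul_assoc]
    rw [hprod]
    have hmem : i ∈ J ∨ j ∈ J ∨ l ∈ J := by
      rw [Finset.not_disjoint_iff] at hd
      obtain ⟨m, hmJ, hm⟩ := hd
      simp only [members, Finset.mem_insert, Finset.mem_singleton] at hm
      rcases hm with rfl | rfl | rfl
      · exact Or.inl hmJ
      · exact Or.inr (Or.inl hmJ)
      · exact Or.inr (Or.inr hmJ)
    have e1 := mul_nonneg (mul_nonneg (hv0 i) (hu0 j)) (hu0 l)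
    have e2 := mul_nonneg (mul_nonneg (hu0 i) (hv0 j)) (hu0 l)
    have e3 := mul_nonneg (mul_nonneg (hu0 i) (hu0 j)) (hv0 l)
    rcases hmem with hm | hm | hm
    · have : v i = u i := by simp [hu, hv, hm]
      rw [this] at e1 ⊢
      simp only
      linarith
    · have : v j = u j := by simp [hu, hv, hm]
      rw [this] at e2 ⊢
      simp only
      linarith
    · have : v l = u l := by simp [hu, hv, hm]
      rw [this] at e3 ⊢
      simp only
      linarith
  have hsv : ∑ m, v m = J.card * R := by
    simp [hv, Finset.sum_ite_mem]
  have hsu : ∑ m, u m ≤ N + J.card * R := by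
    calc ∑ m, u m ≤ ∑ m, (1 + v m) := by
          refine Finset.sum_le_sum fun m _ => ?_
          simp only [hu, hv]
          split_ifs <;> linarith
      _ = _ := by rw [Finset.sum_add_distrib, hsv]; simp
  have hsu0 : 0 ≤ ∑ m, u m := Finset.sum_nonneg fun m _ => hu0 m
  calc _ ≤ ∑ t ∈ (triples N).filter (fun t => ¬Disjoint J (members t)),
        (v t.1 * u t.2.1 * u t.2.2 + u t.1 * v t.2.1 * u t.2.2 + u t.1 * u t.2.1 * v t.2.2) :=
        Finset.sum_le_sum hpt
    _ ≤ ∑ t : Fin N × Fin N × Fin N,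
        (v t.1 * u t.2.1 * u t.2.2 + u t.1 * v t.2.1 * u t.2.2 + u t.1 * u t.2.1 * v t.2.2) := by
        refine Finset.sum_le_sum_of_subset_of_nonneg (Finset.subset_univ _) fun t _ _ => ?_
        have e1 := mul_nonneg (mul_nonneg (hv0 t.1) (hu0 t.2.1)) (hu0 t.2.2)
        have e2 := mul_nonneg (mul_nonneg (hu0 t.1) (hv0 t.2.1)) (hu0 t.2.2)
        have e3 := mul_nonneg (mul_nonneg (hu0 t.1) (hu0 t.2.1)) (hv0 t.2.2)
        linarith
    _ = 3 * (∑ m, v m) * (∑ m, u m) ^ 2 := by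
        simp only [Fintype.sum_prod_type, Finset.sum_add_distrib, mul_assoc, ← Finset.mul_sum,
          ← Finset.sum_mul]
        ring
    _ ≤ _ := by
        rw [hsv]
        have : (0 : ℝ) ≤ J.card * R := by positivity
        gcongr

/-- A given particle lies in at most 3 N² triples. -/
theorem sum_triples_members_le {f : Fin N → ℝ} (hf : ∀ j, 0 ≤ f j)
    (D : Finset (Fin N × Fin N × Fin N)) :
    ∑ t ∈ D, ∑ j, (if j ∈ members t then f j else 0) ≤ 3 * N ^ 2 * ∑ j, f j := by
  have hpt : ∀ t : Fin N × Fin N × Fin N,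
      ∑ j, (if j ∈ members t then f j else 0) ≤ f t.1 + f t.2.1 + f t.2.2 := by
    intro t
    rw [Finset.sum_ite_mem, Finset.univ_inter, members]
    have h1 : ∀ (x : Fin N) (s : Finset (Fin N)), ∑ j ∈ insert x s, f j ≤ f x + ∑ j ∈ s, f j := by
      intro x s
      by_cases hx : x ∈ s
      · rw [Finset.insert_eq_of_mem hx]
        linarith [hf x]
      · rw [Finset.sum_insert hx]
    have h2 := h1 t.1 {t.2.1, t.2.2}
    have h3 := h1 t.2.1 {t.2.2}
    rw [Finset.sum_singleton] at h3
    linarith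
  calc _ ≤ ∑ t ∈ D, (f t.1 + f t.2.1 + f t.2.2) := Finset.sum_le_sum fun t _ => hpt t
    _ ≤ ∑ t : Fin N × Fin N × Fin N, (f t.1 + f t.2.1 + f t.2.2) :=
        Finset.sum_le_sum_of_subset_of_nonneg (Finset.subset_univ _) fun t _ _ => by
          linarith [hf t.1, hf t.2.1, hf t.2.2]
    _ = _ := by
        simp only [Fintype.sum_prod_type, Finset.sum_add_distrib, Finset.sum_const,
          Finset.card_univ, Fintype.card_fin, Fintype.card_prod, nsmul_eq_mul, ← Finset.mul_sum]
        push_cast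
        ring

theorem norm_le_norm_fm_meanSymbol (hN : 1 ≤ N) {φ : L2N N} (hφ : MemSobolev L 2 φ) :
    wsum (sqw (meanSymbol L N)) φ ≠ ⊤ ∧ ‖φ‖ ≤ ‖fm (meanSymbol L N) φ‖ := by
  have h1 : wsum (sqw (meanSymbol L N)) φ ≠ ⊤ := hφ
  refine ⟨h1, ?_⟩
  have h2 : ‖φ‖ ≤ 1 * ‖fm (meanSymbol L N) φ‖ := by
    refine norm_le_of_enorm_sq_le zero_le_one ?_
    rw [enorm_fm_sq h1, ← wsum_one]
    simp only [one_pow, ENNReal.ofReal_one, one_mul]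
    refine wsum_mono (fun ξ => ?_) φ
    rw [sqw, ENNReal.one_le_ofReal]
    exact one_le_pow₀ (one_le_meanSymbol L hN ξ)
  rwa [one_mul] at h2

/-- The kinetic energy dominates: lower bound of `‖(T + W) φ‖`, where `W` is the interaction of
some of the triples. -/
theorem InteractionBounds.norm_kinetic_add_ge (h : InteractionBounds L N U a C R) {φ : L2N N}
    (hφ : MemSobolev L 2 φ) (D : Finset (Fin N × Fin N × Fin N)) (hρ : 6 * C * (R ^ 7 / N) ≤ 1) :
    (1 - 6 * C * (R ^ 7 / N)) * ‖fm (meanSymbol L N) φ‖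
      ≤ ‖fm (meanSymbol L N) φ + ((N : ℂ) ^ 3)⁻¹ • ∑ t ∈ D, mulOp (U t) φ‖ := by
  have hN0 : (0 : ℝ) < N := by exact_mod_cast h.one_le_N
  have hR0 : 0 ≤ R := zero_le_one.trans h.one_le_R
  have hC0 := h.C_nonneg
  obtain ⟨h1, h2⟩ := norm_le_norm_fm_meanSymbol h.one_le_N hφ
  set X := fm (meanSymbol L N) φ with hX
  set Y : Fin N → L2N N := fun j => fm (fun ξ => prodSymbol L {j} ξ ^ 2) φ with hY
  set f : Fin N → ℝ := fun j => ‖fm (prodSymbol L {j}) φ‖ ^ 2 with hf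
  have hfin1 : ∀ j : Fin N, wsum (sqw (prodSymbol L {j})) φ ≠ ⊤ := fun j =>
    (hφ.mono h.one_le_N one_le_two).of_le (c := N) fun ξ => ENNReal.ofReal_le_ofReal (by
      simpa using prodSymbol_sq_le (L := L) h.one_le_N {j} ξ)
  have hfin2 : ∀ j : Fin N, wsum (sqw fun ξ => prodSymbol L {j} ξ ^ 2) φ ≠ ⊤ := fun j =>
    hφ.of_le (c := N ^ 2) fun ξ => ENNReal.ofReal_le_ofReal (by
      have h3 := prodSymbol_sq_le (L := L) h.one_le_N {j} ξ
      rw [Finset.card_singleton, pow_one] at h3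
      rw [← mul_pow]
      gcongr)
  have hXY : X = ((N : ℂ))⁻¹ • ∑ j, Y j := by
    refine fc_ext fun ξ => ?_
    rw [hX, fc_fm h1, fc_smul, fc_sum]
    have hYj : ∀ j, fc (Y j) ξ = (japaneseSymbol L j ξ ^ 2 : ℝ) * fc φ ξ := fun j => by
      rw [hY, ← prodSymbol_singleton]
      exact fc_fm (hfin2 j) ξ
    rw [Finset.sum_congr rfl fun j _ => hYj j, ← Finset.sum_mul, ← mul_assoc, meanSymbol]
    push_cast
    rfl
  have hre : ∀ χ : L2N N, (⟪X, χ⟫_ℂ).re = (N : ℝ)⁻¹ * ∑ j, (⟪Y j, χ⟫_ℂ).re := by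
    intro χ
    rw [hXY, inner_smul_left, sum_inner, map_inv₀, Complex.conj_natCast, ← Complex.ofReal_natCast,
      ← Complex.ofReal_inv, Complex.re_ofReal_mul, Complex.re_sum]
  -- The sum of ‖S_j φ‖² is N ⟨T φ, φ⟩, and T ≥ 1 gives ‖φ‖ ≤ ‖T φ‖.
  have hsumf : ∑ j, f j ≤ N * ‖X‖ ^ 2 := by
    have h3 : ∑ j, f j = N * (⟪X, φ⟫_ℂ).re := by
      rw [hre, mul_inv_cancel_left₀ hN0.ne']
      refine Finset.sum_congr rfl fun j _ => ?_
      rw [hY]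
      simp only
      rw [inner_fm_sq (hfin2 j) (hfin1 j) (hfin1 j), inner_self_eq_norm_sq_to_K]
      simp [hf, ← Complex.ofReal_pow]
    rw [h3]
    have h4 := (Complex.abs_re_le_norm _).trans (norm_inner_le_norm (𝕜 := ℂ) X φ)
    have h5 := (abs_le.1 h4).2
    have h6 : ‖X‖ * ‖φ‖ ≤ ‖X‖ * ‖X‖ := by gcongr
    gcongr
    nlinarith
  have hf0 : ∀ j, 0 ≤ f j := fun j => sq_nonneg _
  -- Powers of N: N⁻¹ from T, N⁻³ from W, 3 N² triples containing a given particle, and N from the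
  -- sum of ‖S_j φ‖².
  have hinner : -(3 * C * (R ^ 7 / N) * ‖X‖ ^ 2)
      ≤ (⟪X, ((N : ℂ) ^ 3)⁻¹ • ∑ t ∈ D, mulOp (U t) φ⟫_ℂ).re := by
    have h3 : ∀ t, -(N : ℝ)⁻¹ * (C * R ^ 7 * ∑ j, (if j ∈ members t then f j else 0))
        ≤ (⟪X, mulOp (U t) φ⟫_ℂ).re := by
      intro t
      rw [hre, neg_mul, ← mul_neg, Finset.mul_sum, ← Finset.sum_neg_distrib]
      gcongr with j _
      refine le_trans (le_of_eq ?_) (h.re_inner_kinetic_mulOp_ge j t hφ)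
      rw [mul_ite, mul_zero]
    have h4 : -(N : ℝ)⁻¹ * (C * R ^ 7 * (3 * N ^ 2 * (N * ‖X‖ ^ 2)))
        ≤ ∑ t ∈ D, (⟪X, mulOp (U t) φ⟫_ℂ).re := by
      refine le_trans ?_ (Finset.sum_le_sum fun t _ => h3 t)
      rw [← Finset.mul_sum, ← Finset.mul_sum, neg_mul, neg_mul, neg_le_neg_iff]
      have h5 := sum_triples_members_le hf0 D
      have h6 : 3 * (N : ℝ) ^ 2 * ∑ j, f j ≤ 3 * N ^ 2 * (N * ‖X‖ ^ 2) := by gcongr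
      gcongr
      exact h5.trans h6
    rw [inner_smul_right, inner_sum]
    have h7 : (((N : ℂ) ^ 3)⁻¹ * ∑ t ∈ D, ⟪X, mulOp (U t) φ⟫_ℂ).re
        = ((N : ℝ) ^ 3)⁻¹ * ∑ t ∈ D, (⟪X, mulOp (U t) φ⟫_ℂ).re := by
      rw [← Complex.ofReal_natCast, ← Complex.ofReal_pow, ← Complex.ofReal_inv,
        Complex.re_ofReal_mul, Complex.re_sum]
    rw [h7]
    calc _ = ((N : ℝ) ^ 3)⁻¹ * (-(N : ℝ)⁻¹ * (C * R ^ 7 * (3 * N ^ 2 * (N * ‖X‖ ^ 2)))) := by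
          field_simp
      _ ≤ _ := by gcongr
  set W := ((N : ℂ) ^ 3)⁻¹ • ∑ t ∈ D, mulOp (U t) φ with hW
  have hsq : (1 - 6 * C * (R ^ 7 / N)) * ‖X‖ ^ 2 ≤ ‖X + W‖ ^ 2 := by
    have h8 := norm_add_sq (𝕜 := ℂ) X W
    rw [RCLike.re_eq_complex_re] at h8
    rw [h8]
    nlinarith [sq_nonneg ‖W‖]
  have hρ0 : 0 ≤ 6 * C * (R ^ 7 / N) := by positivity
  -- For x = 6 C ρ in [0, 1] one has (1 - x)² ≤ 1 - x, so the bound on squares yields the bound on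
  -- norms.
  refine le_of_sq_le_sq ?_ (norm_nonneg _)
  rw [mul_pow]
  refine le_trans ?_ hsq
  gcongr
  nlinarith

/-- The induction step of the energy estimate, for a fixed set `J` of derivatives. -/
theorem InteractionBounds.wsum_shiftedOp_ge (h : InteractionBounds L N U a C R)
    (J : Finset (Fin N)) {ψ : L2N N} (hψ : MemSobolev L (J.card + 2) ψ) {c : ℝ} (hc : 0 ≤ c)
    (hρ : energyError C (R ^ 7 / N) J.card ≤ 1 - c) :
    ENNReal.ofReal (c ^ 2) * wsum (sqw fun ξ => prodSymbol L J ξ * meanSymbol L N ξ) ψ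
      ≤ wsum (sqw (prodSymbol L J)) (shiftedOp L U ψ) := by
  have hN0 : (0 : ℝ) < N := by exact_mod_cast h.one_le_N
  have hR := h.one_le_R
  have hR0 : 0 ≤ R := zero_le_one.trans h.one_le_R
  have hC0 := h.C_nonneg
  have hp : ∀ ξ, prodSymbol L J ξ ^ 2 ≤ N ^ J.card * meanSymbol L N ξ ^ J.card := fun ξ => by
    rw [← mul_pow]
    exact prodSymbol_sq_le h.one_le_N J ξ
  have hfp : wsum (sqw (prodSymbol L J)) ψ ≠ ⊤ :=
    (hψ.mono h.one_le_N (Nat.le_add_right _ _)).of_le fun ξ => ENNReal.ofReal_le_ofReal (hp ξ)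
  have hfτ : wsum (sqw (meanSymbol L N)) ψ ≠ ⊤ :=
    hψ.mono h.one_le_N (Nat.le_add_left 2 _)
  set φ := fm (prodSymbol L J) ψ with hφdef
  have hφ : MemSobolev L 2 φ := by
    rw [MemSobolev, hφdef, wsum_fm hfp]
    refine hψ.of_le (c := N ^ J.card) fun ξ => ?_
    rw [sobolevWeight, sqw, ← ENNReal.ofReal_mul (sq_nonneg _)]
    refine ENNReal.ofReal_le_ofReal ?_
    rw [pow_add, ← mul_assoc, mul_comm]
    gcongr
    exact hp ξ
  obtain ⟨h1, h2⟩ := norm_le_norm_fm_meanSymbol h.one_le_N hφ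
  set X := fm (meanSymbol L N) φ with hX
  -- S_J A ψ = Z + E: Z = (T + W_D) S_J ψ collects the triples that commute with S_J, E the
  -- remaining ones.
  set D := (triples N).filter (fun t => Disjoint J (members t)) with hD
  set M := (triples N).filter (fun t => ¬Disjoint J (members t)) with hM
  set Z := X + ((N : ℂ) ^ 3)⁻¹ • ∑ t ∈ D, mulOp (U t) φ with hZ
  set E := ((N : ℂ) ^ 3)⁻¹ • ∑ t ∈ M, fm (prodSymbol L J) (mulOp (U t) ψ) with hE
  have hfcX : ∀ ξ, fc X ξ = ((prodSymbol L J ξ * meanSymbol L N ξ : ℝ) : ℂ) * fc ψ ξ := by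
    intro ξ
    rw [hX, fc_fm h1, hφdef, fc_fm hfp]
    push_cast
    ring
  have hfcZE : ∀ ξ, fc (Z + E) ξ = prodSymbol L J ξ * fc (shiftedOp L U ψ) ξ := by
    intro ξ
    have hsplit : ∑ t ∈ triples N, fc (mulOp (U t) ψ) ξ
        = ∑ t ∈ D, fc (mulOp (U t) ψ) ξ + ∑ t ∈ M, fc (mulOp (U t) ψ) ξ :=
      (Finset.sum_filter_add_sum_filter_not _ _ _).symm
    have hDt : ∑ t ∈ D, fc (mulOp (U t) φ) ξ
        = prodSymbol L J ξ * ∑ t ∈ D, fc (mulOp (U t) ψ) ξ := by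
      rw [Finset.mul_sum]
      refine Finset.sum_congr rfl fun t ht => ?_
      rw [hφdef, ← h.fm_mulOp_of_disjoint (Finset.mem_filter.1 ht).2 hfp,
        fc_fm (h.norm_fm_mulOp_le J t hfp).1]
    have hMt : ∑ t ∈ M, fc (fm (prodSymbol L J) (mulOp (U t) ψ)) ξ
        = prodSymbol L J ξ * ∑ t ∈ M, fc (mulOp (U t) ψ) ξ := by
      rw [Finset.mul_sum]
      exact Finset.sum_congr rfl fun t _ => fc_fm (h.norm_fm_mulOp_le J t hfp).1 ξ
    rw [hZ, hE, shiftedOp]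
    simp only [fc_add, fc_smul, fc_sum]
    rw [hfcX, fc_fm hfτ, hsplit, hDt, hMt]
    push_cast
    ring
  rw [wsum_eq_of_fc hfcX, wsum_eq_of_fc hfcZE]
  -- No sign is used for triples meeting J: there are few of them, and ‖φ‖ ≤ ‖T φ‖.
  have hEle : ‖E‖ ≤ 3 * C * J.card * (R ^ 7 / N) * (1 + J.card * (R ^ 7 / N)) ^ 2 * ‖X‖ := by
    have h3 : ‖∑ t ∈ M, fm (prodSymbol L J) (mulOp (U t) ψ)‖
        ≤ C * R ^ 6 * (3 * (J.card * R) * (N + J.card * R) ^ 2) * ‖X‖ := by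
      calc _ ≤ ∑ t ∈ M, ‖fm (prodSymbol L J) (mulOp (U t) ψ)‖ := norm_sum_le _ _
        _ ≤ ∑ t ∈ M, C * R ^ 6 * R ^ (J ∩ members t).card * ‖φ‖ := by
            refine Finset.sum_le_sum fun t _ => ?_
            have := (h.norm_fm_mulOp_le J t hfp).2
            rwa [pow_add, ← mul_assoc] at this
        _ = C * R ^ 6 * (∑ t ∈ M, R ^ (J ∩ members t).card) * ‖φ‖ := by
            rw [Finset.mul_sum, Finset.sum_mul]
        _ ≤ _ := by
            have := sum_triples_prod_le (J := J) h.one_le_R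
            gcongr
    have h4 : ‖E‖ = ((N : ℝ) ^ 3)⁻¹ * ‖∑ t ∈ M, fm (prodSymbol L J) (mulOp (U t) ψ)‖ := by
      rw [hE, norm_smul, norm_inv, norm_pow, Complex.norm_natCast]
    rw [h4]
    calc _ ≤ ((N : ℝ) ^ 3)⁻¹ *
          (C * R ^ 6 * (3 * (J.card * R) * (N + J.card * R) ^ 2) * ‖X‖) := by gcongr
      _ = 3 * C * J.card * (R ^ 7 / N) * (1 + J.card * (R / N)) ^ 2 * ‖X‖ := by
          field_simp
      _ ≤ _ := by
          -- The weaker form with R⁷/N leaves a single small parameter.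
          have : R ≤ R ^ 7 := le_self_pow₀ hR (by norm_num)
          gcongr
  have hZge : (1 - 6 * C * (R ^ 7 / N)) * ‖X‖ ≤ ‖Z‖ := by
    refine h.norm_kinetic_add_ge hφ D ?_
    have : 0 ≤ 3 * C * J.card * (R ^ 7 / N) * (1 + J.card * (R ^ 7 / N)) ^ 2 := by positivity
    rw [energyError] at hρ
    linarith
  have hfinal : c * ‖X‖ ≤ ‖Z + E‖ := by
    have h5 : ‖Z‖ ≤ ‖Z + E‖ + ‖E‖ := by
      simpa using norm_sub_le (Z + E) E
    rw [energyError] at hρ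
    have h6 := mul_le_mul_of_nonneg_right hρ (norm_nonneg X)
    nlinarith
  rw [ENNReal.ofReal_pow hc, ← mul_pow, ← ofReal_norm, ← ofReal_norm, ← ENNReal.ofReal_mul hc]
  gcongr

end KeyEstimate

/-! ### Averages over sets of particles -/

section Averages

variable {N : ℕ}

/-- Double counting: a set of k + 1 particles arises from k + 1 pairs (J, j), one for each choice of
the inserted element. -/
theorem sum_powersetCard_sum_insert (k : ℕ) (F : Finset (Fin N) → ℝ) :
    ∑ J ∈ Finset.powersetCard k Finset.univ, ∑ j ∈ Jᶜ, F (insert j J)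
      = (k + 1) * ∑ J ∈ Finset.powersetCard (k + 1) Finset.univ, F J := by
  have h1 : ∑ J ∈ Finset.powersetCard (k + 1) Finset.univ, ∑ _j ∈ J, F J
      = (k + 1) * ∑ J ∈ Finset.powersetCard (k + 1) (Finset.univ : Finset (Fin N)), F J := by
    rw [Finset.mul_sum]
    refine Finset.sum_congr rfl fun J hJ => ?_
    rw [Finset.sum_const, (Finset.mem_powersetCard.1 hJ).2]
    simp
  rw [← h1, Finset.sum_sigma', Finset.sum_sigma']
  refine Finset.sum_bij' (fun p _ => ⟨insert p.2 p.1, p.2⟩) (fun p _ => ⟨p.1.erase p.2, p.2⟩)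
    ?_ ?_ ?_ ?_ ?_
  · rintro ⟨J, j⟩ h
    simp only [Finset.mem_sigma, Finset.mem_powersetCard, Finset.subset_univ, true_and,
      Finset.mem_compl] at h ⊢
    exact ⟨by rw [Finset.card_insert_of_notMem h.2, h.1], Finset.mem_insert_self _ _⟩
  · rintro ⟨J, j⟩ h
    simp only [Finset.mem_sigma, Finset.mem_powersetCard, Finset.subset_univ, true_and,
      Finset.mem_compl] at h ⊢
    exact ⟨by rw [Finset.card_erase_of_mem h.2, h.1]; rfl, Finset.notMem_erase _ _⟩
  · rintro ⟨J, j⟩ h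
    simp only [Finset.mem_sigma, Finset.mem_compl] at h
    simp [Finset.erase_insert h.2]
  · rintro ⟨J, j⟩ h
    simp only [Finset.mem_sigma] at h
    simp [Finset.insert_erase h.2]
  · rintro ⟨J, j⟩ _
    rfl

/-- The elementary symmetric functions of nonnegative numbers satisfy
`(k + 1) (k + 2) e_{k+2} ≤ e_1² e_k`, with an explicit part of the remainder. -/
theorem esymm_mul_sq_ge (k : ℕ) {x : Fin N → ℝ} (hx : ∀ j, 0 ≤ x j) :
    ((k : ℝ) + 1) * (k + 2) * ∑ J ∈ Finset.powersetCard (k + 2) Finset.univ, ∏ j ∈ J, x j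
      + ∑ J ∈ Finset.powersetCard k Finset.univ, ∑ j ∈ Jᶜ, x j * ∏ i ∈ insert j J, x i
      ≤ (∑ j, x j) ^ 2 * ∑ J ∈ Finset.powersetCard k Finset.univ, ∏ j ∈ J, x j := by
  have h1 : ((k : ℝ) + 1) * (k + 2) *
      ∑ J ∈ Finset.powersetCard (k + 2) Finset.univ, ∏ j ∈ J, x j
      = ∑ J ∈ Finset.powersetCard k Finset.univ, ∑ j ∈ Jᶜ,
          ∑ i ∈ (insert j J)ᶜ, ∏ m ∈ insert i (insert j J), x m := by
    rw [sum_powersetCard_sum_insert k fun J => ∑ i ∈ Jᶜ, ∏ m ∈ insert i J, x m,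
      sum_powersetCard_sum_insert (k + 1) fun J => ∏ m ∈ J, x m]
    push_cast
    ring
  rw [h1, ← Finset.sum_add_distrib, Finset.mul_sum]
  refine Finset.sum_le_sum fun J _ => ?_
  rw [← Finset.sum_add_distrib]
  have hP : 0 ≤ ∏ j ∈ J, x j := Finset.prod_nonneg fun j _ => hx j
  -- The second index i runs off J ∪ {j}; the diagonal term supplies exactly the missing value i =
  -- j.
  have h2 : ∀ j ∈ Jᶜ, ∑ i ∈ (insert j J)ᶜ, ∏ m ∈ insert i (insert j J), x m
      + x j * ∏ i ∈ insert j J, x i = x j * (∑ i ∈ Jᶜ, x i) * ∏ m ∈ J, x m := by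
    intro j hj
    have hjJ : j ∉ J := Finset.mem_compl.1 hj
    have h3 : ∑ i ∈ Jᶜ, x i = ∑ i ∈ (insert j J)ᶜ, x i + x j := by
      rw [Finset.compl_insert, Finset.sum_erase_add _ _ hj]
    have h4 : ∀ i ∈ (insert j J)ᶜ, ∏ m ∈ insert i (insert j J), x m
        = x j * x i * ∏ m ∈ J, x m := by
      intro i hi
      rw [Finset.prod_insert (Finset.mem_compl.1 hi), Finset.prod_insert hjJ]
      ring
    rw [Finset.sum_congr rfl h4, Finset.prod_insert hjJ, h3, ← Finset.sum_mul, ← Finset.mul_sum]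
    ring
  rw [Finset.sum_congr rfl h2, ← Finset.sum_mul, ← Finset.sum_mul, ← sq]
  -- The only loss: both indices may be chosen in J as well.
  have h5 : ∑ i ∈ Jᶜ, x i ≤ ∑ i, x i :=
    Finset.sum_le_sum_of_subset_of_nonneg (Finset.subset_univ _) fun i _ _ => hx i
  have h6 : 0 ≤ ∑ i ∈ Jᶜ, x i := Finset.sum_nonneg fun i _ => hx i
  gcongr

/-- The average `N^{-k} ∑ ∏ ⟨2 π ξ_{j_i} / L⟩²` over the ordered `k`-tuples of distinct
particles. -/
def avgSymbol (L : ℝ) (N k : ℕ) (ξ : Fin N × Fin 3 → ℤ) : ℝ :=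
  k.factorial / (N : ℝ) ^ k *
    ∑ J ∈ Finset.powersetCard k (Finset.univ : Finset (Fin N)), prodSymbol L J ξ ^ 2

/-- The diagonal remainder in the comparison of averages. -/
def diagSymbol (L : ℝ) (N k : ℕ) (ξ : Fin N × Fin 3 → ℤ) : ℝ :=
  k.factorial / (N : ℝ) ^ (k + 2) *
    ∑ J ∈ Finset.powersetCard k (Finset.univ : Finset (Fin N)), ∑ j ∈ Jᶜ,
      (japaneseSymbol L j ξ * prodSymbol L (insert j J) ξ) ^ 2

theorem avgSymbol_nonneg (L : ℝ) (N k : ℕ) (ξ : Fin N × Fin 3 → ℤ) : 0 ≤ avgSymbol L N k ξ := by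
  unfold avgSymbol
  positivity

theorem diagSymbol_nonneg (L : ℝ) (N k : ℕ) (ξ : Fin N × Fin 3 → ℤ) :
    0 ≤ diagSymbol L N k ξ := by
  unfold diagSymbol
  positivity

theorem avgSymbol_zero (L : ℝ) (N : ℕ) (ξ : Fin N × Fin 3 → ℤ) : avgSymbol L N 0 ξ = 1 := by
  simp [avgSymbol, prodSymbol]

theorem avgSymbol_one (L : ℝ) (N : ℕ) (ξ : Fin N × Fin 3 → ℤ) :
    avgSymbol L N 1 ξ = meanSymbol L N ξ := by
  simp [avgSymbol, prodSymbol, meanSymbol, Finset.powersetCard_one]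

/-- `esymm_mul_sq_ge` at the numbers ⟨ξ_j⟩², multiplied by k!/N^{k+2}. The factor (k+1)(k+2)
completes the factorial, so the induction loses no combinatorial constant. -/
theorem avgSymbol_add_two_le (L : ℝ) (N k : ℕ) (ξ : Fin N × Fin 3 → ℤ) :
    avgSymbol L N (k + 2) ξ + diagSymbol L N k ξ ≤ avgSymbol L N k ξ * meanSymbol L N ξ ^ 2 := by
  have h := esymm_mul_sq_ge k (x := fun j => japaneseSymbol L j ξ ^ 2) fun j => sq_nonneg _
  simp only [Finset.prod_pow] at h
  rw [avgSymbol, diagSymbol, avgSymbol, meanSymbol, Nat.factorial_succ, Nat.factorial_succ]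
  have h2 : (0 : ℝ) ≤ k.factorial / (N : ℝ) ^ (k + 2) := by positivity
  have h3 := mul_le_mul_of_nonneg_left h h2
  rw [mul_add] at h3
  refine le_trans (le_of_eq ?_) (h3.trans (le_of_eq ?_))
  · congr 1
    · simp only [prodSymbol]
      push_cast
      ring
    · simp only [prodSymbol, mul_pow]
  · simp only [prodSymbol]
    rw [mul_pow, inv_pow, pow_add]
    field_simp

variable {L : ℝ} {U : Fin N × Fin N × Fin N → C(UnitAddTorus (Fin N × Fin 3), ℝ)} {a : Mode → ℂ}
  {C R : ℝ}

theorem ofReal_avgSymbol_mul (k : ℕ) {F : (Fin N × Fin 3 → ℤ) → ℝ}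
    (ψ : L2N N) :
    wsum (fun ξ => ENNReal.ofReal (avgSymbol L N k ξ * F ξ ^ 2)) ψ
      = ENNReal.ofReal (k.factorial / (N : ℝ) ^ k) *
        ∑ J ∈ Finset.powersetCard k (Finset.univ : Finset (Fin N)),
          wsum (sqw fun ξ => prodSymbol L J ξ * F ξ) ψ := by
  rw [← wsum_finset_sum, ← wsum_const_mul]
  congr 1
  funext ξ
  simp only [sqw]
  rw [← ENNReal.ofReal_sum_of_nonneg fun J _ => sq_nonneg _, ← ENNReal.ofReal_mul (by positivity),
    avgSymbol, mul_assoc, Finset.sum_mul]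
  simp only [mul_pow]

/-- The induction step of the energy estimate. -/
theorem InteractionBounds.wsum_avgSymbol_shiftedOp_ge (h : InteractionBounds L N U a C R)
    {k : ℕ} {ψ : L2N N} (hψ : MemSobolev L (k + 2) ψ) {c : ℝ} (hc : 0 ≤ c)
    (hρ : energyError C (R ^ 7 / N) k ≤ 1 - c) :
    ENNReal.ofReal (c ^ 2) *
        (wsum (fun ξ => ENNReal.ofReal (avgSymbol L N (k + 2) ξ)) ψ
          + wsum (fun ξ => ENNReal.ofReal (diagSymbol L N k ξ)) ψ)
      ≤ wsum (fun ξ => ENNReal.ofReal (avgSymbol L N k ξ)) (shiftedOp L U ψ) := by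
  have h1 : wsum (fun ξ => ENNReal.ofReal (avgSymbol L N (k + 2) ξ)) ψ
      + wsum (fun ξ => ENNReal.ofReal (diagSymbol L N k ξ)) ψ
      ≤ wsum (fun ξ => ENNReal.ofReal (avgSymbol L N k ξ * meanSymbol L N ξ ^ 2)) ψ := by
    rw [← wsum_add]
    refine wsum_mono (fun ξ => ?_) ψ
    rw [← ENNReal.ofReal_add (avgSymbol_nonneg _ _ _ _) (diagSymbol_nonneg _ _ _ _)]
    exact ENNReal.ofReal_le_ofReal (avgSymbol_add_two_le L N k ξ)
  have h2 := ofReal_avgSymbol_mul (L := L) k (F := fun _ => 1) (shiftedOp L U ψ)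
  simp only [one_pow, mul_one] at h2
  rw [h2]
  calc _ ≤ ENNReal.ofReal (c ^ 2) *
        wsum (fun ξ => ENNReal.ofReal (avgSymbol L N k ξ * meanSymbol L N ξ ^ 2)) ψ := by gcongr
    _ ≤ _ := by
        rw [ofReal_avgSymbol_mul, mul_left_comm, Finset.mul_sum]
        gcongr with J hJ
        have hJk := (Finset.mem_powersetCard.1 hJ).2
        -- The estimate holds for each J separately with the same c, hence for the average.
        exact h.wsum_shiftedOp_ge J (by rwa [hJk]) hc (by rwa [hJk])

end Averages

/-! ### Permutation symmetry -/

section Symmetry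

variable {N : ℕ} {L : ℝ}

/-- Permuting coordinates preserves the measure of the torus and permutes the plane waves. -/
theorem fc_bosonic {ψ : L2N N} (hψ : IsBosonic ψ) (σ : Equiv.Perm (Fin N))
    (ξ : Fin N × Fin 3 → ℤ) : fc ψ (fun p => ξ (σ p.1, p.2)) = fc ψ ξ := by
  let e : Fin N × Fin 3 ≃ Fin N × Fin 3 := Equiv.prodCongr σ (Equiv.refl _)
  have hmp : MeasurePreserving (fun (x : UnitAddTorus (Fin N × Fin 3))
      (p : Fin N × Fin 3) => x (σ p.1, p.2)) volume volume :=
    volume_measurePreserving_piCongrLeft (fun _ : Fin N × Fin 3 => UnitAddCircle) e |>.symm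
  have hemb : MeasurableEmbedding (fun (x : UnitAddTorus (Fin N × Fin 3))
      (p : Fin N × Fin 3) => x (σ p.1, p.2)) :=
    (MeasurableEquiv.piCongrLeft (fun _ : Fin N × Fin 3 => UnitAddCircle) e).symm.measurableEmbedding
  rw [fc_eq_integral, fc_eq_integral,
    ← hmp.integral_comp hemb fun x => UnitAddTorus.mFourier (-fun p => ξ (σ p.1, p.2)) x * ψ x]
  refine integral_congr_ae ?_
  filter_upwards [hψ σ] with x hx
  rw [hx]
  congr 1
  simp only [UnitAddTorus.mFourier, ContinuousMap.coe_mk]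
  exact e.prod_comp fun p => fourier ((-ξ) p) (x p)

theorem wsum_bosonic {ψ : L2N N} (hψ : IsBosonic ψ) (σ : Equiv.Perm (Fin N))
    (F : (Fin N × Fin 3 → ℤ) → ℝ≥0∞) :
    wsum (fun ξ => F fun p => ξ (σ p.1, p.2)) ψ = wsum F ψ := by
  let e : (Fin N × Fin 3 → ℤ) ≃ (Fin N × Fin 3 → ℤ) :=
    (Equiv.prodCongr σ (Equiv.refl (Fin 3))).arrowCongr (Equiv.refl ℤ) |>.symm
  rw [wsum, wsum, ← e.tsum_eq fun ξ => F ξ * ‖fc ψ ξ‖ₑ ^ 2]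
  refine tsum_congr fun ξ => ?_
  have : (e ξ : Fin N × Fin 3 → ℤ) = fun p => ξ (σ p.1, p.2) := rfl
  rw [this, fc_bosonic hψ]

theorem japaneseSymbol_perm (σ : Equiv.Perm (Fin N)) (j : Fin N) (ξ : Fin N × Fin 3 → ℤ) :
    japaneseSymbol L j (fun p => ξ (σ p.1, p.2)) = japaneseSymbol L (σ j) ξ := rfl

theorem prodSymbol_perm (σ : Equiv.Perm (Fin N)) (J : Finset (Fin N)) (ξ : Fin N × Fin 3 → ℤ) :
    prodSymbol L J (fun p => ξ (σ p.1, p.2)) = prodSymbol L (J.image σ) ξ := by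
  rw [prodSymbol, prodSymbol, Finset.prod_image fun x _ y _ h => σ.injective h]
  rfl

theorem exists_perm_image_eq {J K : Finset (Fin N)} (h : J.card = K.card) :
    ∃ σ : Equiv.Perm (Fin N), J.image σ = K := by
  have e : {x // x ∈ J} ≃ {x // x ∈ K} := Finset.equivOfCardEq h
  refine ⟨e.extendSubtype, ?_⟩
  refine Finset.eq_of_subset_of_card_le (fun y hy => ?_) ?_
  · obtain ⟨x, hx, rfl⟩ := Finset.mem_image.1 hy
    exact e.extendSubtype_mem x hx
  · rw [Finset.card_image_of_injective _ (Equiv.injective _), h]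

/-- A permutation taking J to K is corrected by a transposition of two points outside K. -/
theorem exists_perm_image_eq_of_notMem {J K : Finset (Fin N)} (h : J.card = K.card)
    {j i : Fin N} (hj : j ∉ J) (hi : i ∉ K) :
    ∃ σ : Equiv.Perm (Fin N), J.image σ = K ∧ σ j = i := by
  obtain ⟨σ, hσ⟩ := exists_perm_image_eq h
  have hσj : σ j ∉ K := by
    rw [← hσ, Finset.mem_image]
    rintro ⟨x, hx, hxj⟩
    exact hj (σ.injective hxj ▸ hx)
  refine ⟨Equiv.swap (σ j) i * σ, ?_, by simp⟩
  have : J.image ⇑(Equiv.swap (σ j) i * σ) = (J.image σ).image (Equiv.swap (σ j) i) := by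
    rw [Finset.image_image]
    rfl
  rw [this, hσ]
  refine (Finset.image_congr fun x hx => ?_).trans Finset.image_id
  exact Equiv.swap_apply_of_ne_of_ne (fun h => hσj (h ▸ hx)) (fun h => hi (h ▸ hx))

theorem wsum_prodSymbol_bosonic {ψ : L2N N} (hψ : IsBosonic ψ) {J K : Finset (Fin N)}
    (h : J.card = K.card) : wsum (sqw (prodSymbol L J)) ψ = wsum (sqw (prodSymbol L K)) ψ := by
  obtain ⟨σ, hσ⟩ := exists_perm_image_eq h
  rw [← wsum_bosonic hψ σ]
  simp only [sqw, prodSymbol_perm, hσ]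
  rfl

/-- The first `k` particles. -/
def firstParticles (N k : ℕ) : Finset (Fin N) := Finset.univ.filter fun j => j.val < k

theorem card_firstParticles {k : ℕ} (h : k ≤ N) : (firstParticles N k).card = k := by
  rw [firstParticles, Fin.card_filter_val_lt, min_eq_right h]

/-- All sets J of size k contribute equally; k! times their number is the falling factorial. -/
theorem wsum_avgSymbol_bosonic {ψ : L2N N} (hψ : IsBosonic ψ) {k : ℕ} (hk : k ≤ N) :
    wsum (fun ξ => ENNReal.ofReal (avgSymbol L N k ξ)) ψ
      = ENNReal.ofReal (N.descFactorial k / (N : ℝ) ^ k)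
        * wsum (sqw (prodSymbol L (firstParticles N k))) ψ := by
  have h2 := ofReal_avgSymbol_mul (L := L) k (F := fun _ => 1) ψ
  simp only [one_pow, mul_one] at h2
  rw [h2, Finset.sum_congr rfl fun J hJ => wsum_prodSymbol_bosonic hψ
    ((Finset.mem_powersetCard.1 hJ).2.trans (card_firstParticles hk).symm), Finset.sum_const,
    Finset.card_powersetCard, Finset.card_univ, Fintype.card_fin, nsmul_eq_mul, ← mul_assoc,
    ← ENNReal.ofReal_natCast, ← ENNReal.ofReal_mul (by positivity),
    Nat.descFactorial_eq_factorial_mul_choose]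
  congr 2
  push_cast
  ring

/-- Every pair (J, j) with j ∉ J can be permuted so that j becomes the first particle and J the next
k. The normalization has one more power of N than the falling factorial, which produces the
coefficient 1/N in the energy estimate. -/
theorem wsum_diagSymbol_bosonic {ψ : L2N N} (hψ : IsBosonic ψ) {k : ℕ} (hk : k + 1 ≤ N) :
    wsum (fun ξ => ENNReal.ofReal (diagSymbol L N k ξ)) ψ
      = ENNReal.ofReal (N.descFactorial (k + 1) / (N : ℝ) ^ (k + 2))
        * wsum (sqw fun ξ => prodSymbol L (firstParticles N 1) ξ *
            prodSymbol L (firstParticles N (k + 1)) ξ) ψ := by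
  have hN : 0 < N := by omega
  let z : Fin N := ⟨0, hN⟩
  have hz1 : firstParticles N 1 = {z} := by
    ext j
    simp [firstParticles, z, Fin.ext_iff]
  have hzK : insert z ((firstParticles N (k + 1)).erase z) = firstParticles N (k + 1) :=
    Finset.insert_erase (by simp [firstParticles, z])
  have hcard : ((firstParticles N (k + 1)).erase z).card = k := by
    rw [Finset.card_erase_of_mem (by simp [firstParticles, z]), card_firstParticles hk]
    rfl
  have hterm : ∀ J ∈ Finset.powersetCard k (Finset.univ : Finset (Fin N)), ∀ j ∈ Jᶜ,
      wsum (sqw fun ξ => japaneseSymbol L j ξ * prodSymbol L (insert j J) ξ) ψ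
        = wsum (sqw fun ξ => prodSymbol L (firstParticles N 1) ξ *
            prodSymbol L (firstParticles N (k + 1)) ξ) ψ := by
    intro J hJ j hj
    obtain ⟨σ, hσ, hσj⟩ := exists_perm_image_eq_of_notMem
      ((Finset.mem_powersetCard.1 hJ).2.trans hcard.symm) (Finset.mem_compl.1 hj)
      (Finset.notMem_erase z (firstParticles N (k + 1)))
    rw [← wsum_bosonic hψ σ]
    simp only [sqw, prodSymbol_perm, japaneseSymbol_perm, Finset.image_insert, hσ, hσj, hzK, hz1,
      prodSymbol_singleton]
    rfl
  have h1 : wsum (fun ξ => ENNReal.ofReal (diagSymbol L N k ξ)) ψ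
      = ENNReal.ofReal (k.factorial / (N : ℝ) ^ (k + 2)) *
        ∑ J ∈ Finset.powersetCard k (Finset.univ : Finset (Fin N)), ∑ j ∈ Jᶜ,
          wsum (sqw fun ξ => japaneseSymbol L j ξ * prodSymbol L (insert j J) ξ) ψ := by
    simp only [← wsum_finset_sum]
    rw [← wsum_const_mul]
    congr 1
    funext ξ
    simp only [sqw]
    rw [diagSymbol, ENNReal.ofReal_mul (by positivity),
      ENNReal.ofReal_sum_of_nonneg fun J _ => Finset.sum_nonneg fun j _ => sq_nonneg _]
    congr 1
    exact Finset.sum_congr rfl fun J _ => ENNReal.ofReal_sum_of_nonneg fun j _ => sq_nonneg _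
  have h2 : ∀ J ∈ Finset.powersetCard k (Finset.univ : Finset (Fin N)), Jᶜ.card = N - k := by
    intro J hJ
    rw [Finset.card_compl, (Finset.mem_powersetCard.1 hJ).2, Fintype.card_fin]
  rw [h1, Finset.sum_congr rfl fun J hJ => (Finset.sum_congr rfl (hterm J hJ)).trans
    ((Finset.sum_const _).trans (by rw [h2 J hJ])), Finset.sum_const, Finset.card_powersetCard,
    Finset.card_univ, Fintype.card_fin, nsmul_eq_mul, nsmul_eq_mul, ← mul_assoc, ← mul_assoc,
    ← ENNReal.ofReal_natCast, ← ENNReal.ofReal_natCast, ← ENNReal.ofReal_mul (by positivity),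
    ← ENNReal.ofReal_mul (by positivity), Nat.descFactorial_succ,
    Nat.descFactorial_eq_factorial_mul_choose]
  congr 2
  push_cast
  ring

end Symmetry

/-! ### The Hamiltonian as an operator -/

section Pow

variable {E : Type*} [NormedAddCommGroup E] [InnerProductSpace ℂ E]

/-- The graph of the power `A ^ m`. -/
def IsPow (A : E →ₗ.[ℂ] E) (m : ℕ) (ψ χ : E) : Prop :=
  ∃ h : ψ ∈ (opPow A m).domain, opPow A m ⟨ψ, h⟩ = χ

theorem isPow_zero (A : E →ₗ.[ℂ] E) (ψ χ : E) : IsPow A 0 ψ χ ↔ ψ = χ :=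
  ⟨fun ⟨_, h⟩ => h, fun h => ⟨trivial, h⟩⟩

theorem isPow_succ (A : E →ₗ.[ℂ] E) (m : ℕ) (ψ χ : E) :
    IsPow A (m + 1) ψ χ ↔ ∃ φ, IsPow A m ψ φ ∧ ∃ h : φ ∈ A.domain, A ⟨φ, h⟩ = χ := by
  constructor
  · rintro ⟨h, rfl⟩
    have h1 := h
    obtain ⟨⟨y, hy, hyψ⟩, hψ⟩ := h1
    subst hyψ
    exact ⟨opPow A m y, ⟨y.2, rfl⟩, hy, rfl⟩
  · rintro ⟨φ, ⟨h1, rfl⟩, h2, rfl⟩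
    exact ⟨⟨⟨⟨ψ, h1⟩, h2, rfl⟩, h1⟩, rfl⟩

/-- The definition of the power splits off the outermost factor; the energy induction needs the
innermost one. -/
theorem isPow_succ' (A : E →ₗ.[ℂ] E) (m : ℕ) (ψ χ : E) :
    IsPow A (m + 1) ψ χ ↔ ∃ h : ψ ∈ A.domain, IsPow A m (A ⟨ψ, h⟩) χ := by
  induction m generalizing χ with
  | zero =>
    rw [isPow_succ]
    simp only [isPow_zero]
    exact ⟨fun ⟨_, h, h'⟩ => by subst h; exact h', fun h => ⟨ψ, rfl, h⟩⟩
  | succ m ih =>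
    rw [isPow_succ]
    constructor
    · rintro ⟨φ, h1, h2⟩
      obtain ⟨h3, h4⟩ := (ih φ).1 h1
      exact ⟨h3, (isPow_succ A m _ χ).2 ⟨φ, h4, h2⟩⟩
    · rintro ⟨h3, h4⟩
      obtain ⟨φ, h5, h6⟩ := (isPow_succ A m _ χ).1 h4
      exact ⟨φ, (ih φ).2 ⟨h3, h5⟩, h6⟩

theorem powExpectation_ne_top {A : E →ₗ.[ℂ] E} {q : E → ℝ≥0∞} {k : ℕ} {ψ : E}
    (h : powExpectation A q k ψ ≠ ⊤) :
    ∃ χ, IsPow A (k / 2) ψ χ ∧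
      powExpectation A q k ψ = if Even k then ‖χ‖ₑ ^ 2 else q χ := by
  unfold powExpectation at h ⊢
  split_ifs at h ⊢ with h1 h2
  · exact ⟨_, ⟨h1, rfl⟩, rfl⟩
  · exact ⟨_, ⟨h1, rfl⟩, rfl⟩
  all_goals exact absurd rfl h

end Pow

/-! ### The Hamiltonian as the Laplacian plus a bounded multiplication operator. -/

section Hamiltonian

variable {L : ℝ} {V : (Fin 3 → ℝ) × (Fin 3 → ℝ) → ℝ} {β : ℝ}

theorem exists_interactionBounds (hL : 0 < L) (hV : ContDiff ℝ ∞ V) (hs : HasCompactSupport V)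
    (h0 : ∀ z, 0 ≤ V z) (β : ℝ) :
    ∃ C : ℝ, 0 ≤ C ∧ ∀ N : ℕ, 1 ≤ N →
      ∃ U : Fin N × Fin N × Fin N → C(UnitAddTorus (Fin N × Fin 3), ℝ),
        InteractionBounds L N U (interactionCoeff V β L N) C (scale β N) ∧
        ∀ t x, U t x = VN V β L N (particle x t.1 - particle x t.2.1)
          (particle x t.1 - particle x t.2.2) := by
  choose C hC0 hC using exists_sum_interactionCoeff_le hL hV hs β
  -- One constant that serves all of r = 0, 1, 2, 3.
  refine ⟨∑ r ∈ Finset.range 4, C r, Finset.sum_nonneg fun r _ => hC0 r, fun N hN => ?_⟩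
  have hsum : ∀ (t : Fin N × Fin N × Fin N) x,
      HasSum (fun n => interactionCoeff V β L N n * UnitAddTorus.mFourier (shift t n) x)
        (VN V β L N (particle x t.1 - particle x t.2.1) (particle x t.1 - particle x t.2.2) : ℂ) := by
    intro t x
    simp only [mFourier_shift]
    exact hasSum_VN hL hV hs β hN _ _
  have hcont : ∀ t : Fin N × Fin N × Fin N, Continuous fun x : UnitAddTorus (Fin N × Fin 3) =>
      VN V β L N (particle x t.1 - particle x t.2.1) (particle x t.1 - particle x t.2.2) := by
    intro t
    have h1 : Continuous fun x : UnitAddTorus (Fin N × Fin 3) =>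
        ∑' n, interactionCoeff V β L N n * UnitAddTorus.mFourier (shift t n) x := by
      have h2 := summable_interactionCoeff hL hV hs β hN 0
      simp only [pow_zero, mul_one] at h2
      refine continuous_tsum (fun n => by fun_prop) h2 fun n x => ?_
      rw [norm_mul]
      refine mul_le_of_le_one_right (norm_nonneg _) ?_
      exact ((UnitAddTorus.mFourier _).norm_coe_le_norm x).trans_eq UnitAddTorus.mFourier_norm
    refine (Complex.continuous_re.comp h1).congr fun x => ?_
    simp only [Function.comp_apply, (hsum t x).tsum_eq, Complex.ofReal_re]
  refine ⟨fun t => ⟨_, hcont t⟩, ⟨hL, hN, fun t x => ?_, hsum,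
    summable_interactionCoeff hL hV hs β hN, fun r hr => ?_,
    Finset.sum_nonneg fun r _ => hC0 r, one_le_scale β N⟩, fun t x => rfl⟩
  · exact tsum_nonneg fun p => mul_nonneg (by positivity) (h0 _)
  · refine Summable.tsum_le_of_sum_le (summable_interactionCoeff hL hV hs β hN r) fun s => ?_
    refine (hC r N hN s).trans ?_
    have := one_le_scale β N
    gcongr
    exact Finset.single_le_sum (fun r _ => hC0 r) (Finset.mem_range.2 (by omega))

variable {N : ℕ} {U : Fin N × Fin N × Fin N → C(UnitAddTorus (Fin N × Fin 3), ℝ)}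

/-- The total interaction as a continuous function. -/
def totalInteraction (U : Fin N × Fin N × Fin N → C(UnitAddTorus (Fin N × Fin 3), ℝ)) :
    C(UnitAddTorus (Fin N × Fin 3), ℝ) := (1 / (N : ℝ) ^ 2) • ∑ t ∈ triples N, U t

theorem sum_triples (f : Fin N × Fin N × Fin N → ℝ) :
    ∑ t ∈ triples N, f t = ∑ i, ∑ j ∈ Finset.Ioi i, ∑ l ∈ Finset.Ioi j, f (i, j, l) := by
  rw [triples, Finset.sum_filter, Fintype.sum_prod_type]
  refine Finset.sum_congr rfl fun i _ => ?_
  rw [Fintype.sum_prod_type, ← Finset.filter_lt_eq_Ioi, Finset.sum_filter]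
  refine Finset.sum_congr rfl fun j _ => ?_
  rw [← Finset.filter_lt_eq_Ioi, Finset.sum_filter]
  by_cases hij : i < j <;> simp [hij]

theorem interaction_eq (hU : ∀ t x, U t x = VN V β L N (particle x t.1 - particle x t.2.1)
    (particle x t.1 - particle x t.2.2)) : interaction V β L N = totalInteraction U := by
  funext x
  have h1 : totalInteraction U x = 1 / (N : ℝ) ^ 2 * ∑ t ∈ triples N, U t x := by
    simp [totalInteraction]
  rw [h1, sum_triples, interaction]
  simp only [hU]

/-- With s = ∑ |ξ_j|² and T = s/N + 1, one has T² ≤ 2s² + 2 and s² ≤ N² T². -/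
theorem wsum_sqw_sum_laplaceSymbol_iff (hN : 1 ≤ N) (ψ : L2N N) :
    wsum (sqw fun ξ => ∑ j : Fin N, laplaceSymbol L j ξ) ψ ≠ ⊤ ↔ MemSobolev L 2 ψ := by
  have hN0 : (0 : ℝ) < N := by exact_mod_cast hN
  constructor
  · intro h
    have h1 : wsum (sobolevWeight L N 2) ψ
        ≤ ENNReal.ofReal 2 * wsum (sqw fun ξ => ∑ j : Fin N, laplaceSymbol L j ξ) ψ
          + ENNReal.ofReal 2 * wsum (fun _ => 1) ψ := by
      rw [← wsum_const_mul, ← wsum_const_mul, ← wsum_add]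
      refine wsum_mono (fun ξ => ?_) ψ
      rw [sqw, ← ENNReal.ofReal_mul (by norm_num), mul_one, ← ENNReal.ofReal_add (by positivity)
        (by norm_num)]
      refine ENNReal.ofReal_le_ofReal ?_
      rw [meanSymbol_eq L hN]
      set s := ∑ j : Fin N, laplaceSymbol L j ξ
      have hs : 0 ≤ s := Finset.sum_nonneg fun j _ => laplaceSymbol_nonneg L j ξ
      have h2 : (N : ℝ)⁻¹ * s ≤ s :=
        mul_le_of_le_one_left hs (inv_le_one_of_one_le₀ (by exact_mod_cast hN))
      have h3 : 0 ≤ (N : ℝ)⁻¹ * s := by positivity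
      nlinarith [sq_nonneg (s - 1)]
    refine ne_top_of_le_ne_top (ENNReal.add_ne_top.2 ⟨ENNReal.mul_ne_top ENNReal.ofReal_ne_top h,
      ENNReal.mul_ne_top ENNReal.ofReal_ne_top ?_⟩) h1
    rw [wsum_one]
    exact ENNReal.pow_ne_top enorm_ne_top
  · intro h
    refine h.of_le (c := N ^ 2) fun ξ => ENNReal.ofReal_le_ofReal ?_
    rw [← mul_pow, meanSymbol_eq L hN, mul_add, mul_inv_cancel_left₀ hN0.ne']
    have hs : 0 ≤ ∑ j : Fin N, laplaceSymbol L j ξ :=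
      Finset.sum_nonneg fun j _ => laplaceSymbol_nonneg L j ξ
    gcongr
    linarith

theorem mem_domain_hamiltonian (hN : 1 ≤ N) (hU : interaction V β L N = totalInteraction U)
    (ψ : L2N N) : ψ ∈ (hamiltonian V β L N).domain ↔ MemSobolev L 2 ψ := by
  rw [← wsum_sqw_sum_laplaceSymbol_iff hN, ← mem_domain_fourierMultiplier, hamiltonian,
    LinearPMap.add_domain, hU]
  exact ⟨fun h => h.1, fun h => ⟨h, mem_domain_multiplication _ ψ⟩⟩

theorem hamiltonian_apply (hU : interaction V β L N = totalInteraction U)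
    (ψ : (hamiltonian V β L N).domain) :
    hamiltonian V β L N ψ = fm (fun ξ => ∑ j : Fin N, laplaceSymbol L j ξ) (ψ : L2N N)
      + mulOp (totalInteraction U) ψ := by
  obtain ⟨ψ, h⟩ := ψ
  have h1 : ψ ∈ (fourierMultiplier fun ξ => ∑ j : Fin N, laplaceSymbol L j ξ).domain := h.1
  rw [fm, dif_pos h1]
  have h2 := LinearPMap.add_apply (fourierMultiplier fun ξ => ∑ j : Fin N, laplaceSymbol L j ξ)
    (multiplication (interaction V β L N)) ⟨ψ, h⟩
  refine h2.trans ?_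
  congr 1
  have h3 : ∀ (W : UnitAddTorus (Fin N × Fin 3) → ℝ) (_ : W = totalInteraction U)
      (χ : (multiplication W).domain), multiplication W χ = mulOp (totalInteraction U) (χ : L2N N) := by
    rintro W rfl χ
    rfl
  exact h3 _ hU _

theorem mem_domain_shiftedHamiltonian (hN : 1 ≤ N)
    (hU : interaction V β L N = totalInteraction U) (ψ : L2N N) :
    ψ ∈ (shiftedHamiltonian V β L N).domain ↔ MemSobolev L 2 ψ := by
  rw [← mem_domain_hamiltonian hN hU, shiftedHamiltonian, LinearPMap.add_domain]
  exact ⟨fun h => h.1, fun h => ⟨h, trivial⟩⟩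

theorem shiftedHamiltonian_apply_eq (ψ : (shiftedHamiltonian V β L N).domain)
    (h : (ψ : L2N N) ∈ (hamiltonian V β L N).domain) :
    shiftedHamiltonian V β L N ψ = (N : ℂ)⁻¹ • hamiltonian V β L N ⟨ψ, h⟩ + (ψ : L2N N) := rfl

theorem shiftedHamiltonian_apply (hN : 1 ≤ N) (hU : interaction V β L N = totalInteraction U)
    (ψ : (shiftedHamiltonian V β L N).domain) :
    shiftedHamiltonian V β L N ψ = shiftedOp L U (ψ : L2N N) := by
  have h1 := (mem_domain_shiftedHamiltonian hN hU _).1 ψ.2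
  have h2 := (mem_domain_hamiltonian hN hU _).2 h1
  have hN0 : (N : ℂ) ≠ 0 := by exact_mod_cast (by omega : N ≠ 0)
  rw [shiftedHamiltonian_apply_eq ψ h2, hamiltonian_apply hU, shiftedOp, totalInteraction,
    mulOp_smul, mulOp_sum]
  refine fc_ext fun ξ => ?_
  simp only [fc_add, fc_smul]
  rw [fc_fm ((wsum_sqw_sum_laplaceSymbol_iff hN _).2 h1), fc_fm (w := meanSymbol L N) h1,
    meanSymbol_eq L hN]
  push_cast
  field_simp
  ring

end Hamiltonian

/-! ### The energy estimate without symmetry -/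

section Energy

variable {L : ℝ} {N : ℕ} {U : Fin N × Fin N × Fin N → C(UnitAddTorus (Fin N × Fin 3), ℝ)}
  {a : Mode → ℂ} {C R : ℝ}

theorem memSobolev_fm_meanSymbol_iff {s : ℕ} {ψ : L2N N} (hψ : MemSobolev L 2 ψ) :
    MemSobolev L s (fm (meanSymbol L N) ψ) ↔ MemSobolev L (s + 2) ψ := by
  have h : (fun ξ => sobolevWeight L N s ξ * sqw (meanSymbol L N) ξ)
      = sobolevWeight L N (s + 2) := by
    funext ξ
    have := meanSymbol_nonneg L N ξ
    rw [sobolevWeight, sqw, ← ENNReal.ofReal_mul (by positivity), ← pow_add, sobolevWeight]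
  rw [MemSobolev, wsum_fm (w := meanSymbol L N) hψ, h, MemSobolev]

/-- Elliptic regularity. -/
theorem InteractionBounds.memSobolev_of_shiftedOp (h : InteractionBounds L N U a C R) {s : ℕ}
    {ψ : L2N N} (hψ : MemSobolev L 2 ψ) (hs : MemSobolev L s (shiftedOp L U ψ)) :
    MemSobolev L (s + 2) ψ := by
  -- Bootstrap: T ψ = A ψ - W ψ, and W preserves every Sobolev space.
  have step : ∀ r ≤ s, MemSobolev L r ψ → MemSobolev L (r + 2) ψ := by
    intro r hr hrψ
    rw [← memSobolev_fm_meanSymbol_iff hψ]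
    have h1 : fm (meanSymbol L N) ψ = shiftedOp L U ψ
        + (-((N : ℂ) ^ 3)⁻¹) • ∑ t ∈ triples N, mulOp (U t) ψ := by
      rw [shiftedOp, neg_smul, add_neg_cancel_right]
    rw [h1]
    exact (hs.mono h.one_le_N hr).add
      ((MemSobolev.sum _ fun t _ => h.memSobolev_mulOp hrψ t).smul _)
  have all : ∀ r ≤ s, MemSobolev L r ψ := by
    intro r
    induction r with
    | zero => exact fun _ => memSobolev_zero ψ
    | succ r ih => exact fun hr => (step r (by omega) (ih (by omega))).mono h.one_le_N (by omega)
  exact step s le_rfl (all s le_rfl)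

theorem energyError_mono {C ρ k k' : ℝ} (hC : 0 ≤ C) (hρ : 0 ≤ ρ) (hk : 0 ≤ k) (hkk : k ≤ k') :
    energyError C ρ k ≤ energyError C ρ k' := by
  have hk' : 0 ≤ k' := hk.trans hkk
  unfold energyError
  gcongr

/-- The average `∑ ‖∏ S_{j_i} ψ‖²` over the tuples of `k` distinct particles. -/
def avgNorm (L : ℝ) {N : ℕ} (k : ℕ) (ψ : L2N N) : ℝ≥0∞ :=
  wsum (fun ξ => ENNReal.ofReal (avgSymbol L N k ξ)) ψ

/-- The energy estimate for a power of an operator `A` which agrees with `N⁻¹ H_N + 1`. -/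
theorem InteractionBounds.avgNorm_le_of_isPow (h : InteractionBounds L N U a C R)
    {A : L2N N →ₗ.[ℂ] L2N N} (hdom : ∀ ψ, ψ ∈ A.domain ↔ MemSobolev L 2 ψ)
    (hA : ∀ ψ : A.domain, A ψ = shiftedOp L U (ψ : L2N N)) {c : ℝ} (hc : 0 ≤ c) {k₀ K : ℕ}
    (hρ : energyError C (R ^ 7 / N) K ≤ 1 - c) {Q : ℝ≥0∞} {χ : L2N N}
    (hχ : MemSobolev L k₀ χ) (hQ : ENNReal.ofReal (c ^ k₀) * avgNorm L k₀ χ ≤ Q) (m : ℕ)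
    (hK : 2 * m + k₀ ≤ K) {ψ : L2N N} (hψ : IsPow A m ψ χ) :
    MemSobolev L (2 * m + k₀) ψ ∧
      ENNReal.ofReal (c ^ (2 * m + k₀)) * avgNorm L (2 * m + k₀) ψ ≤ Q := by
  induction m generalizing ψ with
  | zero =>
    rw [isPow_zero] at hψ
    subst hψ
    simpa using ⟨hχ, hQ⟩
  | succ m ih =>
    -- The induction hypothesis applies to A ψ. The basic step then exchanges the average norm of A
    -- ψ for that of ψ with two more derivatives and a factor c².
    obtain ⟨h1, h2⟩ := (isPow_succ' A m ψ χ).1 hψ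
    rw [hA] at h2
    obtain ⟨h3, h4⟩ := ih (by omega) h2
    have h5 := h.memSobolev_of_shiftedOp ((hdom ψ).1 h1) h3
    have e : 2 * (m + 1) + k₀ = 2 * m + k₀ + 2 := by ring
    rw [e]
    refine ⟨h5, le_trans ?_ h4⟩
    have hρ' : energyError C (R ^ 7 / N) (2 * m + k₀ : ℕ) ≤ 1 - c := by
      refine (energyError_mono h.C_nonneg ?_ (by positivity) ?_).trans hρ
      · have := h.one_le_R
        positivity
      · exact_mod_cast (by omega : 2 * m + k₀ ≤ K)
    have h6 := h.wsum_avgSymbol_shiftedOp_ge h5 hc hρ'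
    rw [pow_add, ENNReal.ofReal_mul (by positivity), mul_assoc]
    gcongr
    refine le_trans ?_ h6
    gcongr
    -- The diagonal remainder is dropped here; only the innermost factor of A will need it.
    exact le_self_add

end Energy

/-! ### The energy estimate for bosonic functions -/

section Asymptotics

/-- The size of β matters only here, through N^{7β - 1} → 0; for this 7β < 1 suffices. The term 1/N
covers the case N^β ≤ 1. -/
theorem tendsto_scale_pow_div {β : ℝ} (hβ : β < 1 / 8) :
    Tendsto (fun N : ℕ => scale β N ^ 7 / N) atTop (𝓝 0) := by
  have h1 : Tendsto (fun N : ℕ => (1 : ℝ) / N + (N : ℝ) ^ (-(1 - 7 * β))) atTop (𝓝 (0 + 0)) :=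
    (tendsto_const_div_atTop_nhds_zero_nat 1).add
      ((tendsto_rpow_neg_atTop (by linarith)).comp tendsto_natCast_atTop_atTop)
  rw [add_zero] at h1
  refine squeeze_zero' (Eventually.of_forall fun N => ?_) ?_ h1
  · have := one_le_scale β N
    positivity
  · filter_upwards [eventually_ge_atTop 1] with N hN
    have hN0 : (0 : ℝ) < N := by exact_mod_cast hN
    have hb : 0 < (N : ℝ) ^ β := Real.rpow_pos_of_pos hN0 β
    have h2 : (N : ℝ) ^ (-(1 - 7 * β)) = ((N : ℝ) ^ β) ^ 7 / N := by
      rw [show -(1 - 7 * β) = β * (7 : ℕ) - 1 by push_cast; ring, Real.rpow_sub hN0,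
        Real.rpow_mul hN0.le, Real.rpow_natCast, Real.rpow_one]
    rw [h2, ← add_div]
    gcongr
    rw [scale]
    rcases max_cases (1 : ℝ) ((N : ℝ) ^ β) with ⟨h, -⟩ | ⟨h, -⟩ <;> rw [h]
    · rw [one_pow]
      have : 0 < ((N : ℝ) ^ β) ^ 7 := by positivity
      linarith
    · linarith

theorem tendsto_energyError {β : ℝ} (hβ : β < 1 / 8) (C k : ℝ) :
    Tendsto (fun N : ℕ => energyError C (scale β N ^ 7 / N) k) atTop (𝓝 0) := by
  have h1 : Continuous fun ρ => energyError C ρ k := by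
    unfold energyError
    fun_prop
  have h2 := (h1.tendsto 0).comp (tendsto_scale_pow_div hβ)
  have h3 : energyError C 0 k = 0 := by simp [energyError]
  rwa [h3] at h2

theorem tendsto_descFactorial_div (j : ℕ) :
    Tendsto (fun N : ℕ => (N.descFactorial j / (N : ℝ) ^ j : ℝ)) atTop (𝓝 1) := by
  induction j with
  | zero => simp
  | succ j ih =>
    have h1 : Tendsto (fun N : ℕ => (1 : ℝ) - j / N) atTop (𝓝 (1 - 0)) :=
      tendsto_const_nhds.sub (tendsto_const_div_atTop_nhds_zero_nat (j : ℝ))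
    have h2 := h1.mul ih
    rw [sub_zero, one_mul] at h2
    refine h2.congr' ?_
    filter_upwards [eventually_ge_atTop (j + 1)] with N hN
    have hN0 : (N : ℝ) ≠ 0 := by
      have : N ≠ 0 := by omega
      exact_mod_cast this
    rw [Nat.descFactorial_succ, Nat.cast_mul, Nat.cast_sub (by omega), pow_succ]
    field_simp

end Asymptotics

/-! ### The energy estimate and its thresholds. -/

section Estimate

variable {L : ℝ} {V : (Fin 3 → ℝ) × (Fin 3 → ℝ) → ℝ} {β : ℝ}

/-- The average norm of order one is the kinetic part of the form; the interaction is nonnegative.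
This starts the induction for odd powers. -/
theorem avgNorm_one_le_shiftedEnergyForm {N : ℕ} (hN : 1 ≤ N) (ψ : L2N N) :
    avgNorm L 1 ψ ≤ shiftedEnergyForm V β L N ψ := by
  have hN0 : (0 : ℝ) < N := by exact_mod_cast hN
  have h1 : ∀ j : Fin N, opNormSq (fourierMultiplier fun ξ => Real.sqrt (laplaceSymbol L j ξ)) ψ
      = wsum (fun ξ => ENNReal.ofReal (laplaceSymbol L j ξ)) ψ := by
    intro j
    rw [opNormSq_fourierMultiplier]
    congr 1
    funext ξ
    rw [sqw, Real.sq_sqrt (laplaceSymbol_nonneg L j ξ)]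
  have h2 : avgNorm L 1 ψ = (N : ℝ≥0∞)⁻¹ *
      (∑ j : Fin N, opNormSq (fourierMultiplier fun ξ => Real.sqrt (laplaceSymbol L j ξ)) ψ)
        + ‖ψ‖ₑ ^ 2 := by
    simp only [h1]
    rw [← wsum_finset_sum, ← wsum_const_mul, ← wsum_one, ← wsum_add, avgNorm]
    congr 1
    funext ξ
    rw [avgSymbol_one, meanSymbol_eq L hN, ENNReal.ofReal_add ?_ zero_le_one, ENNReal.ofReal_one,
      ENNReal.ofReal_mul (by positivity), ENNReal.ofReal_inv_of_pos hN0, ENNReal.ofReal_natCast,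
      ENNReal.ofReal_sum_of_nonneg fun j _ => laplaceSymbol_nonneg L j ξ]
    have := Finset.sum_nonneg fun (j : Fin N) (_ : j ∈ Finset.univ) => laplaceSymbol_nonneg L j ξ
    positivity
  rw [h2, shiftedEnergyForm, energyForm]
  gcongr
  exact le_self_add

theorem avgNorm_zero {N : ℕ} (ψ : L2N N) : avgNorm L 0 ψ = ‖ψ‖ₑ ^ 2 := by
  simp only [avgNorm, avgSymbol_zero, ENNReal.ofReal_one, wsum_one]

theorem memSobolev_one_iff {N : ℕ} (ψ : L2N N) : MemSobolev L 1 ψ ↔ avgNorm L 1 ψ ≠ ⊤ := by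
  simp only [MemSobolev, avgNorm, avgSymbol_one]
  unfold sobolevWeight
  simp only [pow_one]

/-- The energy estimate for `(N⁻¹ H_N + 1) ^ k` without symmetry. -/
theorem InteractionBounds.avgNorm_le_powExpectation {N : ℕ}
    {U : Fin N × Fin N × Fin N → C(UnitAddTorus (Fin N × Fin 3), ℝ)} {a : Mode → ℂ} {C R : ℝ}
    (h : InteractionBounds L N U a C R) (hU : interaction V β L N = totalInteraction U) {c : ℝ}
    (hc : 0 ≤ c) (hc1 : c ≤ 1) {k : ℕ} (hρ : energyError C (R ^ 7 / N) k ≤ 1 - c) {ψ : L2N N}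
    (hψ : powExpectation (shiftedHamiltonian V β L N) (shiftedEnergyForm V β L N) k ψ ≠ ⊤) :
    MemSobolev L k ψ ∧ ENNReal.ofReal (c ^ k) * avgNorm L k ψ ≤
      powExpectation (shiftedHamiltonian V β L N) (shiftedEnergyForm V β L N) k ψ := by
  obtain ⟨χ, h1, h2⟩ := powExpectation_ne_top hψ
  rw [h2] at hψ ⊢
  have hdom := mem_domain_shiftedHamiltonian (L := L) h.one_le_N hU
  have hA := shiftedHamiltonian_apply (L := L) h.one_le_N hU
  -- Even powers start the induction from ‖χ‖², odd powers from the quadratic form of χ.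
  by_cases hk : Even k
  · simp only [if_pos hk]
    have e : 2 * (k / 2) + 0 = k := by
      have := Nat.even_iff.1 hk
      omega
    have h3 := h.avgNorm_le_of_isPow hdom hA hc (k₀ := 0) (K := k) hρ (Q := ‖χ‖ₑ ^ 2)
      (memSobolev_zero χ) (by rw [avgNorm_zero]; simp) (k / 2) e.le h1
    rwa [e] at h3
  · simp only [if_neg hk] at hψ ⊢
    have e : 2 * (k / 2) + 1 = k := by
      have := Nat.odd_iff.1 (Nat.not_even_iff_odd.1 hk)
      omega
    have h4 := avgNorm_one_le_shiftedEnergyForm (L := L) (V := V) (β := β) h.one_le_N χ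
    have h3 := h.avgNorm_le_of_isPow hdom hA hc (k₀ := 1) (K := k) hρ
      (Q := shiftedEnergyForm V β L N χ)
      ((memSobolev_one_iff χ).2 (ne_top_of_le_ne_top hψ h4)) (le_trans (by
        rw [pow_one]
        exact mul_le_of_le_one_left zero_le (by simpa using hc1)) h4) (k / 2) e.le h1
    rwa [e] at h3

theorem S_opNormSq {N k : ℕ} (ψ : L2N N) :
    opNormSq (S L N k) ψ = wsum (sqw (prodSymbol L (firstParticles N k))) ψ :=
  opNormSq_fourierMultiplier _ ψ

theorem S₁S_opNormSq {N k : ℕ} (ψ : L2N N) :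
    opNormSq (S₁S L N k) ψ = wsum (sqw fun ξ => prodSymbol L (firstParticles N 1) ξ *
      prodSymbol L (firstParticles N k) ξ) ψ :=
  opNormSq_fourierMultiplier _ ψ

/-- The energy estimate for bosonic functions, for fixed `c`, `k` and `N` large. -/
theorem InteractionBounds.bosonic_energy_estimate {N : ℕ}
    {U : Fin N × Fin N × Fin N → C(UnitAddTorus (Fin N × Fin 3), ℝ)} {a : Mode → ℂ} {C R : ℝ}
    (h : InteractionBounds L N U a C R) (hU : interaction V β L N = totalInteraction U) {c c' : ℝ}
    (hc : 0 ≤ c) (hc' : 0 ≤ c') (hc1 : c' ≤ 1) {k : ℕ} (hk : 1 ≤ k) (hkN : k ≤ N)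
    (hρ : energyError C (R ^ 7 / N) k ≤ 1 - c')
    (hN1 : c * (1 + (N : ℝ)⁻¹) ≤ 1)
    (hd : ∀ j ≤ k, c ^ k ≤ c' ^ k * (N.descFactorial j / (N : ℝ) ^ j))
    {ψ : L2N N} (hψ : IsBosonic ψ) :
    ENNReal.ofReal (c ^ k) *
        (opNormSq (S L N k) ψ + (N : ℝ≥0∞)⁻¹ * opNormSq (S₁S L N (k - 1)) ψ) ≤
      powExpectation (shiftedHamiltonian V β L N) (shiftedEnergyForm V β L N) k ψ := by
  have hN := h.one_le_N
  have hN0 : (0 : ℝ) < N := by exact_mod_cast hN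
  rw [S_opNormSq, S₁S_opNormSq]
  by_cases htop : powExpectation (shiftedHamiltonian V β L N) (shiftedEnergyForm V β L N) k ψ = ⊤
  · rw [htop]
    exact le_top
  have hNinv : (N : ℝ≥0∞)⁻¹ = ENNReal.ofReal (N : ℝ)⁻¹ := by
    rw [ENNReal.ofReal_inv_of_pos hN0, ENNReal.ofReal_natCast]
  obtain ⟨χ, h1, h2⟩ := powExpectation_ne_top htop
  -- For k = 1 the two terms on the left are the same quantity with coefficients 1 and 1/N, whence
  -- the hypothesis `hN1`. No factor of A can be split off in this case.
  rcases Nat.lt_or_ge k 2 with hk2 | hk2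
  · have hk1 : k = 1 := by omega
    subst hk1
    have h3 : ψ = χ := (isPow_zero _ ψ χ).1 h1
    subst h3
    rw [h2, if_neg (by decide)]
    refine le_trans ?_ (avgNorm_one_le_shiftedEnergyForm (L := L) hN ψ)
    have h0 : ∀ ξ, prodSymbol L (firstParticles N 0) ξ = 1 := fun ξ => by
      simp [prodSymbol, firstParticles]
    rw [avgNorm, wsum_avgSymbol_bosonic hψ hN]
    simp only [Nat.sub_self, h0, mul_one, Nat.descFactorial_one, pow_one]
    rw [div_self hN0.ne', ENNReal.ofReal_one, one_mul]
    set X := wsum (sqw (prodSymbol L (firstParticles N 1))) ψ with hX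
    show ENNReal.ofReal c * (X + (N : ℝ≥0∞)⁻¹ * X) ≤ X
    calc _ = ENNReal.ofReal (c * (1 + (N : ℝ)⁻¹)) * X := by
          rw [hNinv, ENNReal.ofReal_mul hc, ENNReal.ofReal_add zero_le_one (by positivity),
            ENNReal.ofReal_one]
          ring
      _ ≤ 1 * X := by
          gcongr
          simpa using hN1
      _ = X := one_mul X
  · obtain ⟨k, rfl⟩ : ∃ k', k = k' + 2 := ⟨k - 2, by omega⟩
    have hdiv : (k + 2) / 2 = k / 2 + 1 := by omega
    rw [hdiv] at h1
    obtain ⟨h3, h4⟩ := (isPow_succ' _ _ ψ χ).1 h1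
    have hA := shiftedHamiltonian_apply (L := L) hN hU ⟨ψ, h3⟩
    rw [hA] at h4
    have hR : 0 ≤ R ^ 7 / N := by
      have := h.one_le_R
      positivity
    have hρ' : energyError C (R ^ 7 / N) k ≤ 1 - c' :=
      (energyError_mono h.C_nonneg hR (by positivity) (by push_cast; linarith)).trans hρ
    -- ⟨ψ, A^{k+2} ψ⟩ = ⟨A ψ, A^k A ψ⟩: the estimate without symmetry handles A^k, and the last step
    -- to ψ keeps the diagonal term.
    have h5 : powExpectation (shiftedHamiltonian V β L N) (shiftedEnergyForm V β L N) k
        (shiftedOp L U ψ)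
        = powExpectation (shiftedHamiltonian V β L N) (shiftedEnergyForm V β L N) (k + 2) ψ := by
      rw [h2]
      obtain ⟨h6, h7⟩ := h4
      rw [powExpectation, dif_pos h6, h7]
      simp only [Nat.even_add, even_two, iff_true]
    rw [← h5] at htop ⊢
    obtain ⟨h6, h7⟩ := h.avgNorm_le_powExpectation hU hc' hc1 hρ' htop
    have h8 := h.memSobolev_of_shiftedOp ((mem_domain_shiftedHamiltonian hN hU ψ).1 h3) h6
    have h9 := h.wsum_avgSymbol_shiftedOp_ge h8 hc' hρ'
    rw [wsum_avgSymbol_bosonic hψ hkN, wsum_diagSymbol_bosonic hψ (by omega)] at h9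
    refine le_trans ?_ h7
    refine le_trans ?_ (mul_le_mul_right h9 _)
    rw [← mul_assoc, ← ENNReal.ofReal_mul (by positivity), ← pow_add, mul_add, mul_add]
    rw [← mul_assoc, ← mul_assoc, ← mul_assoc, hNinv, ← ENNReal.ofReal_mul (by positivity),
      ← ENNReal.ofReal_mul (by positivity), ← ENNReal.ofReal_mul (by positivity)]
    have e1 := hd (k + 2) le_rfl
    have e2 := hd (k + 1) (by omega)
    refine add_le_add ?_ ?_
    · gcongr
    · show ENNReal.ofReal (c ^ (k + 2) * (N : ℝ)⁻¹) * _ ≤ _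
      refine mul_le_mul' (ENNReal.ofReal_le_ofReal ?_) le_rfl
      calc c ^ (k + 2) * (N : ℝ)⁻¹
          ≤ c' ^ (k + 2) * (N.descFactorial (k + 1) / (N : ℝ) ^ (k + 1)) * (N : ℝ)⁻¹ := by gcongr
        _ = c' ^ (k + 2) * (N.descFactorial (k + 1) / (N : ℝ) ^ (k + 2)) := by
            rw [pow_succ (N : ℝ) (k + 1), ← div_div, div_eq_mul_inv _ (N : ℝ), mul_assoc]

/-- For large `N`, the hypotheses of the energy estimates hold. -/
theorem exists_energy_setup (hL : 0 < L) (hV : ContDiff ℝ ∞ V) (hs : HasCompactSupport V)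
    (h0 : ∀ z, 0 ≤ V z) (hβ : β < 1 / 8) :
    ∃ C : ℝ, ∀ c < (1 : ℝ), ∀ k : ℕ, ∃ M : ℕ, ∀ N : ℕ, M < N → k ≤ N ∧
      energyError C (scale β N ^ 7 / N) k ≤ 1 - c ∧
      ∃ U : Fin N × Fin N × Fin N → C(UnitAddTorus (Fin N × Fin 3), ℝ),
        InteractionBounds L N U (interactionCoeff V β L N) C (scale β N) ∧
        interaction V β L N = totalInteraction U := by
  obtain ⟨C, hC0, hC⟩ := exists_interactionBounds hL hV hs h0 β
  refine ⟨C, fun c hc k => ?_⟩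
  have h1 := (tendsto_energyError hβ C k).eventually (eventually_le_nhds (by linarith : 0 < 1 - c))
  obtain ⟨M, hM⟩ := eventually_atTop.1 h1
  refine ⟨max M k, fun N hN => ?_⟩
  rw [max_lt_iff] at hN
  obtain ⟨U, hU1, hU2⟩ := hC N (by omega)
  exact ⟨hN.2.le, hM N hN.1.le, U, hU1, interaction_eq hU2⟩

theorem exists_threshold (hL : 0 < L) (hV : ContDiff ℝ ∞ V) (hs : HasCompactSupport V)
    (h0 : ∀ z, 0 ≤ V z) (hβ : β < 1 / 8) {c : ℝ} (hc : 0 ≤ c) (hc1 : c < 1) {k : ℕ} (hk : 1 ≤ k) :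
    ∃ M : ℕ, ∀ N : ℕ, M < N → ∀ ψ : L2N N, IsBosonic ψ →
      ENNReal.ofReal (c ^ k) *
          (opNormSq (S L N k) ψ + (N : ℝ≥0∞)⁻¹ * opNormSq (S₁S L N (k - 1)) ψ) ≤
        powExpectation (shiftedHamiltonian V β L N) (shiftedEnergyForm V β L N) k ψ := by
  obtain ⟨C, hC⟩ := exists_energy_setup hL hV hs h0 hβ
  -- The gap between c^k and c'^k absorbs the ratios of falling factorials, which tend to 1.
  set c' := (1 + c) / 2 with hc'
  obtain ⟨M, hM⟩ := hC c' (by linarith) k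
  have hcc' : c ^ k < c' ^ k := pow_lt_pow_left₀ (by linarith) hc (by omega)
  have e1 : ∀ᶠ N : ℕ in atTop, ∀ j ∈ Finset.range (k + 1),
      c ^ k ≤ c' ^ k * (N.descFactorial j / (N : ℝ) ^ j) := by
    rw [Finset.eventually_all]
    intro j _
    have h1 := (tendsto_descFactorial_div j).const_mul (c' ^ k)
    rw [mul_one] at h1
    exact h1.eventually (eventually_ge_nhds hcc')
  have e2 : ∀ᶠ N : ℕ in atTop, c * (1 + (N : ℝ)⁻¹) ≤ 1 := by
    have h1 : Tendsto (fun N : ℕ => c * (1 + (N : ℝ)⁻¹)) atTop (𝓝 (c * (1 + 0))) :=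
      (tendsto_const_nhds.add tendsto_inv_atTop_nhds_zero_nat).const_mul c
    rw [add_zero, mul_one] at h1
    exact h1.eventually (eventually_le_nhds hc1)
  obtain ⟨M', hM'⟩ := eventually_atTop.1 (e1.and e2)
  refine ⟨max M M', fun N hN ψ hψ => ?_⟩
  rw [max_lt_iff] at hN
  obtain ⟨hkN, hρ, U, hU1, hU2⟩ := hM N hN.1
  obtain ⟨h1, h2⟩ := hM' N hN.2.le
  exact hU1.bosonic_energy_estimate hU2 hc (by linarith) (by linarith) hk hkN hρ h2
    (fun j hj => h1 j (Finset.mem_range.2 (by omega))) hψ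

/-- The energy estimate with a threshold which diverges as `c₁ → 1`. -/
theorem exists_threshold_function (hL : 0 < L) (hV : ContDiff ℝ ∞ V) (hs : HasCompactSupport V)
    (h0 : ∀ z, 0 ≤ V z) (hβ : β < 1 / 8) :
    ∃ N₀ : ℝ → ℕ → ℕ,
      (∀ k : ℕ, 1 ≤ k → Tendsto (fun c₁ : ℝ => N₀ c₁ k) (𝓝[<] 1) atTop) ∧
      ∀ c₁ : ℝ, 0 ≤ c₁ → c₁ < 1 → ∀ k : ℕ, 1 ≤ k → ∀ N : ℕ, N₀ c₁ k < N →
        ∀ ψ : L2N N, IsBosonic ψ →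
          ENNReal.ofReal (c₁ ^ k) *
              (opNormSq (S L N k) ψ + (N : ℝ≥0∞)⁻¹ * opNormSq (S₁S L N (k - 1)) ψ) ≤
            powExpectation (shiftedHamiltonian V β L N) (shiftedEnergyForm V β L N) k ψ := by
  have h1 : ∀ (c : ℝ) (k : ℕ), ∃ M : ℕ, 0 ≤ c → c < 1 → 1 ≤ k →
      ∀ N : ℕ, M < N → ∀ ψ : L2N N, IsBosonic ψ →
      ENNReal.ofReal (c ^ k) *
          (opNormSq (S L N k) ψ + (N : ℝ≥0∞)⁻¹ * opNormSq (S₁S L N (k - 1)) ψ) ≤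
        powExpectation (shiftedHamiltonian V β L N) (shiftedEnergyForm V β L N) k ψ := by
    intro c k
    by_cases h : 0 ≤ c ∧ c < 1 ∧ 1 ≤ k
    · obtain ⟨M, hM⟩ := exists_threshold hL hV hs h0 hβ h.1 h.2.1 h.2.2
      exact ⟨M, fun _ _ _ => hM⟩
    · exact ⟨0, fun a b d => absurd ⟨a, b, d⟩ h⟩
  choose M hM using h1
  -- Any larger threshold remains valid, so divergence as c → 1 can simply be imposed.
  refine ⟨fun c k => max (M c k) ⌈(1 - c)⁻¹⌉₊, fun k _ => ?_, fun c hc hc1 k hk N hN =>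
    hM c k hc hc1 hk N ((le_max_left _ _).trans_lt hN)⟩
  refine tendsto_atTop_mono (fun c => le_max_right _ _) ?_
  refine tendsto_nat_ceil_atTop.comp (tendsto_inv_nhdsGT_zero.comp ?_)
  refine tendsto_nhdsWithin_iff.2 ⟨?_, ?_⟩
  · have : Tendsto (fun c : ℝ => 1 - c) (𝓝 1) (𝓝 (1 - 1)) := tendsto_const_nhds.sub tendsto_id
    rw [sub_self] at this
    exact this.mono_left nhdsWithin_le_nhds
  · filter_upwards [self_mem_nhdsWithin] with c hc
    exact sub_pos.2 (mem_Iio.1 hc)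

end Estimate

/-! ### Resolvents of nonnegative symmetric operators and conservation laws -/

section Resolvent

variable {E : Type*} [NormedAddCommGroup E] [InnerProductSpace ℂ E]

/-- A nonnegative symmetric linear relation. -/
structure IsNonnegSymm (G : Submodule ℂ (E × E)) : Prop where
  symm : ∀ p ∈ G, ∀ q ∈ G, ⟪p.2, q.1⟫_ℂ = ⟪p.1, q.2⟫_ℂ
  nonneg : ∀ p ∈ G, 0 ≤ (⟪p.1, p.2⟫_ℂ).re

/-- `R = (1 + A / n)⁻¹` for the operator `A` with graph `G`. -/
def IsResolvent (G : Submodule ℂ (E × E)) (n : ℝ) (R : E →L[ℂ] E) : Prop :=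
  ∀ φ, (R φ, (n : ℂ) • (φ - R φ)) ∈ G

/-- The bounded operator `A (1 + A / n)⁻¹ = n (1 - R)`. -/
def yosida (n : ℝ) (R : E →L[ℂ] E) : E →L[ℂ] E := (n : ℂ) • (1 - R)

theorem yosida_apply (n : ℝ) (R : E →L[ℂ] E) (φ : E) : yosida n R φ = (n : ℂ) • (φ - R φ) := rfl

variable {G : Submodule ℂ (E × E)} {n : ℝ} {R : E →L[ℂ] E}

/-- Expanding the square, the cross term is nonnegative. This gives both uniqueness for 1 + A/n and
contractivity of its inverse. -/
theorem IsNonnegSymm.norm_le (hG : IsNonnegSymm G) (hn : 0 < n) {p : E × E} (hp : p ∈ G) :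
    ‖p.1‖ ≤ ‖p.1 + (n : ℂ)⁻¹ • p.2‖ := by
  refine le_of_sq_le_sq ?_ (norm_nonneg _)
  rw [norm_add_sq (𝕜 := ℂ), inner_smul_right, ← Complex.ofReal_inv, RCLike.re_eq_complex_re,
    Complex.re_ofReal_mul]
  have := hG.nonneg p hp
  have : 0 ≤ n⁻¹ * (⟪p.1, p.2⟫_ℂ).re := by positivity
  nlinarith [sq_nonneg ‖((n⁻¹ : ℝ) : ℂ) • p.2‖]

theorem IsResolvent.apply_add (hR : IsResolvent G n R) (hG : IsNonnegSymm G) (hn : 0 < n)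
    {p : E × E} (hp : p ∈ G) : R (p.1 + (n : ℂ)⁻¹ • p.2) = p.1 := by
  have hn' : (n : ℂ) ≠ 0 := by exact_mod_cast hn.ne'
  have h1 := G.sub_mem (hR (p.1 + (n : ℂ)⁻¹ • p.2)) hp
  have h2 := hG.norm_le hn h1
  simp only [Prod.fst_sub, Prod.snd_sub] at h2
  have h3 : R (p.1 + (n : ℂ)⁻¹ • p.2) - p.1 + (n : ℂ)⁻¹ •
      ((n : ℂ) • (p.1 + (n : ℂ)⁻¹ • p.2 - R (p.1 + (n : ℂ)⁻¹ • p.2)) - p.2) = 0 := by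
    rw [smul_sub, inv_smul_smul₀ hn']
    abel
  rw [h3, norm_zero] at h2
  exact sub_eq_zero.1 (norm_le_zero_iff.1 h2)

theorem IsResolvent.norm_apply_le (hR : IsResolvent G n R) (hG : IsNonnegSymm G) (hn : 0 < n)
    (φ : E) : ‖R φ‖ ≤ ‖φ‖ := by
  have hn' : (n : ℂ) ≠ 0 := by exact_mod_cast hn.ne'
  have h1 := hG.norm_le hn (hR φ)
  simpa only [inv_smul_smul₀ hn', add_sub_cancel] using h1

/-- The resolvent commutes with A: R A = A R = n (1 - R) on the domain. -/
theorem IsResolvent.apply_snd (hR : IsResolvent G n R) (hG : IsNonnegSymm G) (hn : 0 < n)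
    {p : E × E} (hp : p ∈ G) : R p.2 = yosida n R p.1 := by
  have hn' : (n : ℂ) ≠ 0 := by exact_mod_cast hn.ne'
  have h1 := hR.apply_add hG hn hp
  rw [map_add, map_smul] at h1
  rw [yosida_apply, ← eq_sub_of_add_eq' h1, smul_inv_smul₀ hn']

/-- `B` maps the graph `G` into itself, that is, `B` commutes with the operator. -/
def Preserves (G : Submodule ℂ (E × E)) (B : E →L[ℂ] E) : Prop := ∀ p ∈ G, (B p.1, B p.2) ∈ G

theorem IsResolvent.preserves (hR : IsResolvent G n R) (hG : IsNonnegSymm G) (hn : 0 < n) :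
    Preserves G R := fun p hp => by
  rw [hR.apply_snd hG hn hp]
  exact hR p.1

theorem IsResolvent.preserves_yosida (hR : IsResolvent G n R) (hG : IsNonnegSymm G) (hn : 0 < n) :
    Preserves G (yosida n R) := fun p hp =>
  G.smul_mem (n : ℂ) (G.sub_mem hp (hR.preserves hG hn p hp))

theorem Preserves.pow {B : E →L[ℂ] E} (hB : Preserves G B) (m : ℕ) : Preserves G (B ^ m) := by
  induction m with
  | zero => exact fun p hp => hp
  | succ m ih =>
    intro p hp
    rw [pow_succ']
    exact hB _ (ih p hp)

theorem IsResolvent.norm_yosida_le (hR : IsResolvent G n R) (hG : IsNonnegSymm G) (hn : 0 < n)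
    {p : E × E} (hp : p ∈ G) : ‖yosida n R p.1‖ ≤ ‖p.2‖ := by
  rw [← hR.apply_snd hG hn hp]
  exact hR.norm_apply_le hG hn _

/-- On the domain 1 - R = n⁻¹ R A has size 1/n, and R is a contraction; hence R^m tends to the
identity there as n → ∞. -/
theorem IsResolvent.norm_sub_pow_le (hR : IsResolvent G n R) (hG : IsNonnegSymm G) (hn : 0 < n)
    {p : E × E} (hp : p ∈ G) (m : ℕ) : ‖p.1 - (R ^ m) p.1‖ ≤ m * (‖p.2‖ / n) := by
  have hn' : (n : ℂ) ≠ 0 := by exact_mod_cast hn.ne'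
  induction m with
  | zero => simp
  | succ m ih =>
    have h1 : p.1 - (R ^ (m + 1)) p.1 = (p.1 - R p.1) + R (p.1 - (R ^ m) p.1) := by
      rw [pow_succ', mul_apply_eq_comp, map_sub]
      abel
    have h2 : ‖p.1 - R p.1‖ ≤ ‖p.2‖ / n := by
      rw [le_div_iff₀ hn, mul_comm]
      refine le_trans (le_of_eq ?_) (hR.norm_yosida_le hG hn hp)
      rw [yosida_apply, norm_smul, Complex.norm_real, Real.norm_of_nonneg hn.le]
    rw [h1]
    refine (norm_add_le _ _).trans ?_
    have h3 := hR.norm_apply_le hG hn (p.1 - (R ^ m) p.1)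
    rw [Nat.cast_succ, add_one_mul]
    linarith

/-- A^m R^m = (A R)^m. In particular R^m maps every vector into the domain of A^m, with no
regularity assumed. -/
theorem IsResolvent.isPow {A : E →ₗ.[ℂ] E} (hR : IsResolvent A.graph n R)
    (hG : IsNonnegSymm A.graph) (hn : 0 < n) (m : ℕ) (φ : E) :
    IsPow A m ((R ^ m) φ) ((yosida n R ^ m) φ) := by
  induction m generalizing φ with
  | zero => exact (isPow_zero _ _ _).2 rfl
  | succ m ih =>
    rw [isPow_succ]
    refine ⟨(yosida n R ^ m) (R φ), by rw [pow_succ]; exact ih (R φ), ?_⟩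
    have h1 := ((hR.preserves_yosida hG hn).pow m) _ (hR φ)
    obtain ⟨y, hy1, hy2⟩ := (LinearPMap.mem_graph_iff A).1 h1
    simp only at hy1 hy2
    refine ⟨hy1 ▸ y.2, ?_⟩
    rw [pow_succ, mul_apply_eq_comp, yosida_apply, ← hy2]
    congr 1
    exact Subtype.ext hy1.symm

/-- If `A χ_j = μ χ_{j+1} + χ_j` and `‖χ_j‖ ≤ K ^ j`, then `‖(A (1 + A / n)⁻¹) ^ i χ_j‖` is bounded
uniformly in `n`. -/
theorem IsResolvent.norm_yosida_pow_le (hR : IsResolvent G n R) (hG : IsNonnegSymm G) (hn : 0 < n)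
    {χ : ℕ → E} {μ K : ℝ} (hμ : 0 ≤ μ) (hχ : ∀ j, (χ j, (μ : ℂ) • χ (j + 1) + χ j) ∈ G)
    (hK : ∀ j, ‖χ j‖ ≤ K ^ j) (i j : ℕ) :
    ‖(yosida n R ^ i) (χ j)‖ ≤ (1 + μ * K) ^ i * K ^ j := by
  induction i generalizing j with
  | zero => simpa using hK j
  | succ i ih =>
    have hcomm : Commute (yosida n R ^ i) R := by
      refine Commute.pow_left ?_ i
      rw [yosida]
      exact (Commute.sub_left (Commute.one_left R) (Commute.refl R)).smul_left _
    -- One factor A R acts on χ_j as R (μ χ_{j+1} + χ_j). The contraction R is kept outermost so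
    -- that the bound is uniform in n.
    have h1 : (yosida n R ^ (i + 1)) (χ j)
        = R ((μ : ℂ) • (yosida n R ^ i) (χ (j + 1)) + (yosida n R ^ i) (χ j)) := by
      rw [pow_succ, mul_apply_eq_comp, ← hR.apply_snd hG hn (hχ j), ← map_smul,
        ← map_add]
      exact congrArg (fun B : E →L[ℂ] E => B ((μ : ℂ) • χ (j + 1) + χ j)) hcomm.eq
    rw [h1]
    refine (hR.norm_apply_le hG hn _).trans ((norm_add_le _ _).trans ?_)
    rw [norm_smul, Complex.norm_real, Real.norm_of_nonneg hμ]
    have h2 := mul_le_mul_of_nonneg_left (ih (j + 1)) hμ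
    have h3 := ih j
    calc _ ≤ μ * ((1 + μ * K) ^ i * K ^ (j + 1)) + (1 + μ * K) ^ i * K ^ j := add_le_add h2 h3
      _ = _ := by ring

/-- Bounded operators commuting with the generator give conserved quantities. -/
theorem Preserves.norm_eq_of_solution {B : E →L[ℂ] E} (hB : Preserves G B) (hG : IsNonnegSymm G)
    {ψ : ℝ → E} {ν : ℝ}
    (hψ : ∀ t, ∃ y, (ψ t, y) ∈ G ∧ HasDerivAt ψ (-(Complex.I • (ν : ℂ) • (y - ψ t))) t) (t : ℝ) :
    ‖B (ψ t)‖ = ‖B (ψ 0)‖ := by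
  have hd : ∀ s, HasDerivAt (fun s => ⟪B (ψ s), B (ψ s)⟫_ℂ) 0 s := by
    intro s
    obtain ⟨y, hy, hd⟩ := hψ s
    have h1 : HasDerivAt (fun s => B (ψ s)) (B (-(Complex.I • (ν : ℂ) • (y - ψ s)))) s :=
      (B.restrictScalars ℝ).hasFDerivAt.comp_hasDerivAt s hd
    have h2 := h1.inner ℂ h1
    have h3 : ⟪B y, B (ψ s)⟫_ℂ = ⟪B (ψ s), B y⟫_ℂ := hG.symm _ (hB _ hy) _ (hB _ hy)
    -- Since (B ψ, B y) lies again in the graph, symmetry makes the two halves of the derivative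
    -- cancel; so does the real shift by ψ.
    have h4 : ⟪B (ψ s), B (-(Complex.I • (ν : ℂ) • (y - ψ s)))⟫_ℂ
        + ⟪B (-(Complex.I • (ν : ℂ) • (y - ψ s))), B (ψ s)⟫_ℂ = 0 := by
      simp only [map_neg, map_smul, map_sub, inner_neg_right, inner_neg_left, inner_smul_right,
        inner_smul_left, inner_sub_left, inner_sub_right, Complex.conj_I, Complex.conj_ofReal]
      rw [h3]
      ring
    rw [h4] at h2
    exact h2
  have h1 : ⟪B (ψ t), B (ψ t)⟫_ℂ = ⟪B (ψ 0), B (ψ 0)⟫_ℂ :=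
    is_const_of_deriv_eq_zero (fun s => (hd s).differentiableAt) (fun s => (hd s).deriv) t 0
  rw [inner_self_eq_norm_sq_to_K, inner_self_eq_norm_sq_to_K] at h1
  exact (pow_left_inj₀ (norm_nonneg _) (norm_nonneg _) two_ne_zero).1 (by exact_mod_cast h1)

end Resolvent

/-! ### Regularity of solutions of the Schrödinger equation -/

section BoundedMultiplier

variable {d : Type} [Fintype d]

theorem wsum_sqw_le_of_abs_le_one {w : (d → ℤ) → ℝ} (hw : ∀ ξ, |w ξ| ≤ 1) (ψ : L2 d) :
    wsum (sqw w) ψ ≤ ‖ψ‖ₑ ^ 2 := by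
  rw [← wsum_one]
  refine wsum_mono (fun ξ => ?_) ψ
  rw [sqw, ← ENNReal.ofReal_one]
  exact ENNReal.ofReal_le_ofReal ((sq_le_one_iff_abs_le_one _).2 (hw ξ))

theorem wsum_sqw_ne_top_of_abs_le_one {w : (d → ℤ) → ℝ} (hw : ∀ ξ, |w ξ| ≤ 1) (ψ : L2 d) :
    wsum (sqw w) ψ ≠ ⊤ :=
  ne_top_of_le_ne_top (ENNReal.pow_ne_top enorm_ne_top) (wsum_sqw_le_of_abs_le_one hw ψ)

/-- A Fourier multiplier with symbol bounded by one as a bounded operator. -/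
def contractionMultiplier (w : (d → ℤ) → ℝ) (hw : ∀ ξ, |w ξ| ≤ 1) : L2 d →L[ℂ] L2 d :=
  LinearMap.mkContinuous
    { toFun := fm w
      map_add' := fun φ ψ => fc_ext fun ξ => by
        rw [fc_add]
        simp only [fc_fm (wsum_sqw_ne_top_of_abs_le_one hw _), fc_add, mul_add]
      map_smul' := fun c ψ => fc_ext fun ξ => by
        rw [RingHom.id_apply, fc_smul]
        simp only [fc_fm (wsum_sqw_ne_top_of_abs_le_one hw _), fc_smul]
        ring } 1 (by
    intro ψ
    refine norm_le_of_enorm_sq_le zero_le_one ?_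
    rw [one_pow, ENNReal.ofReal_one, one_mul]
    show ‖fm w ψ‖ₑ ^ 2 ≤ ‖ψ‖ₑ ^ 2
    rw [enorm_fm_sq (wsum_sqw_ne_top_of_abs_le_one hw _)]
    exact wsum_sqw_le_of_abs_le_one hw ψ)

theorem fc_contractionMultiplier {w : (d → ℤ) → ℝ} (hw : ∀ ξ, |w ξ| ≤ 1) (ψ : L2 d) (ξ : d → ℤ) :
    fc (contractionMultiplier w hw ψ) ξ = w ξ * fc ψ ξ :=
  fc_fm (wsum_sqw_ne_top_of_abs_le_one hw ψ) ξ

theorem wsum_contractionMultiplier {w : (d → ℤ) → ℝ} (hw : ∀ ξ, |w ξ| ≤ 1)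
    (F : (d → ℤ) → ℝ≥0∞) (ψ : L2 d) :
    wsum F (contractionMultiplier w hw ψ) = wsum (fun ξ => F ξ * sqw w ξ) ψ :=
  wsum_fm (wsum_sqw_ne_top_of_abs_le_one hw ψ) F

end BoundedMultiplier

/-! ### Conservation of the regularized energies and the resulting Sobolev bound. -/

section Dynamics

variable {L : ℝ} {V : (Fin 3 → ℝ) × (Fin 3 → ℝ) → ℝ} {β : ℝ} {N : ℕ}
  {U : Fin N × Fin N × Fin N → C(UnitAddTorus (Fin N × Fin 3), ℝ)} {a : Mode → ℂ} {C R : ℝ}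

theorem mem_graph_shiftedHamiltonian (hN : 1 ≤ N) (hU : interaction V β L N = totalInteraction U)
    {φ χ : L2N N} : (φ, χ) ∈ (shiftedHamiltonian V β L N).graph ↔
      MemSobolev L 2 φ ∧ shiftedOp L U φ = χ := by
  rw [LinearPMap.mem_graph_iff]
  constructor
  · rintro ⟨y, rfl, rfl⟩
    exact ⟨(mem_domain_shiftedHamiltonian hN hU _).1 y.2, (shiftedHamiltonian_apply hN hU y).symm⟩
  · rintro ⟨h1, h2⟩
    exact ⟨⟨φ, (mem_domain_shiftedHamiltonian hN hU _).2 h1⟩, rfl,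
      (shiftedHamiltonian_apply hN hU _).trans h2⟩

theorem hamiltonian_mem_graph (hN : 1 ≤ N) (hU : interaction V β L N = totalInteraction U)
    {φ χ : L2N N} (h : ∃ h : φ ∈ (hamiltonian V β L N).domain, hamiltonian V β L N ⟨φ, h⟩ = χ) :
    (φ, (((N : ℝ)⁻¹ : ℝ) : ℂ) • χ + φ) ∈ (shiftedHamiltonian V β L N).graph := by
  obtain ⟨h1, rfl⟩ := h
  have h2 : φ ∈ (shiftedHamiltonian V β L N).domain :=
    (mem_domain_shiftedHamiltonian hN hU φ).2 ((mem_domain_hamiltonian hN hU φ).1 h1)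
  have h3 := shiftedHamiltonian_apply_eq ⟨φ, h2⟩ h1
  rw [Complex.ofReal_inv, Complex.ofReal_natCast, ← h3]
  exact (shiftedHamiltonian V β L N).mem_graph ⟨φ, h2⟩

theorem inner_fm_left {d : Type} [Fintype d] {w : (d → ℤ) → ℝ} {φ ψ : L2 d}
    (hφ : wsum (sqw w) φ ≠ ⊤) (hψ : wsum (sqw w) ψ ≠ ⊤) : ⟪fm w φ, ψ⟫_ℂ = ⟪φ, fm w ψ⟫_ℂ := by
  refine (hasSum_inner_fc (fm w φ) ψ).unique ?_
  convert hasSum_inner_fc φ (fm w ψ) using 2 with ξ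
  rw [fc_fm hφ, fc_fm hψ, map_mul, Complex.conj_ofReal]
  ring

theorem re_inner_fm_nonneg {d : Type} [Fintype d] {w : (d → ℤ) → ℝ} (hw : ∀ ξ, 0 ≤ w ξ) {ψ : L2 d}
    (hψ : wsum (sqw w) ψ ≠ ⊤) : 0 ≤ (⟪ψ, fm w ψ⟫_ℂ).re := by
  refine (Complex.hasSum_re (hasSum_inner_fc ψ (fm w ψ))).nonneg fun ξ => ?_
  rw [fc_fm hψ, mul_left_comm, Complex.re_ofReal_mul, mul_comm (conj (fc ψ ξ)), Complex.mul_conj,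
    Complex.ofReal_re]
  exact mul_nonneg (hw ξ) (Complex.normSq_nonneg _)

theorem InteractionBounds.isNonnegSymm (h : InteractionBounds L N U a C R)
    (hU : interaction V β L N = totalInteraction U) :
    IsNonnegSymm (shiftedHamiltonian V β L N).graph := by
  constructor
  · rintro ⟨φ, _⟩ hφ ⟨ψ, _⟩ hψ
    obtain ⟨hφ', rfl⟩ := (mem_graph_shiftedHamiltonian h.one_le_N hU).1 hφ
    obtain ⟨hψ', rfl⟩ := (mem_graph_shiftedHamiltonian h.one_le_N hU).1 hψ
    simp only [shiftedOp, inner_add_left, inner_add_right, inner_smul_left, inner_smul_right,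
      sum_inner, inner_sum, inner_mulOp_left, map_inv₀, map_pow, map_natCast]
    rw [inner_fm_left (w := meanSymbol L N) hφ' hψ']
  · rintro ⟨ψ, _⟩ hψ
    obtain ⟨hψ', rfl⟩ := (mem_graph_shiftedHamiltonian h.one_le_N hU).1 hψ
    have e : ((N : ℂ) ^ 3)⁻¹ = (((N : ℝ) ^ 3)⁻¹ : ℝ) := by push_cast; rfl
    simp only [shiftedOp, inner_add_right, inner_smul_right, inner_sum, Complex.add_re, e,
      Complex.re_ofReal_mul, Complex.re_sum]
    refine add_nonneg (re_inner_fm_nonneg (meanSymbol_nonneg L N) hψ')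
      (mul_nonneg (by positivity) (Finset.sum_nonneg fun t _ => ?_))
    exact re_inner_mulOp_nonneg (h.nonneg t) ψ

/-- The interaction part of `N⁻¹ H_N + 1` is bounded, so resolvents exist by a Neumann series. -/
theorem InteractionBounds.exists_isResolvent (h : InteractionBounds L N U a C R)
    (hU : interaction V β L N = totalInteraction U) :
    ∃ n₀ : ℝ, 0 < n₀ ∧ ∀ n, n₀ < n → ∃ B : L2N N →L[ℂ] L2N N,
      IsResolvent (shiftedHamiltonian V β L N).graph n B := by
  set W : L2N N →L[ℂ] L2N N := ((N : ℂ) ^ 3)⁻¹ • ∑ t ∈ triples N, mulOp (U t) with hW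
  refine ⟨‖W‖ + 1, by positivity, fun n hn => ?_⟩
  have hn0 : 0 < n := lt_of_le_of_lt (by positivity) hn
  have hn' : (n : ℂ) ≠ 0 := by exact_mod_cast hn0.ne'
  set w : (Fin N × Fin 3 → ℤ) → ℝ := fun ξ => (1 + meanSymbol L N ξ / n)⁻¹ with hwdef
  have hpos : ∀ ξ, 0 < 1 + meanSymbol L N ξ / n := fun ξ => by
    have := meanSymbol_nonneg L N ξ
    positivity
  have hw : ∀ ξ, |w ξ| ≤ 1 := fun ξ => by
    rw [abs_of_pos (inv_pos.2 (hpos ξ))]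
    refine inv_le_one_of_one_le₀ ?_
    have := meanSymbol_nonneg L N ξ
    have : 0 ≤ meanSymbol L N ξ / n := by positivity
    linarith
  set D := contractionMultiplier w hw with hD
  have hDnorm : ‖D‖ ≤ 1 := LinearMap.mkContinuous_norm_le _ zero_le_one _
  have hDmem : ∀ φ, MemSobolev L 2 (D φ) := fun φ => by
    rw [MemSobolev, wsum_contractionMultiplier]
    have h1 : wsum (fun ξ => sobolevWeight L N 2 ξ * sqw w ξ) φ
        ≤ ENNReal.ofReal (n ^ 2) * wsum (fun _ => 1) φ := by
      rw [← wsum_const_mul]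
      refine wsum_mono (fun ξ => ?_) φ
      rw [sobolevWeight, sqw, ← ENNReal.ofReal_mul (by positivity), mul_one, ← mul_pow]
      have h2 := meanSymbol_nonneg L N ξ
      have h3 := inv_nonneg.2 (hpos ξ).le
      refine ENNReal.ofReal_le_ofReal (pow_le_pow_left₀ (mul_nonneg h2 h3) ?_ 2)
      show meanSymbol L N ξ * (1 + meanSymbol L N ξ / n)⁻¹ ≤ n
      rw [← div_eq_mul_inv, div_le_iff₀ (hpos ξ), mul_add, mul_div_cancel₀ _ hn0.ne']
      linarith
    rw [wsum_one] at h1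
    exact ne_top_of_le_ne_top (ENNReal.mul_ne_top ENNReal.ofReal_ne_top
      (ENNReal.pow_ne_top enorm_ne_top)) h1
  -- With D = (1 + T₀/n)⁻¹ for the kinetic part T₀, one has 1 + (T₀ + W)/n = (1 + W D/n)(1 + T₀/n).
  -- The first factor is invertible once n > ‖W‖.
  set T : L2N N →L[ℂ] L2N N := -((n : ℂ)⁻¹ • (W * D)) with hT
  have hTnorm : ‖T‖ < 1 := by
    rw [hT, norm_neg, norm_smul, norm_inv, Complex.norm_real, Real.norm_of_nonneg hn0.le,
      inv_mul_lt_iff₀ hn0, mul_one]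
    calc ‖W * D‖ ≤ ‖W‖ * ‖D‖ := norm_mul_le _ _
      _ ≤ ‖W‖ * 1 := by gcongr
      _ < n := by linarith
  refine ⟨D * ((Units.oneSub T hTnorm)⁻¹ : (L2N N →L[ℂ] L2N N)ˣ), fun φ => ?_⟩
  set η := (((Units.oneSub T hTnorm)⁻¹ : (L2N N →L[ℂ] L2N N)ˣ) : L2N N →L[ℂ] L2N N) φ with hη
  have h1 : η + (n : ℂ)⁻¹ • W (D η) = φ := by
    have h2 := congrArg (fun B : L2N N →L[ℂ] L2N N => B φ) (Units.oneSub T hTnorm).mul_inv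
    have h3 : (1 - T) η = φ := h2
    rw [← h3, hT, sub_neg_eq_add]
    rfl
  refine (mem_graph_shiftedHamiltonian h.one_le_N hU).2 ⟨hDmem η, ?_⟩
  have h4 : shiftedOp L U (D η) = fm (meanSymbol L N) (D η) + W (D η) := by
    rw [shiftedOp, hW]
    simp
  show shiftedOp L U (D η) = (n : ℂ) • (φ - D η)
  rw [h4, ← h1, add_sub_right_comm, smul_add, smul_inv_smul₀ hn']
  congr 1
  refine fc_ext fun ξ => ?_
  rw [fc_fm (w := meanSymbol L N) (hDmem η), fc_smul, sub_eq_add_neg, ← neg_one_smul ℂ (D η),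
    fc_add, fc_smul, hD, fc_contractionMultiplier, hwdef]
  have h6 : (n : ℂ) + meanSymbol L N ξ ≠ 0 := by
    have := meanSymbol_nonneg L N ξ
    exact_mod_cast (by positivity : n + meanSymbol L N ξ ≠ 0)
  have h7 : (1 : ℂ) + meanSymbol L N ξ / n = (n + meanSymbol L N ξ) / n := by
    field_simp
  push_cast
  rw [h7, inv_div]
  field_simp
  ring

/-- The average Sobolev norm of a solution whose initial value has energy moments. -/
theorem InteractionBounds.avgNorm_solution_le (h : InteractionBounds L N U a C R)
    (hU : interaction V β L N = totalInteraction U) {k : ℕ}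
    (hρ : energyError C (R ^ 7 / N) (2 * k : ℕ) ≤ 1 - 1 / 2) {ψ : ℝ → L2N N}
    (hψ : IsSchrodingerSolution (hamiltonian V β L N) ψ) {K : ℝ} (hK : 0 < K) (h0 : ‖ψ 0‖ = 1)
    (hE : ∀ j : ℕ, 1 ≤ j → powExpectation (hamiltonian V β L N) (energyForm V β L N) j (ψ 0)
      ≤ ENNReal.ofReal (K ^ j * (N : ℝ) ^ j)) (t : ℝ) :
    ENNReal.ofReal ((1 / 2) ^ (2 * k)) * avgNorm L (2 * k) (ψ t)
      ≤ ENNReal.ofReal ((1 + K) ^ (2 * k)) := by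
  have hN := h.one_le_N
  have hN0 : (0 : ℝ) < N := by exact_mod_cast hN
  have hN' : (N : ℂ) ≠ 0 := by exact_mod_cast hN0.ne'
  have hG := h.isNonnegSymm hU
  -- Only even moments are used: the moment of order 2j is ‖H_N^j ψ(0)‖².
  have hex : ∀ j, ∃ χ, IsPow (hamiltonian V β L N) j (ψ 0) χ ∧ ‖χ‖ ≤ (K * N) ^ j := by
    intro j
    rcases Nat.eq_zero_or_pos j with rfl | hj
    · exact ⟨ψ 0, (isPow_zero _ _ _).2 rfl, by simp [h0]⟩
    · have h1 := hE (2 * j) (by omega)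
      obtain ⟨χ, h2, h3⟩ := powExpectation_ne_top (ne_top_of_le_ne_top ENNReal.ofReal_ne_top h1)
      rw [Nat.mul_div_cancel_left j two_pos] at h2
      rw [h3, if_pos (even_two_mul j)] at h1
      refine ⟨χ, h2, ?_⟩
      rw [← mul_pow, mul_comm 2 j, pow_mul, ← ofReal_norm, ← ENNReal.ofReal_pow (norm_nonneg _),
        ENNReal.ofReal_le_ofReal_iff (by positivity)] at h1
      exact le_of_sq_le_sq h1 (by positivity)
  choose χ hχ hχn using hex
  have hχ0 : χ 0 = ψ 0 := ((isPow_zero _ _ _).1 (hχ 0)).symm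
  have hχs : ∀ j, (χ j, (((N : ℝ)⁻¹ : ℝ) : ℂ) • χ (j + 1) + χ j)
      ∈ (shiftedHamiltonian V β L N).graph := by
    intro j
    obtain ⟨φ, h1, h2⟩ := (isPow_succ _ _ _ _).1 (hχ (j + 1))
    obtain ⟨h3, h4⟩ := h1
    obtain ⟨h5, h6⟩ := hχ j
    have h7 : φ = χ j := h4.symm.trans h6
    subst h7
    exact hamiltonian_mem_graph hN hU h2
  have hsol : ∀ s, ∃ y, (ψ s, y) ∈ (shiftedHamiltonian V β L N).graph ∧
      HasDerivAt ψ (-(Complex.I • (((N : ℝ) : ℝ) : ℂ) • (y - ψ s))) s := by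
    intro s
    obtain ⟨h1, h2⟩ := hψ s
    refine ⟨_, hamiltonian_mem_graph hN hU ⟨h1, rfl⟩, ?_⟩
    rwa [add_sub_cancel_right, Complex.ofReal_inv, Complex.ofReal_natCast, smul_inv_smul₀ hN']
  obtain ⟨n₀, hn₀, hres⟩ := h.exists_isResolvent hU
  choose! B hB using hres
  -- Convergence holds because a strong solution stays in the domain at every time.
  have hlim : Tendsto (fun n : ℕ => (B n ^ k) (ψ t)) atTop (𝓝 (ψ t)) := by
    obtain ⟨y, hy, -⟩ := hsol t
    rw [tendsto_iff_norm_sub_tendsto_zero]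
    have h1 : Tendsto (fun n : ℕ => k * (‖y‖ / (n : ℝ))) atTop (𝓝 (k * 0)) :=
      (tendsto_const_div_atTop_nhds_zero_nat ‖y‖).const_mul _
    rw [mul_zero] at h1
    refine squeeze_zero' (Eventually.of_forall fun n => norm_nonneg _) ?_ h1
    filter_upwards [tendsto_natCast_atTop_atTop.eventually_gt_atTop n₀] with n hn
    rw [norm_sub_rev]
    exact (hB n hn).norm_sub_pow_le hG (hn₀.trans hn) hy k
  rw [avgNorm, ← wsum_const_mul]
  refine wsum_le_of_tendsto (fun ξ => ENNReal.mul_ne_top ENNReal.ofReal_ne_top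
    ENNReal.ofReal_ne_top) hlim ?_
  filter_upwards [tendsto_natCast_atTop_atTop.eventually_gt_atTop n₀] with n hn
  have hn0 := hn₀.trans hn
  have h1 := (hB n hn).isPow hG hn0 k (ψ t)
  set φ := (yosida (n : ℝ) (B n) ^ k) (ψ t) with hφ
  -- Conservation reduces to t = 0. There A χ_j = N⁻¹ χ_{j+1} + χ_j with ‖χ_j‖ ≤ (K N)^j, and N⁻¹ ·
  -- K N = K.
  have h2 : ‖φ‖ ≤ (1 + K) ^ k := by
    rw [hφ, ((hB n hn).preserves_yosida hG hn0).pow k |>.norm_eq_of_solution hG hsol t, ← hχ0]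
    have h3 := (hB n hn).norm_yosida_pow_le hG hn0 (inv_nonneg.2 hN0.le) hχs hχn k 0
    rwa [pow_zero, mul_one, mul_comm K, inv_mul_cancel_left₀ hN0.ne'] at h3
  -- The energy estimate is applied to the regularized vector R^k ψ(t), whose image under A^k is φ.
  have h4 := h.avgNorm_le_of_isPow (mem_domain_shiftedHamiltonian hN hU)
    (shiftedHamiltonian_apply hN hU) (c := 1 / 2) (by norm_num) (k₀ := 0) hρ
    (Q := ‖φ‖ₑ ^ 2) (memSobolev_zero φ)
    (by rw [pow_zero, ENNReal.ofReal_one, one_mul, avgNorm_zero]) k le_rfl h1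
  rw [wsum_const_mul]
  refine h4.2.trans ?_
  rw [mul_comm 2 k, pow_mul, ← ofReal_norm, ← ENNReal.ofReal_pow (norm_nonneg _)]
  exact ENNReal.ofReal_le_ofReal (pow_le_pow_left₀ (norm_nonneg _) h2 2)

theorem firstParticles_mono {k k' : ℕ} (h : k ≤ k') : firstParticles N k ⊆ firstParticles N k' :=
  Finset.monotone_filter_right _ fun _ _ hj => lt_of_lt_of_le hj h

/-- The Sobolev bound for solutions of the Schrödinger equation. -/
theorem exists_opNormSq_solution_le (hL : 0 < L) (hV : ContDiff ℝ ∞ V) (hs : HasCompactSupport V)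
    (h0 : ∀ z, 0 ≤ V z) (hβ : β < 1 / 8) {K : ℝ} (hK : 0 < K) {k : ℕ} (hk : 1 ≤ k) :
    ∃ M : ℕ, ∀ N : ℕ, M < N → k ≤ N ∧ ∀ ψ : ℝ → L2N N,
      IsSchrodingerSolution (hamiltonian V β L N) ψ → (∀ t, IsBosonic (ψ t)) → ‖ψ 0‖ = 1 →
      (∀ j : ℕ, 1 ≤ j → powExpectation (hamiltonian V β L N) (energyForm V β L N) j (ψ 0)
        ≤ ENNReal.ofReal (K ^ j * (N : ℝ) ^ j)) → ∀ t,
      opNormSq (S L N k) (ψ t) ≤ ENNReal.ofReal ((8 * (1 + K) ^ 2) ^ k) := by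
  obtain ⟨C, hC⟩ := exists_energy_setup hL hV hs h0 hβ
  -- The estimate is run with 2k derivatives, coming from ‖A^k ψ‖², and k of them are then discarded
  -- since ⟨ξ_j⟩ ≥ 1. This avoids odd powers and keeps the bound geometric in k.
  obtain ⟨M, hM⟩ := hC (1 / 2) (by norm_num) (2 * k)
  obtain ⟨M', hM'⟩ := eventually_atTop.1 ((tendsto_descFactorial_div (2 * k)).eventually
    (eventually_ge_nhds (by norm_num : (1 / 2 : ℝ) < 1)))
  refine ⟨max M M', fun N hN => ?_⟩
  rw [max_lt_iff] at hN
  obtain ⟨hkN, hρ, U, hU1, hU2⟩ := hM N hN.1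
  refine ⟨by omega, fun ψ hψ hb h1 hE t => ?_⟩
  have h2 := hU1.avgNorm_solution_le hU2 hρ hψ hK h1 hE t
  rw [avgNorm, wsum_avgSymbol_bosonic (hb t) hkN, ← mul_assoc,
    ← ENNReal.ofReal_mul (by positivity)] at h2
  have h3 : wsum (sqw (prodSymbol L (firstParticles N k))) (ψ t)
      ≤ wsum (sqw (prodSymbol L (firstParticles N (2 * k)))) (ψ t) := by
    refine wsum_mono (fun ξ => ENNReal.ofReal_le_ofReal ?_) _
    refine pow_le_pow_left₀ (zero_le_one.trans (one_le_prodSymbol _ _ _)) ?_ 2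
    exact Finset.prod_le_prod_of_subset_of_one_le (firstParticles_mono (by omega))
      (fun j _ => zero_le_one.trans (one_le_japaneseSymbol L j ξ)) fun j _ _ => one_le_japaneseSymbol L j ξ
  rw [S_opNormSq]
  set X := wsum (sqw (prodSymbol L (firstParticles N k))) (ψ t) with hX
  -- The factor 4^k undoes (1/2)^{2k}, and 2^k ≥ 2 undoes the falling factorial ratio, which is at
  -- least 1/2 for large N.
  have h4 : (1 : ℝ) ≤ 2 ^ k * 4 ^ k * ((1 / 2) ^ (2 * k) *
      (N.descFactorial (2 * k) / (N : ℝ) ^ (2 * k))) := by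
    have h5 := hM' N hN.2.le
    have h6 : (1 / 2 : ℝ) ^ (2 * k) = ((4 : ℝ) ^ k)⁻¹ := by
      rw [pow_mul, ← inv_pow]
      norm_num
    have h7 : (2 : ℝ) ≤ 2 ^ k := le_self_pow₀ one_le_two (by omega)
    rw [h6, mul_assoc, mul_inv_cancel_left₀ (by positivity)]
    nlinarith
  calc X = ENNReal.ofReal 1 * X := by rw [ENNReal.ofReal_one, one_mul]
    _ ≤ ENNReal.ofReal (2 ^ k * 4 ^ k * ((1 / 2) ^ (2 * k) *
      (N.descFactorial (2 * k) / (N : ℝ) ^ (2 * k)))) *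
        wsum (sqw (prodSymbol L (firstParticles N (2 * k)))) (ψ t) := by gcongr
    _ ≤ ENNReal.ofReal (2 ^ k * 4 ^ k) * ENNReal.ofReal ((1 + K) ^ (2 * k)) := by
      rw [ENNReal.ofReal_mul (by positivity), mul_assoc]
      gcongr
    _ = _ := by
      rw [← ENNReal.ofReal_mul (by positivity), pow_mul, ← mul_pow, ← mul_pow]
      norm_num

end Dynamics

/-! ### Partial traces -/

section Pairing

variable {X Y : Type*} [MeasurableSpace X] [MeasurableSpace Y] {μ : Measure X} {ν : Measure Y}

/-- The function `y ↦ ∫ conj (f x) Ψ(x, y) dx`. -/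
def pairing (μ : Measure X) (f : X → ℂ) (Ψ : X × Y → ℂ) (y : Y) : ℂ :=
  ∫ x, conj (f x) * Ψ (x, y) ∂μ

theorem memLp_two_prod_mul {f : X → ℂ} {g : Y → ℂ} (hf : MemLp f 2 μ) (hg : MemLp g 2 ν) :
    MemLp (fun z : X × Y => f z.1 * g z.2) 2 (μ.prod ν) := by
  have hm : AEStronglyMeasurable (fun z : X × Y => f z.1 * g z.2) (μ.prod ν) :=
    hf.1.comp_fst.mul hg.1.comp_snd
  rw [memLp_two_iff_integrable_sq_norm hm]
  have h1 := ((memLp_two_iff_integrable_sq_norm hf.1).1 hf).mul_prod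
    ((memLp_two_iff_integrable_sq_norm hg.1).1 hg)
  simpa only [norm_mul, mul_pow] using h1

theorem memLp_conj {f : X → ℂ} {p : ℝ≥0∞} (hf : MemLp f p μ) :
    MemLp (fun x => conj (f x)) p μ := hf.star

variable [IsFiniteMeasure μ] [IsFiniteMeasure ν]

/-- The integrand regroups into two L² functions of (x, x', y), namely conj f(x) conj Ψ(x', y) and
g(x') Ψ(x, y). This one fact justifies Fubini for the kernel. -/
theorem integrable_pairing {f g : X → ℂ} {Ψ : X × Y → ℂ} (hf : MemLp f 2 μ) (hg : MemLp g 2 μ)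
    (hΨ : MemLp Ψ 2 (μ.prod ν)) :
    Integrable (fun z : (X × X) × Y => (conj (f z.1.1) * Ψ (z.1.1, z.2)) *
      (conj (Ψ (z.1.2, z.2)) * g z.1.2)) ((μ.prod μ).prod ν) := by
  have h1 : ∀ {h : X → ℂ}, MemLp h 2 μ → ∀ {Φ : X × Y → ℂ}, MemLp Φ 2 (μ.prod ν) →
      MemLp (fun z : (X × X) × Y => h z.1.1 * Φ (z.1.2, z.2)) 2 ((μ.prod μ).prod ν) :=
    fun hh _ hΦ => (memLp_two_prod_mul hh hΦ).comp_measurePreserving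
      (measurePreserving_prodAssoc μ μ ν)
  have h2 := h1 (memLp_conj hf) (memLp_conj hΨ)
  have h3 := (h1 hg hΨ).comp_measurePreserving
    ((Measure.measurePreserving_swap (μ := μ) (ν := μ)).prod (MeasurePreserving.id ν))
  refine (h2.integrable_mul h3).congr (Eventually.of_forall fun z => ?_)
  simp only [Pi.mul_apply, Function.comp_apply, Prod.map_fst, Prod.map_snd, Prod.fst_swap,
    Prod.snd_swap, id]
  ring

theorem pairing_mul_conj (f g : X → ℂ) (Ψ : X × Y → ℂ) (y : Y) :
    pairing μ f Ψ y * conj (pairing μ g Ψ y) =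
      ∫ z : X × X, (conj (f z.1) * Ψ (z.1, y)) * (conj (Ψ (z.2, y)) * g z.2) ∂μ.prod μ := by
  rw [integral_prod_mul (fun x => conj (f x) * Ψ (x, y)) (fun x => conj (Ψ (x, y)) * g x), pairing,
    pairing, ← integral_conj]
  congr 2
  funext x
  rw [map_mul, Complex.conj_conj, mul_comm]

theorem integrable_prod_conj_mul {f : X → ℂ} {Ψ : X × Y → ℂ} (hf : MemLp f 2 μ)
    (hΨ : MemLp Ψ 2 (μ.prod ν)) :
    Integrable (fun z : X × Y => conj (f z.1) * Ψ z) (μ.prod ν) :=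
  ((memLp_two_prod_mul (memLp_conj hf) (memLp_const (1 : ℂ))).integrable_mul hΨ).congr
    (Eventually.of_forall fun z => by simp)

/-- The squared modulus is a partial integral of the integrable function above with g = f. -/
theorem memLp_pairing {f : X → ℂ} {Ψ : X × Y → ℂ} (hf : MemLp f 2 μ)
    (hΨ : MemLp Ψ 2 (μ.prod ν)) : MemLp (pairing μ f Ψ) 2 ν := by
  have hm : AEStronglyMeasurable (pairing μ f Ψ) ν :=
    (integrable_prod_conj_mul hf hΨ).1.prod_swap.integral_prod_right'
  rw [memLp_two_iff_integrable_sq_norm hm]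
  have h1 := (integrable_pairing hf hf hΨ).integral_prod_right
  simp only [← pairing_mul_conj] at h1
  refine h1.re.congr (Eventually.of_forall fun y => ?_)
  simp only [Complex.mul_conj, RCLike.re_eq_complex_re, Complex.ofReal_re, Complex.normSq_eq_norm_sq]

theorem integral_integral_pairing {f g : X → ℂ} {Ψ : X × Y → ℂ} (hf : MemLp f 2 μ)
    (hg : MemLp g 2 μ) (hΨ : MemLp Ψ 2 (μ.prod ν)) :
    ∫ x, ∫ x', conj (f x) * (∫ y, Ψ (x, y) * conj (Ψ (x', y)) ∂ν) * g x' ∂μ ∂μ =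
      ∫ y, pairing μ f Ψ y * conj (pairing μ g Ψ y) ∂ν := by
  have hint := integrable_pairing hf hg hΨ
  simp only [pairing_mul_conj]
  rw [← integral_prod_symm _ hint, integral_prod _ hint, integral_prod _ hint.integral_prod_left]
  refine integral_congr_ae (Eventually.of_forall fun x => ?_)
  refine integral_congr_ae (Eventually.of_forall fun x' => ?_)
  simp only
  rw [← integral_const_mul, ← integral_mul_const]
  refine integral_congr_ae (Eventually.of_forall fun y => ?_)
  simp only
  ring

/-- Partial integration in one and in the other variable can be exchanged. -/
theorem integral_pairing {f : X → ℂ} {g : Y → ℂ} {Ψ : X × Y → ℂ} (hf : MemLp f 2 μ)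
    (hg : MemLp g 2 ν) (hΨ : MemLp Ψ 2 (μ.prod ν)) :
    ∫ y, conj (g y) * pairing μ f Ψ y ∂ν = ∫ z, conj (f z.1) * conj (g z.2) * Ψ z ∂μ.prod ν := by
  have h1 : Integrable (fun z : X × Y => conj (f z.1) * conj (g z.2) * Ψ z) (μ.prod ν) :=
    (memLp_two_prod_mul (memLp_conj hf) (memLp_conj hg)).integrable_mul hΨ
  rw [integral_prod_symm _ h1]
  refine integral_congr_ae (Eventually.of_forall fun y => ?_)
  simp only [pairing]
  rw [← integral_const_mul]
  refine integral_congr_ae (Eventually.of_forall fun x => ?_)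
  simp only
  ring

end Pairing

/-! ### Sums of rank-one operators. -/

section TraceClass

/-- The operator `∑ ζ, |u ζ⟩⟨u ζ|` for a family with `∑ ‖u ζ‖² < ∞`. -/
theorem exists_sum_rankOne {d : Type} [Fintype d] {ι : Type*} (u : ι → L2 d) {M : ℝ}
    (hM : 0 ≤ M) (hu : ∑' ζ, ‖u ζ‖ₑ ^ 2 ≤ ENNReal.ofReal M) :
    ∃ G : L2 d →L[ℂ] L2 d, (∀ f g, HasSum (fun ζ => ⟪f, u ζ⟫_ℂ * ⟪u ζ, g⟫_ℂ) ⟪f, G g⟫_ℂ) ∧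
      0 ≤ G ∧ G ≤ (M : ℂ) • ContinuousLinearMap.id ℂ (L2 d) ∧ posTrace G ≤ ENNReal.ofReal M := by
  have hle : ∀ f : L2 d, ∑' ζ, ‖⟪u ζ, f⟫_ℂ‖ₑ ^ 2 ≤ ENNReal.ofReal M * ‖f‖ₑ ^ 2 := fun f => by
    calc ∑' ζ, ‖⟪u ζ, f⟫_ℂ‖ₑ ^ 2 ≤ ∑' ζ, ‖u ζ‖ₑ ^ 2 * ‖f‖ₑ ^ 2 := by
          refine ENNReal.tsum_le_tsum fun ζ => ?_
          rw [← mul_pow]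
          gcongr
          rw [← ofReal_norm, ← ofReal_norm, ← ofReal_norm, ← ENNReal.ofReal_mul (norm_nonneg _)]
          exact ENNReal.ofReal_le_ofReal (norm_inner_le_norm _ _)
      _ ≤ _ := by
          rw [ENNReal.tsum_mul_right]
          gcongr
  have hmem : ∀ f : L2 d, Memℓp (fun ζ => ⟪u ζ, f⟫_ℂ) 2 := fun f =>
    (tsum_enorm_sq_ne_top_iff _).1 (ne_top_of_le_ne_top
      (ENNReal.mul_ne_top ENNReal.ofReal_ne_top (ENNReal.pow_ne_top enorm_ne_top)) (hle f))
  have hnorm : ∀ f : L2 d, ‖(⟨_, hmem f⟩ : lp (fun _ : ι => ℂ) 2)‖ ≤ Real.sqrt M * ‖f‖ := fun f => by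
    refine le_of_sq_le_sq ?_ (by positivity)
    rw [mul_pow, Real.sq_sqrt hM, ← ENNReal.ofReal_le_ofReal_iff (by positivity),
      ENNReal.ofReal_mul hM, ENNReal.ofReal_pow (norm_nonneg _), ENNReal.ofReal_pow (norm_nonneg _),
      ofReal_norm, ofReal_norm, enorm_sq_lp]
    exact hle f
  -- The sum is G = T* T for the analysis map T f = (⟨u_ζ, f⟩)_ζ with ‖T‖² ≤ M; positivity and the
  -- bound G ≤ M follow.
  let T : L2 d →L[ℂ] lp (fun _ : ι => ℂ) 2 := LinearMap.mkContinuous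
    { toFun := fun f => ⟨_, hmem f⟩
      map_add' := fun f g => lp.ext (funext fun ζ => inner_add_right _ _ _)
      map_smul' := fun c f => lp.ext (funext fun ζ => inner_smul_right _ _ _) } (Real.sqrt M) hnorm
  have hT : ∀ f ζ, T f ζ = ⟪u ζ, f⟫_ℂ := fun f ζ => rfl
  have hinner : ∀ f g, ⟪f, (T.adjoint ∘L T) g⟫_ℂ = ⟪T f, T g⟫_ℂ := fun f g => by
    rw [ContinuousLinearMap.comp_apply, ContinuousLinearMap.adjoint_inner_right]
  have hself : ∀ f, (RCLike.re ⟪f, (T.adjoint ∘L T) f⟫_ℂ) = ‖T f‖ ^ 2 := fun f => by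
    rw [hinner, inner_self_eq_norm_sq]
  have hpos : (T.adjoint ∘L T).IsPositive := ContinuousLinearMap.isPositive_adjoint_comp_self T
  refine ⟨T.adjoint ∘L T, fun f g => ?_, (ContinuousLinearMap.nonneg_iff_isPositive _).2 hpos, ?_, ?_⟩
  · rw [hinner]
    have e : (fun ζ => ⟪f, u ζ⟫_ℂ * ⟪u ζ, g⟫_ℂ) = fun ζ => ⟪T f ζ, T g ζ⟫_ℂ := funext fun ζ => by
      rw [hT, hT, RCLike.inner_apply, inner_conj_symm, mul_comm]
    rw [e]
    exact lp.hasSum_inner (T f) (T g)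
  · rw [ContinuousLinearMap.le_def]
    refine ⟨fun f g => ?_, fun f => ?_⟩
    · have := hpos.1 f g
      simp only [ContinuousLinearMap.coe_coe] at this
      simp only [ContinuousLinearMap.coe_coe, sub_apply,
        smul_apply, ContinuousLinearMap.id_apply, inner_sub_left,
        inner_sub_right, inner_smul_left, inner_smul_right, Complex.conj_ofReal, this]
    · have h1 : ‖T f‖ ^ 2 ≤ M * ‖f‖ ^ 2 := by
        have h2 := pow_le_pow_left₀ (norm_nonneg _) (hnorm f) 2
        rwa [mul_pow, Real.sq_sqrt hM] at h2
      rw [ContinuousLinearMap.reApplyInnerSelf_apply, ← inner_re_symm]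
      simp only [sub_apply, smul_apply,
        ContinuousLinearMap.id_apply, inner_sub_right, inner_smul_right, map_sub, hself]
      rw [RCLike.re_eq_complex_re, Complex.re_ofReal_mul, ← RCLike.re_eq_complex_re,
        inner_self_eq_norm_sq]
      linarith
  · refine le_trans (le_of_eq ?_) hu
    rw [posTrace]
    have h1 : ∀ ξ : d → ℤ, ENNReal.ofReal (RCLike.re ⟪UnitAddTorus.mFourierBasis ξ,
        (T.adjoint ∘L T) (UnitAddTorus.mFourierBasis ξ)⟫_ℂ) = ∑' ζ, ‖fc (u ζ) ξ‖ₑ ^ 2 := fun ξ => by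
      rw [hself, ENNReal.ofReal_pow (norm_nonneg _), ofReal_norm, enorm_sq_lp]
      refine tsum_congr fun ζ => ?_
      rw [hT, fc, HilbertBasis.repr_apply_apply, ← inner_conj_symm, RCLike.enorm_conj]
    simp only [h1, enorm_sq_eq]
    -- Tonelli: the trace in plane waves is the sum of ‖u_ζ‖².
    exact ENNReal.tsum_comm

end TraceClass

/-! ### The marginal densities -/

section Glue

variable {d d₁ d₂ : Type}

/-- A function on `d ≃ d₁ ⊕ d₂` from functions on `d₁` and on `d₂`. -/
def glue {α : Type*} (e : d ≃ d₁ ⊕ d₂) (z : (d₁ → α) × (d₂ → α)) : d → α :=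
  fun p => Sum.elim z.1 z.2 (e p)

theorem glue_sumComm {α : Type*} (e : d ≃ d₁ ⊕ d₂) (z : (d₂ → α) × (d₁ → α)) :
    glue (e.trans (Equiv.sumComm d₁ d₂)) z = glue e z.swap := by
  funext p
  simp only [glue, Equiv.trans_apply, Prod.fst_swap, Prod.snd_swap]
  cases e p <;> rfl

theorem tsum_glue (e : d ≃ d₁ ⊕ d₂) (F : (d → ℤ) → ℝ≥0∞) :
    ∑' η, F η = ∑' ζ : d₂ → ℤ, ∑' ξ : d₁ → ℤ, F (glue e (ξ, ζ)) := by
  let E : (d₁ → ℤ) × (d₂ → ℤ) ≃ (d → ℤ) :=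
    (Equiv.sumArrowEquivProdArrow d₁ d₂ ℤ).symm.trans (e.symm.arrowCongr (Equiv.refl ℤ))
  have hE : ∀ z, E z = glue e z := fun z => by
    funext p
    show Sum.elim z.1 z.2 (e p) = _
    rfl
  rw [ENNReal.tsum_comm, ← ENNReal.tsum_prod, ← E.tsum_eq]
  exact tsum_congr fun z => by rw [hE]

variable [Fintype d] [Fintype d₁] [Fintype d₂]

theorem measurePreserving_glue (e : d ≃ d₁ ⊕ d₂) :
    MeasurePreserving (glue e : UnitAddTorus d₁ × UnitAddTorus d₂ → UnitAddTorus d)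
      (volume.prod volume) volume := by
  have h1 := volume_measurePreserving_sumPiEquivProdPi_symm
    (fun _ : d₁ ⊕ d₂ => UnitAddCircle)
  have h2 := volume_measurePreserving_piCongrLeft (fun _ : d => UnitAddCircle) e.symm
  have h3 := h2.comp h1
  have h4 : (glue e : UnitAddTorus d₁ × UnitAddTorus d₂ → UnitAddTorus d)
      = MeasurableEquiv.piCongrLeft (fun _ : d => UnitAddCircle) e.symm ∘
        (MeasurableEquiv.sumPiEquivProdPi fun _ : d₁ ⊕ d₂ => UnitAddCircle).symm := by
    funext z p
    obtain ⟨q, rfl⟩ := e.symm.surjective p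
    rw [Function.comp_apply, MeasurableEquiv.coe_piCongrLeft, Equiv.piCongrLeft_apply_apply, glue,
      Equiv.apply_symm_apply]
    cases q <;> rfl
  rw [h4]
  exact h3

theorem mFourier_glue (e : d ≃ d₁ ⊕ d₂) (η : (d₁ → ℤ) × (d₂ → ℤ))
    (z : UnitAddTorus d₁ × UnitAddTorus d₂) :
    UnitAddTorus.mFourier (glue e η) (glue e z)
      = UnitAddTorus.mFourier η.1 z.1 * UnitAddTorus.mFourier η.2 z.2 := by
  simp only [UnitAddTorus.mFourier, ContinuousMap.coe_mk, glue]
  rw [e.prod_comp (fun q => fourier (Sum.elim η.1 η.2 q) (Sum.elim z.1 z.2 q)), Fintype.prod_sum_type]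
  rfl

variable (e : d ≃ d₁ ⊕ d₂)

theorem memLp_comp_glue (ψ : L2 d) :
    MemLp (fun z : UnitAddTorus d₁ × UnitAddTorus d₂ => ψ (glue e z)) 2 (volume.prod volume) :=
  (Lp.memLp ψ).comp_measurePreserving (measurePreserving_glue e)

theorem memLp_mFourier (ξ : d → ℤ) : MemLp (UnitAddTorus.mFourier ξ) 2 volume :=
  MemLp.of_bound (UnitAddTorus.mFourier ξ).continuous.aestronglyMeasurable 1
    (Eventually.of_forall fun x =>
      ((UnitAddTorus.mFourier ξ).norm_coe_le_norm x).trans_eq UnitAddTorus.mFourier_norm)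

/-- The partial Fourier coefficient of `ψ` in the variables of `d₂`. -/
def partialCoeff (ψ : L2 d) (ζ : d₂ → ℤ) : L2 d₁ :=
  -- The pairing integrates out the first factor, hence the exchange of the two blocks.
  (memLp_pairing (memLp_mFourier ζ) (memLp_comp_glue ((e.trans (Equiv.sumComm d₁ d₂))) ψ)).toLp

theorem integral_conj_mul_partialCoeff {f : UnitAddTorus d₁ → ℂ} (hf : MemLp f 2 volume) (ψ : L2 d)
    (ζ : d₂ → ℤ) : ∫ x, conj (f x) * partialCoeff e ψ ζ x =
      ∫ z : UnitAddTorus d₁ × UnitAddTorus d₂,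
        conj (f z.1) * conj (UnitAddTorus.mFourier ζ z.2) * ψ (glue e z) ∂volume.prod volume := by
  have h1 := integral_pairing (memLp_mFourier ζ) hf
    (memLp_comp_glue (e.trans (Equiv.sumComm d₁ d₂)) ψ)
  rw [← (Measure.measurePreserving_swap (μ := (volume : Measure (UnitAddTorus d₁)))
    (ν := (volume : Measure (UnitAddTorus d₂)))).integral_comp
      MeasurableEquiv.prodComm.measurableEmbedding] at h1
  refine (integral_congr_ae ?_).trans (h1.trans (integral_congr_ae (Eventually.of_forall fun z => ?_)))
  · filter_upwards [(memLp_pairing (memLp_mFourier ζ)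
      (memLp_comp_glue ((e.trans (Equiv.sumComm d₁ d₂))) ψ)).coeFn_toLp] with x hx
    rw [partialCoeff, hx]
  · simp only [glue_sumComm, Prod.fst_swap, Prod.snd_swap, Prod.swap_swap]
    ring

theorem fc_partialCoeff (ψ : L2 d) (ζ : d₂ → ℤ) (ξ : d₁ → ℤ) :
    fc (partialCoeff e ψ ζ) ξ = fc ψ (glue e (ξ, ζ)) := by
  rw [fc_eq_integral, fc_eq_integral]
  simp only [UnitAddTorus.mFourier_neg]
  have h1 := integral_map (μ := (volume : Measure (UnitAddTorus d₁)).prod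
    (volume : Measure (UnitAddTorus d₂))) (measurePreserving_glue e).measurable.aemeasurable
    (f := fun x => conj (UnitAddTorus.mFourier (glue e (ξ, ζ)) x) * ψ x) (by
      rw [(measurePreserving_glue e).map_eq]
      exact ((memLp_conj (memLp_mFourier _)).1).mul (Lp.aestronglyMeasurable ψ))
  rw [(measurePreserving_glue e).map_eq] at h1
  rw [integral_conj_mul_partialCoeff e (memLp_mFourier ξ), h1]
  simp only [mFourier_glue, map_mul]

/-- The form of the partial trace is the L² inner product, in the traced variables, of the pairings
of ψ with g and f. Parseval in those variables expands it into rank-one terms. -/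
theorem hasSum_kernelForm (ψ : L2 d) (f g : L2 d₁) :
    HasSum (fun ζ => ⟪f, partialCoeff e ψ ζ⟫_ℂ * ⟪partialCoeff e ψ ζ, g⟫_ℂ)
      (kernelForm (fun x x' => ∫ y, ψ (glue e (x, y)) * conj (ψ (glue e (x', y)))) f g) := by
  have hΨ := memLp_comp_glue e ψ
  have hA : ∀ f : L2 d₁, MemLp (pairing volume f fun z : UnitAddTorus d₁ × UnitAddTorus d₂ =>
    ψ (glue e z)) 2 volume := fun f => memLp_pairing (Lp.memLp f) hΨ
  have hfc : ∀ (f : L2 d₁) ζ, fc (hA f).toLp ζ = ⟪f, partialCoeff e ψ ζ⟫_ℂ := by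
    intro f ζ
    rw [fc_eq_integral, L2.inner_def]
    have h1 := integral_pairing (Lp.memLp f) (memLp_mFourier ζ) hΨ
    rw [← integral_conj_mul_partialCoeff e (Lp.memLp f)] at h1
    refine (integral_congr_ae ?_).trans (h1.trans (integral_congr_ae
      (Eventually.of_forall fun x => ?_)))
    · filter_upwards [(hA f).coeFn_toLp] with y hy
      rw [hy, UnitAddTorus.mFourier_neg]
    · simp only [RCLike.inner_apply, mul_comm]
  have h1 := hasSum_inner_fc (hA g).toLp (hA f).toLp
  simp only [hfc, inner_conj_symm] at h1
  convert h1 using 1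
  · funext ζ
    rw [mul_comm]
  · rw [kernelForm, integral_integral_pairing (Lp.memLp f) (Lp.memLp g) hΨ, L2.inner_def]
    refine integral_congr_ae ?_
    filter_upwards [(hA f).coeFn_toLp, (hA g).coeFn_toLp] with y h2 h3
    rw [h2, h3, RCLike.inner_apply]

end Glue

/-! ### From the wave function to its k-particle marginal. -/

section Marginal

variable {L : ℝ} {N k : ℕ}

/-- The splitting of the coordinates of `Λ ^ N` into those of the first `k` particles and of the
last `N - k` particles. -/
def splitCoord (hk : k ≤ N) :
    Fin N × Fin 3 ≃ (Fin k × Fin 3) ⊕ ({j : Fin N // k ≤ j.val} × Fin 3) where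
  toFun p := if h : p.1.val < k then .inl (⟨p.1.val, h⟩, p.2) else .inr (⟨p.1, not_lt.mp h⟩, p.2)
  invFun := Sum.elim (fun q => (Fin.castLE hk q.1, q.2)) fun q => (q.1.1, q.2)
  left_inv p := by
    dsimp only
    split_ifs with h <;> rfl
  right_inv q := by
    rcases q with ⟨j, a⟩ | ⟨⟨j, hj⟩, a⟩
    · simp
    · exact dif_neg (not_lt.2 hj)

theorem joinConfig_eq (hk : k ≤ N) (x : UnitAddTorus (Fin k × Fin 3))
    (y : UnitAddTorus ({j : Fin N // k ≤ j.val} × Fin 3)) :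
    joinConfig x y = glue (splitCoord hk) (x, y) := by
  funext p
  simp only [joinConfig, glue, splitCoord, Equiv.coe_fn_mk]
  split_ifs <;> rfl

theorem prodSymbol_glue (hk : k ≤ N) (ξ : Fin k × Fin 3 → ℤ)
    (ζ : {j : Fin N // k ≤ j.val} × Fin 3 → ℤ) :
    prodSymbol L (firstParticles N k) (glue (splitCoord hk) (ξ, ζ))
      = prodSymbol L (firstParticles k k) ξ := by
  have h1 : firstParticles k k = Finset.univ := Finset.filter_true_of_mem fun j _ => j.2
  have h2 : firstParticles N k = Finset.univ.map (Fin.castLEEmb hk) := by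
    ext j
    simp only [firstParticles, Finset.mem_filter, Finset.mem_univ, true_and, Finset.mem_map,
      Fin.castLEEmb_apply]
    exact ⟨fun h => ⟨⟨j, h⟩, rfl⟩, fun ⟨i, hi⟩ => hi ▸ i.2⟩
  rw [prodSymbol, prodSymbol, h1, h2, Finset.prod_map]
  refine Finset.prod_congr rfl fun j _ => ?_
  simp [japaneseSymbol, laplaceSymbol, glue, splitCoord]

/-- A Sobolev bound for the wave function bounds its marginal density. -/
theorem sobolevBound_marginal (hk : k ≤ N) {ψ : L2N N} {M : ℝ} (hM : 0 ≤ M)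
    (h : opNormSq (S L N k) ψ ≤ ENNReal.ofReal M) : SobolevBound L k (marginal ψ k) M := by
  set e := splitCoord hk with he
  set w : (Fin k × Fin 3 → ℤ) → ℝ := prodSymbol L (firstParticles k k) with hw
  -- The symbol of S^{(1,k)} depends only on the first k frequencies, so ‖S^{(1,k)} ψ‖² is the sum
  -- over ζ of ‖S u_ζ‖².
  have hsum : ∑' ζ, wsum (sqw w) (partialCoeff e ψ ζ) ≤ ENNReal.ofReal M := by
    refine le_trans (le_of_eq ?_) h
    rw [S_opNormSq, wsum, tsum_glue e]
    refine tsum_congr fun ζ => tsum_congr fun ξ => ?_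
    rw [fc_partialCoeff, sqw, sqw, he, prodSymbol_glue]
  have hne : ∀ ζ, wsum (sqw w) (partialCoeff e ψ ζ) ≠ ⊤ := fun ζ =>
    ne_top_of_le_ne_top ENNReal.ofReal_ne_top ((ENNReal.le_tsum ζ).trans hsum)
  obtain ⟨G, hG, h0, h1, h2⟩ := exists_sum_rankOne (fun ζ => fm w (partialCoeff e ψ ζ)) hM (by
    simpa only [enorm_fm_sq (hne _)] using hsum)
  refine ⟨G, fun f g => (hG f g).unique ?_, h0, h1, h2⟩
  have hS : ∀ f : (S L k k).domain, S L k k f = fm w (f : L2N k) := fun f => by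
    rw [fm, dif_pos (show (f : L2N k) ∈ (fourierMultiplier w).domain from f.2)]
    rfl
  have hf : ∀ f : (S L k k).domain, wsum (sqw w) (f : L2N k) ≠ ⊤ := fun f =>
    mem_domain_fourierMultiplier.1 f.2
  have h3 := hasSum_kernelForm e ψ (S L k k f) (S L k k g)
  have h4 : (fun x x' => ∫ y, ψ (glue e (x, y)) * conj (ψ (glue e (x', y)))) = marginal ψ k := by
    funext x x'
    simp only [marginal, joinConfig_eq hk, he]
  rw [h4] at h3
  convert h3 using 1
  funext ζ
  -- Self-adjointness of S moves it from the test functions f and g onto u_ζ.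
  rw [hS, hS, inner_fm_left (hf f) (hne ζ), ← inner_fm_left (hne ζ) (hf g)]

end Marginal

end QuinticBose

end

theorem mainTheorem10 (L : ℝ) (hL : 0 < L)
    (V : (Fin 3 → ℝ) × (Fin 3 → ℝ) → ℝ)
    (hV_smooth : ContDiff ℝ ∞ V) (hV_supp : HasCompactSupport V) (hV_nonneg : ∀ z, 0 ≤ V z)
    (hV_symm : ∀ x y, V (x, y) = V (y, x))
    (β : ℝ) (hβ : β < 1 / 8) :
    (∃ N₀ : ℝ → ℕ → ℕ,
      (∀ k : ℕ, 1 ≤ k → Tendsto (fun c₁ : ℝ => N₀ c₁ k) (𝓝[<] 1) atTop) ∧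
      ∀ c₁ : ℝ, 0 ≤ c₁ → c₁ < 1 → ∀ k : ℕ, 1 ≤ k → ∀ N : ℕ, N₀ c₁ k < N →
        ∀ ψ : QuinticBose.L2N N, QuinticBose.IsBosonic ψ →
          ENNReal.ofReal (c₁ ^ k) *
              (QuinticBose.opNormSq (QuinticBose.S L N k) ψ +
                (N : ℝ≥0∞)⁻¹ * QuinticBose.opNormSq (QuinticBose.S₁S L N (k - 1)) ψ) ≤
            QuinticBose.powExpectation (QuinticBose.shiftedHamiltonian V β L N)
              (QuinticBose.shiftedEnergyForm V β L N) k ψ) ∧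
    (∀ C : ℝ, 0 < C → ∃ C' : ℝ, 0 < C' ∧ ∀ k : ℕ, 1 ≤ k → ∃ N₁ : ℕ, ∀ N : ℕ, N₁ < N →
      ∀ ψ : ℝ → QuinticBose.L2N N,
        QuinticBose.IsSchrodingerSolution (QuinticBose.hamiltonian V β L N) ψ →
        (∀ t, QuinticBose.IsBosonic (ψ t)) →
        ‖ψ 0‖ = 1 →
        (∀ j : ℕ, 1 ≤ j →
          QuinticBose.powExpectation (QuinticBose.hamiltonian V β L N)
            (QuinticBose.energyForm V β L N) j (ψ 0) ≤ ENNReal.ofReal (C ^ j * (N : ℝ) ^ j)) →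
        ∀ t : ℝ,
          QuinticBose.SobolevBound L k (QuinticBose.marginal (ψ t) k) (C' ^ k)) := by
  refine ⟨QuinticBose.exists_threshold_function hL hV_smooth hV_supp hV_nonneg hβ, fun C hC => ?_⟩
  refine ⟨8 * (1 + C) ^ 2, by positivity, fun k hk => ?_⟩
  obtain ⟨N₁, hN₁⟩ := QuinticBose.exists_opNormSq_solution_le hL hV_smooth hV_supp hV_nonneg hβ hC hk
  refine ⟨N₁, fun N hN ψ hψ hb h0 hE t => ?_⟩
  obtain ⟨hkN, h⟩ := hN₁ N hN
  exact QuinticBose.sobolevBound_marginal hkN (by positivity) (h ψ hψ hb h0 hE t)
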